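/- Let $m,n\ge 0$ and let $\mathbf B=\{\overline m<\cdots<\overline 1<1<\cdots<n\}$, $\mathbf B_+=\{\overline m,\dots,\overline 1\}$, $\mathbf B_-=\{1,\dots,n\}$, be regarded as the $\mathfrak{gl}(m,n)$-crystal of the vector representation, $$\overline m\xrightarrow{\overline{m-1}}\cdots\xrightarrow{\overline 1}\overline 1\xrightarrow{0}1\xrightarrow{1}\cdots\xrightarrow{n-1}n ,$$ with $b$ of weight $\epsilon_b$. Tensor products of crystals are formed by the following rule. Let $(\epsilon_a,\epsilon_b)=\pm\delta_{ab}$ (sign $+$ for $a\in\mathbf B_+$, $-$ for $a\in\mathbf B_-$), let $\alpha_i=\epsilon_b-\epsilon_{b'}$ for each arrow $b\xrightarrow{i}b'$ of $\mathbf B$, let $\ell_i=1$ for $i=\overline{m-1},\dots,\overline1,0$ and $\ell_i=-1$ for $i=1,\dots,n-1$, and let $\ell_i\langle h_i,\lambda\rangle=(\alpha_i,\lambda)$; let $\varepsilon_i(b)$, $\varphi_i(b)$ be the largest $k$ with $\tilde e_i^kb\neq0$, $\tilde f_i^kb\ne0$. Weights add, and: * for $i=\overline{m-1},\dots,\overline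 1$: $\tilde e_i(x\otimes y)$ is $\tilde e_ix\otimes y$ if $\varphi_i(x)\ge\varepsilon_i(y)$ and $x\otimes\tilde e_iy$ otherwise; $\tilde f_i(x\otimes y)$ is $\tilde f_ix\otimes y$ if $\varphi_i(x)>\varepsilon_i(y)$ and $x\otimes\tilde f_iy$ otherwise; * for $i=1,\dots,n-1$: $\tilde e_i(x\otimes y)$ is $x\otimes\tilde e_iy$ if $\varphi_i(y)\ge\varepsilon_i(x)$ and $\tilde e_ix\otimes y$ otherwise; $\tilde f_i(x\otimes y)$ is $x\otimes\tilde f_iy$ if $\varphi_i(y)>\varepsilon_i(x)$ and $\tilde f_ix\otimes y$ otherwise; * for $i=0$: $\tilde e_0$ and $\tilde f_0$ act on the first factor if $\langle h_0,\mathrm{wt}(x)\rangle>0$, and on the second factor if $\langle h_0,\mathrm{wt}(x)\rangle=0$. A semistandard tableau of shape a Young diagram $Y$ is a filling of $Y$ by elements of $\mathbf B$ such that rows and columns are weakly increasing (rows from left to right, columns from top to bottom), no element of $\mathbf B_-$ is repeated in a row and no element of $\mathbf B_+$ is repeated in a column; $B(Y)$ is the set of these. An admissible reading of $Y$ is a listing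 of its $N$ boxes in which a box comes before every other box that lies weakly below and weakly to the left of it; it embeds $B(Y)$ into $\mathbf B^{\otimes N}$. A Young diagram is an $(m,n)$-hook diagram if its $(m+1)$-st row has at most $n$ boxes. Let $Y_0$ be an $(m,n)$-hook Young diagram, and let $\mathcal Y$ be the set of all $(m,n)$-hook Young diagrams obtained from $Y_0$ by adding one box to a co-corner of $Y_0$. Choose an admissible reading of every Young diagram. Then: 1. for every Young diagram $Y$ the image of $B(Y)$ in $\mathbf B^{\otimes N}$ is stable under all $\tilde e_i$ and $\tilde f_i$ (as operators with values in the crystal or $0$), so that $B(Y)$ is a crystal; 2. for each $Y\in\mathcal Y$ the crystal $B(Y)$ is connected (and nonempty); 3. there is an isomorphism of crystals (a bijection that preserves weights and commutes with all $\tilde e_i$, $\tilde f_i$) $$B(Y_0)\otimes\mathbf B\;\cong\;\bigoplus_{Y\in\mathcal Y}B(Y),$$ which is therefore the decomposition of $B(Y_0)\otimes\mathbf B$ into connected components, and which sends $T\otimes c$ to the tableau obtained from $T$ by column bumping: $c$ slides into the first column, where it replaces the topmost entry $a$ with $c<a$ or $c=a\in\mathbf B_+$, and $a$ is bumped out and slides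 into the next column in the same way, and so on; a letter for which there is no such entry is put at the bottom of the column (or forms a new column, if no column is left), and the procedure stops. -/

import Mathlib

namespace GLCrystal

/-! ### Letters, nodes, weights for `gl(m,n)` -/

/-- The ordered alphabet `𝐁 = {m̄ < ⋯ < 1̄ < 1 < ⋯ < n}`. The letters with value `< m` are
`m̄, …, 1̄` (the set `𝐁₊`), those with value `≥ m` are `1, …, n` (the set `𝐁₋`). -/
abbrev Letter (m n : ℕ) : Type := Fin (m + n)

/-- Membership in `𝐁₊`. -/
def Letter.IsPlus {m n : ℕ} (b : Letter m n) : Prop := b.val < m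

instance {m n : ℕ} (b : Letter m n) : Decidable b.IsPlus := Nat.decLt _ _

/-- The index set `I` of simple roots: the node with value `i` joins the consecutive letters
with values `i` and `i + 1`. So `0, …, m - 2` are the nodes `\overline{m-1}, …, 1̄`, the value
`m - 1` is the odd node, and `m, …, m + n - 2` are the nodes `1, …, n - 1`. -/
abbrev Node (m n : ℕ) : Type := {i : ℕ // i + 1 < m + n}

/-- The letter at the source of the `i`-arrow of `𝐁`. -/
def Node.src {m n : ℕ} (i : Node m n) : Letter m n := ⟨i.1, by have := i.2; omega⟩

/-- The letter at the target of the `i`-arrow of `𝐁`. -/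
def Node.tgt {m n : ℕ} (i : Node m n) : Letter m n := ⟨i.1 + 1, i.2⟩

/-- The odd node is the one that joins `1̄` and `1`. -/
def Node.IsOdd {m n : ℕ} (i : Node m n) : Prop := i.1 + 1 = m

instance {m n : ℕ} (i : Node m n) : Decidable i.IsOdd := Nat.decEq _ _

/-- The weight lattice `P = ⨁_b ℤ ε_b`. -/
abbrev Weight (m n : ℕ) : Type := Letter m n → ℤ

/-- The symmetric form on `P`: `(ε_a, ε_a) = 1` on `𝐁₊`, `-1` on `𝐁₋`, and `0` off the diagonal. -/
def form {m n : ℕ} (μ ν : Weight m n) : ℤ :=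
  ∑ b, (if b.IsPlus then 1 else -1) * (μ b * ν b)

/-- The simple root `α_i`. -/
def simpleRoot {m n : ℕ} (i : Node m n) : Weight m n :=
  Pi.single i.src 1 - Pi.single i.tgt 1

/-- The sign `ℓ_i`: it is `1` on the nodes `\overline{m-1}, …, 1̄` and on the odd node, and `-1`
on the nodes `1, …, n - 1`. -/
def ell {m n : ℕ} (i : Node m n) : ℤ := if i.1 < m then 1 else -1

/-- The value `⟨h_i, μ⟩` of the simple coroot, determined by `ℓ_i ⟨h_i, μ⟩ = (α_i, μ)`. -/
def coroot {m n : ℕ} (i : Node m n) (μ : Weight m n) : ℤ := ell i * form (simpleRoot i) μ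

/-! ### Crystals -/

/-- A `gl(m,n)`-crystal on the vertex set `X`: a graph with arrows coloured by the nodes and a
weight function. `e i x = none` means `ẽ_i x = 0`. The four laws on `ε` and `φ` say that
`ε i x` and `φ i x` are the largest `k` with `ẽ_i ^ k x ≠ 0` and `f̃_i ^ k x ≠ 0`. -/
structure Crystal (m n : ℕ) (X : Type) where
  wt : X → Weight m n
  e : Node m n → X → Option X
  f : Node m n → X → Option X
  ε : Node m n → X → ℕ
  φ : Node m n → X → ℕ
  f_eq_some : ∀ i x y, f i x = some y ↔ e i y = some x
  wt_f : ∀ i x y, f i x = some y → wt y = wt x - simpleRoot i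
  e_eq_none : ∀ i x, e i x = none ↔ ε i x = 0
  f_eq_none : ∀ i x, f i x = none ↔ φ i x = 0
  ε_e : ∀ i x y, e i x = some y → ε i x = ε i y + 1
  φ_f : ∀ i x y, f i x = some y → φ i x = φ i y + 1
  even_law : ∀ i x, ¬ i.IsOdd → coroot i (wt x) = (φ i x : ℤ) - ε i x
  odd_nonneg : ∀ i x, i.IsOdd → 0 ≤ coroot i (wt x)
  odd_law : ∀ i x, i.IsOdd → φ i x + ε i x = if coroot i (wt x) = 0 then 0 else 1

theorem coroot_eq {m n : ℕ} (i : Node m n) (μ : Weight m n) :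
    coroot i μ = μ i.src + (if i.IsOdd then 1 else -1) * μ i.tgt := by
  have h1 : form (simpleRoot i) μ = (if i.src.IsPlus then 1 else -1) * μ i.src
      - (if i.tgt.IsPlus then 1 else -1) * μ i.tgt := by
    simp only [form, simpleRoot, Pi.sub_apply, Pi.single_apply, sub_mul, mul_sub,
      Finset.sum_sub_distrib, ite_mul, mul_ite, one_mul, zero_mul, mul_zero, neg_mul]
    simp
  obtain ⟨i, hi⟩ := i
  rw [coroot, h1]
  simp only [ell, Letter.IsPlus, Node.src, Node.tgt, Node.IsOdd]
  by_cases h1 : i < m <;> by_cases h2 : i + 1 < m <;> by_cases h3 : i + 1 = m <;>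
    first
    | omega
    | (simp only [h1, h2, h3, lt_irrefl, if_true, if_false]; ring)

theorem coroot_add {m n : ℕ} (i : Node m n) (μ ν : Weight m n) :
    coroot i (μ + ν) = coroot i μ + coroot i ν := by
  simp only [coroot_eq, Pi.add_apply]; ring

theorem Node.src_ne_tgt {m n : ℕ} (i : Node m n) : i.src ≠ i.tgt := by
  simp [Node.src, Node.tgt]

/-- The crystal `𝐁` of the vector representation: `f̃_i` sends the source of the node `i` to its
target, and `b` has weight `ε_b`. -/
def letterCrystal (m n : ℕ) : Crystal m n (Letter m n) where
  wt b := Pi.single b 1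
  e i b := if b = i.tgt then some i.src else none
  f i b := if b = i.src then some i.tgt else none
  ε i b := if b = i.tgt then 1 else 0
  φ i b := if b = i.src then 1 else 0
  f_eq_some i x y := by
    have := i.src_ne_tgt
    constructor <;> intro h <;> split_ifs at h with h' <;> simp_all
  wt_f i x y h := by
    split_ifs at h with h'
    simp only [Option.some.injEq] at h
    subst h h'
    simp [simpleRoot]
  e_eq_none i x := by split_ifs <;> simp
  f_eq_none i x := by split_ifs <;> simp
  ε_e i x y h := by
    have := i.src_ne_tgt
    split_ifs at h with h'
    simp only [Option.some.injEq] at h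
    subst h h'
    simp [this]
  φ_f i x y h := by
    have := i.src_ne_tgt
    split_ifs at h with h'
    simp only [Option.some.injEq] at h
    subst h h'
    simp [this.symm]
  even_law i x hi := by
    have := i.src_ne_tgt
    rw [coroot_eq, if_neg hi]
    simp only [Pi.single_apply, eq_comm (a := x)]
    split_ifs <;> simp_all
  odd_nonneg i x hi := by
    rw [coroot_eq, if_pos hi]
    simp only [Pi.single_apply]
    split_ifs <;> simp
  odd_law i x hi := by
    have := i.src_ne_tgt
    rw [coroot_eq, if_pos hi]
    simp only [Pi.single_apply, eq_comm (a := x)]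
    split_ifs <;> simp_all

/-- The one-vertex crystal `𝐁^{⊗ 0}` (of the trivial module). -/
def trivialCrystal (m n : ℕ) : Crystal m n (Fin 0 → Letter m n) where
  wt _ := 0
  e _ _ := none
  f _ _ := none
  ε _ _ := 0
  φ _ _ := 0
  f_eq_some := by simp
  wt_f := by simp
  e_eq_none := by simp
  f_eq_none := by simp
  ε_e := by simp
  φ_f := by simp
  even_law := by simp [coroot_eq]
  odd_nonneg := by simp [coroot_eq]
  odd_law := by simp [coroot_eq]

namespace Crystal

variable {m n : ℕ} {X Z : Type}

theorem φ_e (C : Crystal m n X) {i : Node m n} {x y : X} (h : C.e i x = some y) :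
    C.φ i y = C.φ i x + 1 := C.φ_f i y x ((C.f_eq_some i y x).2 h)

theorem ε_f (C : Crystal m n X) {i : Node m n} {x y : X} (h : C.f i x = some y) :
    C.ε i y = C.ε i x + 1 := C.ε_e i y x ((C.f_eq_some i x y).1 h)

theorem coroot_f_odd (C : Crystal m n X) {i : Node m n} (hi : i.IsOdd) {x y : X}
    (h : C.f i x = some y) : coroot i (C.wt y) = coroot i (C.wt x) := by
  have := i.src_ne_tgt
  rw [C.wt_f i x y h]
  simp only [coroot_eq, hi, if_true, Pi.sub_apply, simpleRoot, Pi.single_apply, this, this.symm,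
    if_false]
  ring

/-- The action of `ẽ_i` on `x ⊗ y`: the three cases of the tensor product rule
(`i` odd, where `ℓ_i > 0`; `i` even with `ℓ_i > 0`; `i` even with `ℓ_i < 0`). -/
def tensorE (C : Crystal m n X) (D : Crystal m n Z) (i : Node m n) (p : X × Z) :
    Option (X × Z) :=
  if i.IsOdd then
    if 0 < coroot i (C.wt p.1) then (C.e i p.1).map (fun x => (x, p.2))
    else (D.e i p.2).map (fun z => (p.1, z))
  else if 0 < ell i then
    if C.φ i p.1 ≥ D.ε i p.2 then (C.e i p.1).map (fun x => (x, p.2))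
    else (D.e i p.2).map (fun z => (p.1, z))
  else
    if D.φ i p.2 ≥ C.ε i p.1 then (D.e i p.2).map (fun z => (p.1, z))
    else (C.e i p.1).map (fun x => (x, p.2))

/-- The action of `f̃_i` on `x ⊗ y`. -/
def tensorF (C : Crystal m n X) (D : Crystal m n Z) (i : Node m n) (p : X × Z) :
    Option (X × Z) :=
  if i.IsOdd then
    if 0 < coroot i (C.wt p.1) then (C.f i p.1).map (fun x => (x, p.2))
    else (D.f i p.2).map (fun z => (p.1, z))
  else if 0 < ell i then
    if C.φ i p.1 > D.ε i p.2 then (C.f i p.1).map (fun x => (x, p.2))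
    else (D.f i p.2).map (fun z => (p.1, z))
  else
    if D.φ i p.2 > C.ε i p.1 then (D.f i p.2).map (fun z => (p.1, z))
    else (C.f i p.1).map (fun x => (x, p.2))

/-- `ε_i (x ⊗ y)`. -/
def tensorε (C : Crystal m n X) (D : Crystal m n Z) (i : Node m n) (p : X × Z) : ℕ :=
  if i.IsOdd then
    if 0 < coroot i (C.wt p.1) then C.ε i p.1 else D.ε i p.2
  else if 0 < ell i then C.ε i p.1 + (D.ε i p.2 - C.φ i p.1)
  else D.ε i p.2 + (C.ε i p.1 - D.φ i p.2)

/-- `φ_i (x ⊗ y)`. -/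
def tensorφ (C : Crystal m n X) (D : Crystal m n Z) (i : Node m n) (p : X × Z) : ℕ :=
  if i.IsOdd then
    if 0 < coroot i (C.wt p.1) then C.φ i p.1 else D.φ i p.2
  else if 0 < ell i then D.φ i p.2 + (C.φ i p.1 - D.ε i p.2)
  else C.φ i p.1 + (D.φ i p.2 - C.ε i p.1)

/-- The tensor product `C ⊗ D` of crystals; the pair `(x, y)` stands for `x ⊗ y`. -/
def tensor (C : Crystal m n X) (D : Crystal m n Z) : Crystal m n (X × Z) where
  wt p := C.wt p.1 + D.wt p.2
  e := tensorE C D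
  f := tensorF C D
  ε := tensorε C D
  φ := tensorφ C D
  f_eq_some i p q := by
    obtain ⟨x, z⟩ := p
    obtain ⟨x', z'⟩ := q
    simp only [tensorF, tensorE]
    constructor
    · intro h
      split_ifs at h <;> obtain ⟨a, ha, hq⟩ := Option.map_eq_some_iff.1 h <;> cases hq
      · have := C.coroot_f_odd ‹_› ha
        rw [if_pos ‹_›, if_pos (by omega), (C.f_eq_some i _ _).1 ha]; rfl
      · rw [if_pos ‹_›, if_neg ‹_›, (D.f_eq_some i _ _).1 ha]; rfl
      · have := C.φ_f i _ _ ha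
        rw [if_neg ‹_›, if_pos ‹_›, if_pos (by omega), (C.f_eq_some i _ _).1 ha]; rfl
      · have := D.ε_f ha
        rw [if_neg ‹_›, if_pos ‹_›, if_neg (by omega), (D.f_eq_some i _ _).1 ha]; rfl
      · have := D.φ_f i _ _ ha
        rw [if_neg ‹_›, if_neg ‹_›, if_pos (by omega), (D.f_eq_some i _ _).1 ha]; rfl
      · have := C.ε_f ha
        rw [if_neg ‹_›, if_neg ‹_›, if_neg (by omega), (C.f_eq_some i _ _).1 ha]; rfl
    · intro h
      split_ifs at h <;> obtain ⟨a, ha, hq⟩ := Option.map_eq_some_iff.1 h <;> cases hq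
      · have hf := (C.f_eq_some i _ _).2 ha
        have := C.coroot_f_odd ‹_› hf
        rw [if_pos ‹_›, if_pos (by omega), hf]; rfl
      · rw [if_pos ‹_›, if_neg ‹_›, (D.f_eq_some i _ _).2 ha]; rfl
      · have := C.φ_e ha
        rw [if_neg ‹_›, if_pos ‹_›, if_pos (by omega), (C.f_eq_some i _ _).2 ha]; rfl
      · have := D.ε_e i _ _ ha
        rw [if_neg ‹_›, if_pos ‹_›, if_neg (by omega), (D.f_eq_some i _ _).2 ha]; rfl
      · have := D.φ_e ha
        rw [if_neg ‹_›, if_neg ‹_›, if_pos (by omega), (D.f_eq_some i _ _).2 ha]; rfl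
      · have := C.ε_e i _ _ ha
        rw [if_neg ‹_›, if_neg ‹_›, if_neg (by omega), (C.f_eq_some i _ _).2 ha]; rfl
  wt_f i p q h := by
    simp only [tensorF] at h
    split_ifs at h <;> obtain ⟨a, ha, rfl⟩ := Option.map_eq_some_iff.1 h <;>
      first
      | (rw [C.wt_f i _ _ ha]; abel)
      | (rw [D.wt_f i _ _ ha]; abel)
  e_eq_none i p := by
    simp only [tensorE, tensorε]
    split_ifs <;> simp only [Option.map_eq_none_iff, C.e_eq_none, D.e_eq_none] <;> omega
  f_eq_none i p := by
    simp only [tensorF, tensorφ]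
    split_ifs <;> simp only [Option.map_eq_none_iff, C.f_eq_none, D.f_eq_none] <;> omega
  ε_e i p q h := by
    simp only [tensorE] at h
    simp only [tensorε]
    split_ifs at h <;> obtain ⟨a, ha, rfl⟩ := Option.map_eq_some_iff.1 h
    · have h1 := C.ε_e i _ _ ha
      have h2 := C.coroot_f_odd ‹_› ((C.f_eq_some i _ _).2 ha)
      rw [if_pos ‹_›, if_pos ‹_›, if_pos ‹_›, if_pos (by dsimp only; omega), h1]
    · have h1 := D.ε_e i _ _ ha
      rw [if_pos ‹_›, if_neg ‹_›, if_pos ‹_›, if_neg ‹_›, h1]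
    · have h1 := C.ε_e i _ _ ha
      have h2 := C.φ_e ha
      simp only [*, if_false, if_true] at *; omega
    · have h1 := D.ε_e i _ _ ha
      have h2 := D.φ_e ha
      simp only [*, if_false, if_true] at *; omega
    · have h1 := D.ε_e i _ _ ha
      have h2 := D.φ_e ha
      simp only [*, if_false, if_true] at *; omega
    · have h1 := C.ε_e i _ _ ha
      have h2 := C.φ_e ha
      simp only [*, if_false, if_true] at *; omega
  φ_f i p q h := by
    simp only [tensorF] at h
    simp only [tensorφ]
    split_ifs at h <;> obtain ⟨a, ha, rfl⟩ := Option.map_eq_some_iff.1 h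
    · have h1 := C.φ_f i _ _ ha
      have h2 := C.coroot_f_odd ‹_› ha
      rw [if_pos ‹_›, if_pos ‹_›, if_pos ‹_›, if_pos (by dsimp only; omega), h1]
    · have h1 := D.φ_f i _ _ ha
      rw [if_pos ‹_›, if_neg ‹_›, if_pos ‹_›, if_neg ‹_›, h1]
    · have h1 := C.φ_f i _ _ ha
      have h2 := C.ε_f ha
      simp only [*, if_false, if_true] at *; omega
    · have h1 := D.φ_f i _ _ ha
      have h2 := D.ε_f ha
      simp only [*, if_false, if_true] at *; omega
    · have h1 := D.φ_f i _ _ ha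
      have h2 := D.ε_f ha
      simp only [*, if_false, if_true] at *; omega
    · have h1 := C.φ_f i _ _ ha
      have h2 := C.ε_f ha
      simp only [*, if_false, if_true] at *; omega
  even_law i p hi := by
    have h1 := C.even_law i p.1 hi
    have h2 := D.even_law i p.2 hi
    rw [coroot_add]
    simp only [tensorε, tensorφ, if_neg hi]
    split_ifs <;> omega
  odd_nonneg i p hi := by
    rw [coroot_add]
    exact add_nonneg (C.odd_nonneg i _ hi) (D.odd_nonneg i _ hi)
  odd_law i p hi := by
    have h1 := C.odd_nonneg i p.1 hi
    have h2 := D.odd_nonneg i p.2 hi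
    have h3 := C.odd_law i p.1 hi
    have h4 := D.odd_law i p.2 hi
    rw [coroot_add]
    simp only [tensorε, tensorφ, if_pos hi]
    split_ifs at * <;> omega

/-- Transport of a crystal along a bijection of the vertex sets. -/
def transport (C : Crystal m n X) (g : Z ≃ X) : Crystal m n Z where
  wt z := C.wt (g z)
  e i z := (C.e i (g z)).map g.symm
  f i z := (C.f i (g z)).map g.symm
  ε i z := C.ε i (g z)
  φ i z := C.φ i (g z)
  f_eq_some i x y := by
    simp [Equiv.symm_apply_eq, C.f_eq_some]
  wt_f i x y h := by
    simp only [Option.map_eq_some_iff, Equiv.symm_apply_eq, exists_eq_right] at h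
    exact C.wt_f i _ _ h
  e_eq_none i x := by simp [C.e_eq_none]
  f_eq_none i x := by simp [C.f_eq_none]
  ε_e i x y h := by
    simp only [Option.map_eq_some_iff, Equiv.symm_apply_eq, exists_eq_right] at h
    exact C.ε_e i _ _ h
  φ_f i x y h := by
    simp only [Option.map_eq_some_iff, Equiv.symm_apply_eq, exists_eq_right] at h
    exact C.φ_f i _ _ h
  even_law i x := C.even_law i (g x)
  odd_nonneg i x := C.odd_nonneg i (g x)
  odd_law i x := C.odd_law i (g x)

/-- The range of `ψ` is stable under all `ẽ_i` and `f̃_i` (as a subset of `X ⊔ {0}`). -/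
def StableUnder (C : Crystal m n X) (ψ : Z → X) : Prop :=
  ∀ i z x, (C.e i (ψ z) = some x ∨ C.f i (ψ z) = some x) → x ∈ Set.range ψ

/-- The crystal structure induced on `Z` by an injection `ψ` of `Z` into a crystal whose range is
stable under the `ẽ_i` and `f̃_i`: thus `ψ (ẽ_i z) = ẽ_i (ψ z)` and `ψ (f̃_i z) = f̃_i (ψ z)`. -/
noncomputable def induced (C : Crystal m n X) (ψ : Z → X) (hψ : Function.Injective ψ)
    (hst : C.StableUnder ψ) : Crystal m n Z where
  wt z := C.wt (ψ z)
  e i z := (C.e i (ψ z)).bind (Function.partialInv ψ)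
  f i z := (C.f i (ψ z)).bind (Function.partialInv ψ)
  ε i z := C.ε i (ψ z)
  φ i z := C.φ i (ψ z)
  f_eq_some i x y := by
    have key : ∀ (a : Option X) (z : Z),
        a.bind (Function.partialInv ψ) = some z ↔ a = some (ψ z) := by
      intro a z
      cases a with
      | none => simp
      | some a => simp [hψ.isPartialInv z a, eq_comm]
    rw [key, key, C.f_eq_some]
  wt_f i x y h := by
    obtain ⟨a, ha, hy⟩ := Option.bind_eq_some_iff.1 h
    rw [hψ.isPartialInv y a] at hy
    subst hy
    exact C.wt_f i _ _ ha
  e_eq_none i x := by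
    rw [← C.e_eq_none]
    constructor
    · intro h
      by_contra h'
      obtain ⟨a, ha⟩ := Option.ne_none_iff_exists'.1 h'
      obtain ⟨z, rfl⟩ := hst i x a (Or.inl ha)
      rw [ha] at h
      simp [Function.partialInv_left hψ] at h
    · intro h
      simp [h]
  f_eq_none i x := by
    rw [← C.f_eq_none]
    constructor
    · intro h
      by_contra h'
      obtain ⟨a, ha⟩ := Option.ne_none_iff_exists'.1 h'
      obtain ⟨z, rfl⟩ := hst i x a (Or.inr ha)
      rw [ha] at h
      simp [Function.partialInv_left hψ] at h
    · intro h
      simp [h]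
  ε_e i x y h := by
    obtain ⟨a, ha, hy⟩ := Option.bind_eq_some_iff.1 h
    rw [hψ.isPartialInv y a] at hy
    subst hy
    exact C.ε_e i _ _ ha
  φ_f i x y h := by
    obtain ⟨a, ha, hy⟩ := Option.bind_eq_some_iff.1 h
    rw [hψ.isPartialInv y a] at hy
    subst hy
    exact C.φ_f i _ _ ha
  even_law i x := C.even_law i (ψ x)
  odd_nonneg i x := C.odd_nonneg i (ψ x)
  odd_law i x := C.odd_law i (ψ x)

/-- The direct sum (disjoint union) of a family of crystals. -/
def directSum {S : Type} {V : S → Type} (C : ∀ s, Crystal m n (V s)) :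
    Crystal m n (Σ s, V s) where
  wt p := (C p.1).wt p.2
  e i p := ((C p.1).e i p.2).map (Sigma.mk p.1)
  f i p := ((C p.1).f i p.2).map (Sigma.mk p.1)
  ε i p := (C p.1).ε i p.2
  φ i p := (C p.1).φ i p.2
  f_eq_some i p q := by
    obtain ⟨s, x⟩ := p
    obtain ⟨t, y⟩ := q
    simp only [Option.map_eq_some_iff]
    constructor
    · rintro ⟨a, ha, h⟩
      cases h
      exact ⟨x, ((C _).f_eq_some i _ _).1 ha, rfl⟩
    · rintro ⟨a, ha, h⟩
      cases h
      exact ⟨y, ((C _).f_eq_some i _ _).2 ha, rfl⟩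
  wt_f i p q h := by
    obtain ⟨a, ha, rfl⟩ := Option.map_eq_some_iff.1 h
    exact (C p.1).wt_f i _ _ ha
  e_eq_none i p := by simp [(C p.1).e_eq_none]
  f_eq_none i p := by simp [(C p.1).f_eq_none]
  ε_e i p q h := by
    obtain ⟨a, ha, rfl⟩ := Option.map_eq_some_iff.1 h
    exact (C p.1).ε_e i _ _ ha
  φ_f i p q h := by
    obtain ⟨a, ha, rfl⟩ := Option.map_eq_some_iff.1 h
    exact (C p.1).φ_f i _ _ ha
  even_law i p := (C p.1).even_law i p.2
  odd_nonneg i p := (C p.1).odd_nonneg i p.2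
  odd_law i p := (C p.1).odd_law i p.2

/-- A crystal is connected if it is nonempty and any two vertices are joined by an undirected
path of arrows. -/
def Connected (C : Crystal m n X) : Prop :=
  Nonempty X ∧ ∀ x y, Relation.EqvGen (fun a b => ∃ i, C.f i a = some b) x y

/-- An isomorphism of crystals: a bijection of the vertices that preserves the weights and
commutes with all `ẽ_i` and `f̃_i`. -/
structure Iso (C : Crystal m n X) (D : Crystal m n Z) extends X ≃ Z where
  wt_map : ∀ x, D.wt (toFun x) = C.wt x
  e_map : ∀ i x, D.e i (toFun x) = (C.e i x).map toFun
  f_map : ∀ i x, D.f i (toFun x) = (C.f i x).map toFun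

end Crystal

/-- The crystal `𝐁^{⊗ N}`; the word `w` stands for `w 0 ⊗ w 1 ⊗ ⋯ ⊗ w (N - 1)`. -/
def wordCrystal (m n : ℕ) : (N : ℕ) → Crystal m n (Fin N → Letter m n)
  | 0 => trivialCrystal m n
  | N + 1 => ((letterCrystal m n).tensor (wordCrystal m n N)).transport
      (Fin.consEquiv (fun _ : Fin (N + 1) => Letter m n)).symm

/-! ### Tableaux and readings -/

/-- The two-box row with the entry `a` to the left of the entry `b` is semistandard. -/
def RowOK {m n : ℕ} (a b : Letter m n) : Prop := a < b ∨ (a = b ∧ a.IsPlus)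

/-- The two-box column with the entry `a` above the entry `b` is semistandard. -/
def ColOK {m n : ℕ} (a b : Letter m n) : Prop := a < b ∨ (a = b ∧ ¬ a.IsPlus)

instance {m n : ℕ} (a b : Letter m n) : Decidable (RowOK a b) := by
  unfold RowOK; infer_instance

/-- The boxes of a Young diagram; `(i, j)` is the box in row `i` and column `j`, from `0`. -/
abbrev Box (Y : YoungDiagram) : Type := {c : ℕ × ℕ // c ∈ Y}

/-- The set `B(Y)` of semistandard tableaux of shape `Y` with entries in `𝐁`. -/
@[ext]
structure Tableau (m n : ℕ) (Y : YoungDiagram) where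
  entry : Box Y → Letter m n
  row_ok : ∀ β β' : Box Y, β.1.1 = β'.1.1 → β.1.2 < β'.1.2 → RowOK (entry β) (entry β')
  col_ok : ∀ β β' : Box Y, β.1.2 = β'.1.2 → β.1.1 < β'.1.1 → ColOK (entry β) (entry β')

/-- `β` is strictly higher than `β'`: it lies weakly above and weakly to the right of `β'`. -/
def StrictlyHigher {Y : YoungDiagram} (β β' : Box Y) : Prop :=
  β ≠ β' ∧ β.1.1 ≤ β'.1.1 ∧ β'.1.2 ≤ β.1.2

/-- An admissible reading: a listing of the boxes of `Y` in which `β` comes before `β'` whenever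
`β` is strictly higher than `β'`. -/
structure AdmissibleReading (Y : YoungDiagram) where
  box : Fin Y.card ≃ Box Y
  admissible : ∀ p q, StrictlyHigher (box p) (box q) → p < q

/-- The embedding of `B(Y)` into `𝐁^{⊗ N}` given by a reading. -/
def AdmissibleReading.word {Y : YoungDiagram} (r : AdmissibleReading Y) {m n : ℕ}
    (T : Tableau m n Y) : Fin Y.card → Letter m n := fun p => T.entry (r.box p)

theorem AdmissibleReading.word_injective {Y : YoungDiagram} (r : AdmissibleReading Y)
    {m n : ℕ} : Function.Injective (r.word (m := m) (n := n)) := by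
  intro T T' h
  ext β : 2
  have := congrFun h (r.box.symm β)
  simpa [AdmissibleReading.word] using this

/-- The image of `B(Y)` in `𝐁^{⊗ N}` is stable under the operators `ẽ_i` and `f̃_i`. -/
def AdmissibleReading.Stable {Y : YoungDiagram} (r : AdmissibleReading Y) (m n : ℕ) : Prop :=
  (wordCrystal m n Y.card).StableUnder (r.word (m := m) (n := n))

/-- The crystal structure on `B(Y)` induced from `𝐁^{⊗ N}` by an admissible reading. -/
noncomputable def tableauCrystal {m n : ℕ} {Y : YoungDiagram} (r : AdmissibleReading Y)
    (hst : r.Stable m n) : Crystal m n (Tableau m n Y) :=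
  (wordCrystal m n Y.card).induced r.word r.word_injective hst

/-! ### Hook diagrams and column bumping -/

/-- `(m,n)`-hook Young diagrams: row `m + 1` (counted from one) has at most `n` boxes. -/
def IsHook (m n : ℕ) (Y : YoungDiagram) : Prop := Y.rowLen m ≤ n

/-- `Y` is obtained from `Y₀` by adding one box to a co-corner of `Y₀`. -/
def AddsBox (Y₀ Y : YoungDiagram) : Prop := ∃ c, c ∉ Y₀ ∧ Y.cells = insert c Y₀.cells

/-- The set of `(m,n)`-hook Young diagrams obtained from `Y₀` by adding a box to a co-corner. -/
abbrev HookExtension (m n : ℕ) (Y₀ : YoungDiagram) : Type :=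
  {Y : YoungDiagram // IsHook m n Y ∧ AddsBox Y₀ Y}

/-- The columns of a tableau, from left to right, each read from top to bottom. -/
def Tableau.columns {m n : ℕ} {Y : YoungDiagram} (T : Tableau m n Y) : List (List (Letter m n)) :=
  List.ofFn fun j : Fin (Y.rowLen 0) =>
    List.ofFn fun i : Fin (Y.colLen j) =>
      T.entry ⟨(i, j), YoungDiagram.mem_iff_lt_colLen.2 i.2⟩

/-- Sliding the letter `c` into a column: `c` replaces the topmost entry `a` for which the row
with entries `c`, `a` is semistandard, and `a` is bumped out; if there is none, then `c` is placed
at the bottom of the column and nothing is bumped out. -/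
def bumpColumn {m n : ℕ} : List (Letter m n) → Letter m n → List (Letter m n) × Option (Letter m n)
  | [], c => ([c], none)
  | a :: t, c =>
    if RowOK c a then (c :: t, some a) else (a :: (bumpColumn t c).1, (bumpColumn t c).2)

/-- Column bumping: `c` slides into the first column; an entry bumped out of a column slides into
the next column to the right, and forms a new column when there is none left. -/
def columnBump {m n : ℕ} : List (List (Letter m n)) → Letter m n → List (List (Letter m n))
  | [], c => [[c]]
  | t :: ts, c =>
    match (bumpColumn t c).2 with
    | none => (bumpColumn t c).1 :: ts
    | some a => (bumpColumn t c).1 :: columnBump ts a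

end GLCrystal

/-! All three claims rest on the signature rule for words (`listCrystal_f_eq_some_iff`): an
`i`-arrow changes exactly one source letter into the target letter, and bracketing selects which
one. At an even node with `ℓ_i > 0` every source letter is matched with a later target letter where
possible, and `f̃_i` acts on the leftmost unmatched source. For `ℓ_i < 0` left and right are
exchanged. At the odd node only the first letter that is a source or a target counts.

Stability and independence of the reading. In a semistandard filling the boxes of two consecutive
letters form strips. If the box selected by the bracketing had a neighbour that forbids the change,
the strip would contain a part of the word with too many letters of one kind, against the bracketing
condition (`CellList.not_below`, `CellList.not_right`). Once this is excluded, every box with one of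
the two letters is comparable with the selected box in the order that all readings respect. What is
read before and after it is then the same for every reading, and so is the selected box
(`CellList.balanced_unique`). These arguments are made once for abstract sets of cells;
transposition and a half turn carry them to the nodes with `ℓ_i < 0` and to `ẽ_i`. At the odd node
the obstructing neighbours are read earlier, so they would have been acted on instead.

Connectedness. No highest weight vertex is used. By induction on `k`, two tableaux with the same
entries `≥ k` are joined by a path (`Tableau.joined_of_agreeFrom`). In the induction step the
entries `< k` can be rearranged freely, by the induction hypothesis, until an arrow between `k - 1`
and `k` becomes applicable. Repeating this puts the letters `k` into a position determined by the
larger entries alone. For `k = m + n` the hypothesis is empty.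

Decomposition. The vertex `T ⊗ c` is modelled by the column word of `T` followed by `c`. Sliding a
letter into one column rewrites a word `p a q c` as `a p c q`; this preserves the weight and all
string lengths (`bumpWord_ε_φ`) and commutes with the arrows (`bumpWord_f`). Since the side of a
concatenation on which an operator acts depends only on weights and string lengths, both facts pass
from one column to the whole tableau (`columnBump_f`). Bumping is a bijection because it can be run
backwards from the added corner (`exists_columnBump_eq`). The new shape is a hook diagram because it
carries a semistandard tableau (`IsFilling.isHook`). -/

namespace GLCrystal

/-! ### Words as lists -/

/-- The disjoint union of the crystals `𝐁^{⊗ N}`, with words written as lists. -/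
def listCrystal (m n : ℕ) : Crystal m n (List (Letter m n)) :=
  (Crystal.directSum fun N => wordCrystal m n N).transport List.equivSigmaTuple

section ListCrystal

variable {m n : ℕ}

theorem equivSigmaTuple_ofFn {N : ℕ} (w : Fin N → Letter m n) :
    List.equivSigmaTuple (List.ofFn w) = ⟨N, w⟩ :=
  List.equivSigmaTuple.apply_symm_apply ⟨N, w⟩

theorem listCrystal_f_ofFn (N : ℕ) (i : Node m n) (w : Fin N → Letter m n) :
    (listCrystal m n).f i (List.ofFn w) = ((wordCrystal m n N).f i w).map List.ofFn := by
  change ((Crystal.directSum fun N => wordCrystal m n N).f i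
    (List.equivSigmaTuple (List.ofFn w))).map List.equivSigmaTuple.symm = _
  rw [equivSigmaTuple_ofFn]
  simp only [Crystal.directSum, Option.map_map]
  rfl

theorem wordCrystal_f_iff (N : ℕ) (i : Node m n) (w w' : Fin N → Letter m n) :
    (wordCrystal m n N).f i w = some w' ↔
      (listCrystal m n).f i (List.ofFn w) = some (List.ofFn w') := by
  rw [listCrystal_f_ofFn, Option.map_eq_some_iff]
  simp

theorem listCrystal_φ_ofFn (N : ℕ) (i : Node m n) (w : Fin N → Letter m n) :
    (listCrystal m n).φ i (List.ofFn w) = (wordCrystal m n N).φ i w := by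
  change (Crystal.directSum fun N => wordCrystal m n N).φ i
    (List.equivSigmaTuple (List.ofFn w)) = _
  rw [equivSigmaTuple_ofFn]
  rfl

theorem listCrystal_ε_ofFn (N : ℕ) (i : Node m n) (w : Fin N → Letter m n) :
    (listCrystal m n).ε i (List.ofFn w) = (wordCrystal m n N).ε i w := by
  change (Crystal.directSum fun N => wordCrystal m n N).ε i
    (List.equivSigmaTuple (List.ofFn w)) = _
  rw [equivSigmaTuple_ofFn]
  rfl

theorem listCrystal_wt_ofFn (N : ℕ) (w : Fin N → Letter m n) :
    (listCrystal m n).wt (List.ofFn w) = (wordCrystal m n N).wt w := by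
  change (Crystal.directSum fun N => wordCrystal m n N).wt
    (List.equivSigmaTuple (List.ofFn w)) = _
  rw [equivSigmaTuple_ofFn]
  rfl

theorem listCrystal_wt_cons (a : Letter m n) (w : List (Letter m n)) :
    (listCrystal m n).wt (a :: w) = (letterCrystal m n).wt a + (listCrystal m n).wt w := rfl

theorem listCrystal_ε_cons (i : Node m n) (a : Letter m n) (w : List (Letter m n)) :
    (listCrystal m n).ε i (a :: w) =
      (letterCrystal m n).tensorε (listCrystal m n) i (a, w) := rfl

theorem listCrystal_φ_cons (i : Node m n) (a : Letter m n) (w : List (Letter m n)) :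
    (listCrystal m n).φ i (a :: w) =
      (letterCrystal m n).tensorφ (listCrystal m n) i (a, w) := rfl

theorem listCrystal_f_cons (i : Node m n) (a : Letter m n) (w : List (Letter m n)) :
    (listCrystal m n).f i (a :: w) =
      ((letterCrystal m n).tensorF (listCrystal m n) i (a, w)).map fun p => p.1 :: p.2 := by
  have h1 : (listCrystal m n).f i (a :: w) =
      (((letterCrystal m n).tensorF (wordCrystal m n w.length) i (a, w.get)).map
        (Fin.consEquiv (fun _ : Fin (w.length + 1) => Letter m n)).symm.symm).map List.ofFn := by
    have := listCrystal_f_ofFn (w.length + 1) i (Fin.cons a w.get : Fin (w.length + 1) → Letter m n)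
    rw [List.ofFn_cons, List.ofFn_get] at this
    exact this
  have h2 : (listCrystal m n).f i w =
      ((wordCrystal m n w.length).f i w.get).map List.ofFn := by
    have := listCrystal_f_ofFn w.length i w.get
    rwa [List.ofFn_get] at this
  have h3 : (listCrystal m n).ε i w = (wordCrystal m n w.length).ε i w.get := rfl
  have h4 : (listCrystal m n).φ i w = (wordCrystal m n w.length).φ i w.get := rfl
  rw [h1]
  simp only [Crystal.tensorF, h2, h3, h4]
  split_ifs <;> simp only [Option.map_map] <;> congr 1 <;> funext x <;>
    simp [Fin.consEquiv]

@[simp] theorem listCrystal_ε_nil (i : Node m n) : (listCrystal m n).ε i [] = 0 := rfl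
@[simp] theorem listCrystal_φ_nil (i : Node m n) : (listCrystal m n).φ i [] = 0 := rfl
@[simp] theorem listCrystal_f_nil (i : Node m n) : (listCrystal m n).f i [] = none := rfl
@[simp] theorem listCrystal_wt_nil : (listCrystal m n).wt [] = 0 := rfl

theorem listCrystal_wt_append (u v : List (Letter m n)) :
    (listCrystal m n).wt (u ++ v) = (listCrystal m n).wt u + (listCrystal m n).wt v := by
  induction u with
  | nil => simp
  | cons a u ih => rw [List.cons_append, listCrystal_wt_cons, ih, listCrystal_wt_cons, add_assoc]

theorem listCrystal_wt_perm {u v : List (Letter m n)} (h : u.Perm v) :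
    (listCrystal m n).wt u = (listCrystal m n).wt v := by
  induction h with
  | nil => rfl
  | cons a _ ih => rw [listCrystal_wt_cons, listCrystal_wt_cons, ih]
  | swap a b l => simp only [listCrystal_wt_cons]; abel
  | trans _ _ h1 h2 => exact h1.trans h2

/-- This is associativity of the tensor product on the level of string lengths. At the odd node the
pairings with `h_i` are nonnegative, so the pairing of a concatenation vanishes only if it vanishes
on both parts. -/
theorem listCrystal_ε_append (i : Node m n) (u v : List (Letter m n)) :
    (listCrystal m n).ε i (u ++ v) =
      (listCrystal m n).tensorε (listCrystal m n) i (u, v) ∧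
    (listCrystal m n).φ i (u ++ v) =
      (listCrystal m n).tensorφ (listCrystal m n) i (u, v) := by
  induction u with
  | nil => simp [Crystal.tensorε, Crystal.tensorφ, coroot_eq]
  | cons a u ih =>
    obtain ⟨h1, h2⟩ := ih
    have h3 := ((letterCrystal m n).odd_nonneg i a)
    have h4 := ((listCrystal m n).odd_nonneg i u)
    rw [List.cons_append, listCrystal_ε_cons, listCrystal_φ_cons]
    simp only [Crystal.tensorε, Crystal.tensorφ, h1, h2, listCrystal_ε_cons, listCrystal_φ_cons,
      listCrystal_wt_cons, coroot_add]
    split_ifs at * <;> constructor <;> first | rfl | omega | (have := h3 ‹_›; have := h4 ‹_›; omega)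

/-- Associativity for the operators: the side chosen by the tensor rule is the same for both
bracketings of the three factors, by the formulas for string lengths. -/
theorem listCrystal_f_append (i : Node m n) (u v : List (Letter m n)) :
    (listCrystal m n).f i (u ++ v) =
      ((listCrystal m n).tensorF (listCrystal m n) i (u, v)).map fun p => p.1 ++ p.2 := by
  induction u with
  | nil =>
    have h := (listCrystal m n).f_eq_none i v
    have hmap : (listCrystal m n).f i v =
        Option.map (fun p : List (Letter m n) × List (Letter m n) => p.1 ++ p.2)
          (((listCrystal m n).f i v).map fun z => ([], z)) := by
      rw [Option.map_map]; simp [Function.comp_def]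
    have h0 : ¬ 0 < coroot i (0 : Weight m n) := by simp [coroot_eq]
    simp only [List.nil_append, Crystal.tensorF, listCrystal_wt_nil, listCrystal_ε_nil,
      listCrystal_φ_nil, h0, if_false, Nat.not_lt_zero, gt_iff_lt]
    split_ifs with h1 h2 h3
    · exact hmap
    · exact hmap
    · exact hmap
    · simp [h.2 (by omega)]
  | cons a u ih =>
    have h3 := ((letterCrystal m n).odd_nonneg i a)
    have h4 := ((listCrystal m n).odd_nonneg i u)
    have h1 := (listCrystal_ε_append i u v).1
    have h2 := (listCrystal_ε_append i u v).2
    simp only [Crystal.tensorε, Crystal.tensorφ] at h1 h2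
    rw [List.cons_append, listCrystal_f_cons]
    simp only [Crystal.tensorF, ih, listCrystal_f_cons, listCrystal_ε_cons, listCrystal_φ_cons,
      listCrystal_wt_cons, coroot_add, Crystal.tensorε, Crystal.tensorφ]
    split_ifs at * <;>
     first
     | (exfalso; omega)
     | (exfalso; have := h3 ‹_›; have := h4 ‹_›; omega)
     | (simp only [Option.map_map]; rfl)

/-- The condition on the words `x` and `y` under which the `i`-arrows act on the letter between
them. -/
def ActsBetween (i : Node m n) (x y : List (Letter m n)) : Prop :=
  if i.IsOdd then (listCrystal m n).ε i x = 0 ∧ (listCrystal m n).φ i x = 0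
  else if 0 < ell i then (listCrystal m n).φ i x = 0 ∧ (listCrystal m n).ε i y = 0
  else (listCrystal m n).ε i x = 0 ∧ (listCrystal m n).φ i y = 0

theorem Node.IsOdd.coroot_eq_zero_iff {i : Node m n} (hi : i.IsOdd) {X : Type}
    (C : Crystal m n X) (x : X) : coroot i (C.wt x) = 0 ↔ C.ε i x = 0 ∧ C.φ i x = 0 := by
  have := C.odd_law i x hi
  split_ifs at this with h <;> simp only [h, true_iff, false_iff] <;> omega

theorem letterCrystal_ε (i : Node m n) (a : Letter m n) :
    (letterCrystal m n).ε i a = if a = i.tgt then 1 else 0 := rfl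
theorem letterCrystal_φ (i : Node m n) (a : Letter m n) :
    (letterCrystal m n).φ i a = if a = i.src then 1 else 0 := rfl
theorem letterCrystal_f (i : Node m n) (a : Letter m n) :
    (letterCrystal m n).f i a = if a = i.src then some i.tgt else none := rfl
theorem letterCrystal_coroot_odd {i : Node m n} (hi : i.IsOdd) (a : Letter m n) :
    coroot i ((letterCrystal m n).wt a) = if a = i.src ∨ a = i.tgt then 1 else 0 := by
  have := i.src_ne_tgt
  rw [coroot_eq, if_pos hi]
  simp only [letterCrystal, Pi.single_apply, eq_comm (a := a)]
  split_ifs <;> simp_all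

/-- The signature rule. All later arguments about arrows use only this description, not the
recursive tensor rule. -/
theorem listCrystal_f_eq_some_iff (i : Node m n) (w w' : List (Letter m n)) :
    (listCrystal m n).f i w = some w' ↔
      ∃ x y, w = x ++ i.src :: y ∧ w' = x ++ i.tgt :: y ∧ ActsBetween i x y := by
  have hst := i.src_ne_tgt
  constructor
  · induction w generalizing w' with
    | nil => simp
    | cons a w ih =>
      intro h
      rw [listCrystal_f_cons] at h
      have hod := fun hi : i.IsOdd => hi.coroot_eq_zero_iff (letterCrystal m n) a
      have hnn := (letterCrystal m n).odd_nonneg i a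
      have key : (a = i.src ∧ w' = i.tgt :: w ∧ ActsBetween i [] w) ∨
          (∃ v, (listCrystal m n).f i w = some v ∧ w' = a :: v ∧
            ∀ x y, w = x ++ i.src :: y → ActsBetween i x y → ActsBetween i (a :: x) y) := by
        have H : (∃ b, (letterCrystal m n).f i a = some b ∧ w' = b :: w) →
            a = i.src ∧ w' = i.tgt :: w := by
          rintro ⟨b, hb, rfl⟩
          rw [letterCrystal_f] at hb
          split_ifs at hb with h1
          simp_all
        simp only [Crystal.tensorF] at h
        split_ifs at h with h1 h2 h2 h3 h3 <;> simp only [Option.map_map, Option.map_eq_some_iff,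
          Function.comp] at h <;> obtain ⟨b, hb, rfl⟩ := h
        · left
          obtain ⟨h5, h6⟩ := H ⟨b, hb, rfl⟩
          exact ⟨h5, h6, by simp [ActsBetween, h1]⟩
        · right
          refine ⟨b, hb, rfl, ?_⟩
          intro x y _ hxy
          have h0 : coroot i ((letterCrystal m n).wt a) = 0 := by have := hnn h1; omega
          have h00 := (hod h1).1 h0
          simp only [ActsBetween, h1, if_true] at hxy ⊢
          rw [listCrystal_ε_cons, listCrystal_φ_cons, Crystal.tensorε, Crystal.tensorφ]
          simp [h1, h0, hxy]
        · left
          obtain ⟨h5, h6⟩ := H ⟨b, hb, rfl⟩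
          refine ⟨h5, h6, ?_⟩
          simp only [ActsBetween, h1, h2, if_true, if_false]
          have : (letterCrystal m n).φ i a ≤ 1 := by rw [letterCrystal_φ]; split_ifs <;> simp
          exact ⟨rfl, by omega⟩
        · right
          refine ⟨b, hb, rfl, ?_⟩
          intro x y hw hxy
          simp only [ActsBetween, h1, h2, if_true, if_false] at hxy ⊢
          rw [listCrystal_φ_cons, Crystal.tensorφ]
          simp only [h1, h2, if_true, if_false, hxy]
          refine ⟨?_, trivial⟩
          -- The letter `i.src` followed by `y` has no unmatched target, so `w` and `x` have the
          -- same `ε`. As the operator acts on `w`, any source letter `a` is matched by an unmatched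
          -- target of `x`.
          have h7 := (listCrystal_ε_append i x (i.src :: y)).1
          rw [← hw, Crystal.tensorε] at h7
          simp only [h1, h2, if_true, if_false, hxy, listCrystal_ε_cons, Crystal.tensorε,
            letterCrystal_ε, letterCrystal_φ, hst] at h7
          omega
        · right
          refine ⟨b, hb, rfl, ?_⟩
          intro x y hw hxy
          simp only [ActsBetween, h1, h2, if_false] at hxy ⊢
          rw [listCrystal_ε_cons, Crystal.tensorε]
          simp only [h1, h2, if_false, hxy]
          refine ⟨?_, trivial⟩
          -- The selected letter adds one to the `φ` of `x`. Acting on `w` requires this sum to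
          -- exceed the `ε` of `a`, so a target `a` is already matched inside `x`.
          have h7 := (listCrystal_ε_append i x (i.src :: y)).2
          rw [← hw, Crystal.tensorφ] at h7
          simp only [h1, h2, if_false, hxy, listCrystal_φ_cons, Crystal.tensorφ,
            letterCrystal_ε, letterCrystal_φ, hst] at h7
          have h8 : (letterCrystal m n).ε i a ≤ 1 := by rw [letterCrystal_ε]; split_ifs <;> simp
          simp only [if_true] at h7
          omega
        · left
          obtain ⟨h5, h6⟩ := H ⟨b, hb, rfl⟩
          refine ⟨h5, h6, ?_⟩
          simp only [ActsBetween, h1, h2, if_false]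
          subst h5
          rw [letterCrystal_ε, if_neg hst] at h3
          exact ⟨rfl, by omega⟩
      clear h
      rcases key with ⟨rfl, rfl, h⟩ | ⟨v, hv, rfl, h⟩
      · exact ⟨[], w, rfl, rfl, h⟩
      · obtain ⟨x, y, h1, h2, h3⟩ := ih v hv
        exact ⟨a :: x, y, by simp [h1], by simp [h2], h x y h1 h3⟩
  · rintro ⟨x, y, rfl, rfl, h⟩
    have hnn := (listCrystal m n).odd_nonneg i x
    have h1 : (listCrystal m n).f i (i.src :: y) = some (i.tgt :: y) := by
      rw [listCrystal_f_cons, Crystal.tensorF]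
      simp only [ActsBetween] at h
      split_ifs at h ⊢ with h1 h2 h3 h4 h5 h6
      · simp [letterCrystal_f]
      · exact absurd h2 (by simp [letterCrystal_coroot_odd h1])
      · simp [letterCrystal_f]
      · exact absurd h4 (by simp [letterCrystal_φ, h.2])
      · exact absurd h5 (by simp [h.2])
      · simp [letterCrystal_f]
    rw [listCrystal_f_append, Crystal.tensorF]
    simp only [ActsBetween] at h
    split_ifs at h ⊢ with h2 h3 h3 h4 h5
    · have := (h2.coroot_eq_zero_iff (listCrystal m n) x).2 h
      simp only at h3
      omega
    · simp [h1]
    · simp only [h.1] at h4; omega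
    · simp [h1]
    · simp [h1]
    · exfalso
      apply h5
      simp only
      rw [h.1, listCrystal_φ_cons, Crystal.tensorφ]
      simp only [h2, h3, if_false, letterCrystal_ε, letterCrystal_φ, hst]
      simp

end ListCrystal

/-! ### Bracketing and counts of letters in prefixes and suffixes -/

section Brackets

variable {m n : ℕ}

/-- The two counting functions of a bracketing rule, in terms of prefixes and suffixes. -/
theorem bracket_le_iff {α : Type} [DecidableEq α] {s t : α} (hst : s ≠ t) (E F : List α → ℕ)
    (hE0 : E [] = 0) (hF0 : F [] = 0)
    (hE : ∀ a w, E (a :: w) = (if a = t then 1 else 0) + (E w - if a = s then 1 else 0))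
    (hF : ∀ a w, F (a :: w) = F w + ((if a = s then 1 else 0) - E w)) (w : List α) (k : ℕ) :
    (E w ≤ k ↔ ∀ v, v <+: w → v.count t ≤ v.count s + k) ∧
      (F w ≤ k ↔ ∀ v, v <:+ w → v.count s ≤ v.count t + k) := by
  -- `E` and `F` count the unmatched letters `t` and `s`, and a matched pair contains one of each.
  -- This identity supplies the condition on the whole word that the suffix criterion adds at each
  -- letter.
  have hEF : ∀ w, F w + w.count t = E w + w.count s := by
    intro w
    induction w with
    | nil => simp [hE0, hF0]
    | cons a w ih =>
      rw [hE, hF, List.count_cons, List.count_cons]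
      simp only [beq_iff_eq]
      by_cases h1 : a = t
      · subst h1; simp only [hst.symm, if_true, if_false]; omega
      · by_cases h2 : a = s
        · subst h2; simp only [h1, if_true, if_false]; omega
        · simp only [h1, h2, if_false]; omega
  constructor
  · induction w generalizing k with
    | nil => simp [hE0]
    | cons a w ih =>
      simp only [List.prefix_cons_iff]
      have h1 : (∀ v, (v = [] ∨ ∃ v', v = a :: v' ∧ v' <+: w) → v.count t ≤ v.count s + k) ↔
          ∀ v', v' <+: w → (a :: v').count t ≤ (a :: v').count s + k :=
        ⟨fun h v' hv' => h _ (Or.inr ⟨v', rfl, hv'⟩), by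
          rintro h v (rfl | ⟨v', rfl, hv'⟩)
          · simp
          · exact h _ hv'⟩
      rw [h1, hE]
      simp only [List.count_cons, beq_iff_eq]
      by_cases ha : a = t
      · subst ha
        simp only [hst.symm, if_true, if_false]
        rcases Nat.eq_zero_or_pos k with rfl | hk
        · simp only [add_zero]
          refine ⟨fun h => by omega, fun h => ?_⟩
          have := h [] ⟨_, List.nil_append _⟩
          simp at this
        · rw [show 1 + (E w - 0) ≤ k ↔ E w ≤ k - 1 by omega, ih]
          exact forall₂_congr fun v _ => by omega
      · by_cases h2 : a = s
        · subst h2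
          simp only [ha, if_true, if_false]
          rw [show 0 + (E w - 1) ≤ k ↔ E w ≤ k + 1 by omega, ih]
          exact forall₂_congr fun v _ => by omega
        · simp only [ha, h2, if_false]
          rw [show 0 + (E w - 0) ≤ k ↔ E w ≤ k by omega, ih]
          exact forall₂_congr fun v _ => by omega
  · induction w generalizing k with
    | nil => simp [hF0]
    | cons a w ih =>
      simp only [List.suffix_cons_iff, forall_eq_or_imp, ← ih]
      have h1 := hEF (a :: w)
      rw [hE] at h1
      rw [hF] at h1 ⊢
      have : ¬ (a = s ∧ a = t) := fun h => hst (h.1.symm.trans h.2)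
      by_cases h3 : a = s <;> by_cases h4 : a = t <;> simp only [h3, h4, hst, hst.symm, if_true, if_false] at * <;>
        first | tauto | omega

theorem ell_pos_iff (i : Node m n) : 0 < ell i ↔ i.1 < m := by
  unfold ell; split_ifs <;> simp [*]

theorem bracket_plus {i : Node m n} (hi : i.1 + 1 < m) (w : List (Letter m n)) (k : ℕ) :
    ((listCrystal m n).ε i w ≤ k ↔ ∀ v, v <+: w → v.count i.tgt ≤ v.count i.src + k) ∧
      ((listCrystal m n).φ i w ≤ k ↔ ∀ v, v <:+ w → v.count i.src ≤ v.count i.tgt + k) := by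
  have h1 : ¬ i.IsOdd := by unfold Node.IsOdd; omega
  have h2 : 0 < ell i := (ell_pos_iff i).2 (by omega)
  refine bracket_le_iff i.src_ne_tgt _ _ rfl rfl (fun a w => ?_) (fun a w => ?_) w k
  · rw [listCrystal_ε_cons]; simp only [Crystal.tensorε, h1, h2, if_true, if_false]; rfl
  · rw [listCrystal_φ_cons]; simp only [Crystal.tensorφ, h1, h2, if_true, if_false]; rfl

/-- For `ℓ_i < 0` the recursions are those of `bracket_plus` with source and target exchanged, so
`φ` is now read off from prefixes and `ε` from suffixes. -/
theorem bracket_minus {i : Node m n} (hi : m ≤ i.1) (w : List (Letter m n)) (k : ℕ) :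
    ((listCrystal m n).φ i w ≤ k ↔ ∀ v, v <+: w → v.count i.src ≤ v.count i.tgt + k) ∧
      ((listCrystal m n).ε i w ≤ k ↔ ∀ v, v <:+ w → v.count i.tgt ≤ v.count i.src + k) := by
  have h1 : ¬ i.IsOdd := by unfold Node.IsOdd; omega
  have h2 : ¬ 0 < ell i := by rw [ell_pos_iff]; omega
  refine bracket_le_iff i.src_ne_tgt.symm _ _ rfl rfl (fun a w => ?_) (fun a w => ?_) w k
  · rw [listCrystal_φ_cons]; simp only [Crystal.tensorφ, h1, h2, if_false]; rfl
  · rw [listCrystal_ε_cons]; simp only [Crystal.tensorε, h1, h2, if_false]; rfl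

/-- At the odd node each source or target letter adds one to the pairing with `h_i`, and other
letters add nothing, so no cancellation can occur. -/
theorem odd_word_trivial_iff {i : Node m n} (hi : i.IsOdd) (w : List (Letter m n)) :
    ((listCrystal m n).ε i w = 0 ∧ (listCrystal m n).φ i w = 0) ↔
      i.src ∉ w ∧ i.tgt ∉ w := by
  rw [← hi.coroot_eq_zero_iff]
  induction w with
  | nil => simp [coroot_eq]
  | cons a w ih =>
    have h1 := (listCrystal m n).odd_nonneg i w hi
    rw [listCrystal_wt_cons, coroot_add, letterCrystal_coroot_odd hi]
    simp only [List.mem_cons, not_or, eq_comm (b := a)]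
    split_ifs with h
    · constructor
      · intro; omega
      · tauto
    · push Not at h
      rw [zero_add, ih]
      tauto

/-- If some letter `tgt` of a word is preceded by no letter `src`, then `ẽ_i` does not kill it
(`i` a node with `ℓ_i > 0`). -/
theorem listCrystal_e_ne_none {i : Node m n} (hi : i.1 < m) {x y : List (Letter m n)}
    (hx : i.src ∉ x) : (listCrystal m n).e i (x ++ i.tgt :: y) ≠ none := by
  rw [Ne, Crystal.e_eq_none]
  by_cases h : i.IsOdd
  · induction x with
    | nil =>
      rw [List.nil_append, listCrystal_ε_cons, Crystal.tensorε]
      simp [h, letterCrystal_coroot_odd h, letterCrystal_ε]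
    | cons a x ih =>
      rw [List.mem_cons, not_or] at hx
      rw [List.cons_append, listCrystal_ε_cons, Crystal.tensorε]
      simp only [h, if_true, letterCrystal_coroot_odd h, letterCrystal_ε]
      by_cases ha : a = i.tgt
      · simp [ha]
      · have : ¬ (a = i.src ∨ a = i.tgt) := by tauto
        simp only [this, if_false, lt_irrefl]
        exact ih hx.2
  · have h1 : i.1 + 1 < m := by unfold Node.IsOdd at h; omega
    intro h0
    have := (bracket_plus h1 (x ++ i.tgt :: y) 0).1.1 h0.le (x ++ [i.tgt]) ⟨y, by simp⟩
    simp [List.count_append, List.count_eq_zero_of_not_mem hx, i.src_ne_tgt.symm] at this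

end Brackets

/-! ### Cells of two consecutive letters -/

section Cells

/-- The local properties of the sets `S`, `O` of cells with two consecutive letters in a
semistandard filling. -/
structure LocalCells (S O : ℤ × ℤ → Prop) : Prop where
  comparable : ∀ {p q}, S p → S q → p.1 < q.1 → q.2 ≤ p.2
  row_below : ∀ {r c c'}, S (r, c) → O (r + 1, c) → S (r, c') → c' ≤ c → O (r + 1, c')
  not_southeast : ∀ {p q}, O p → S q → p.1 ≤ q.1 → p.2 ≤ q.2 → False
  below : ∀ {p q}, S p → O q → p.1 < q.1 → p.2 < q.2 → O (p.1 + 1, p.2)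

/-- A listing of cells in which a cell precedes the cells weakly below and weakly left of it. -/
structure CellList (S O : ℤ × ℤ → Prop) (L : List (ℤ × ℤ)) : Prop where
  nodup : L.Nodup
  mem : ∀ p, S p ∨ O p → p ∈ L
  order : L.Pairwise fun p q => ¬ (q ≠ p ∧ q.1 ≤ p.1 ∧ p.2 ≤ q.2)

/-- The bracketing condition on the cells before and after a given cell. -/
def Balanced (S O : ℤ × ℤ → Prop) [DecidablePred S] [DecidablePred O]
    (L₁ L₂ : List (ℤ × ℤ)) : Prop :=
  (∀ v, v <:+ L₁ → v.countP S ≤ v.countP O) ∧ ∀ v, v <+: L₂ → v.countP O ≤ v.countP S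

theorem countP_le_countP_of_injOn {α : Type} [DecidableEq α] {p q : α → Prop} [DecidablePred p]
    [DecidablePred q] {l : List α} (hl : l.Nodup) (g : α → α)
    (hg : ∀ x ∈ l, p x → g x ∈ l ∧ q (g x))
    (hinj : ∀ x ∈ l, ∀ y ∈ l, p x → p y → g x = g y → x = y) :
    l.countP p ≤ l.countP q := by
  have h : ∀ (r : α → Prop) [DecidablePred r],
      l.countP r = (l.toFinset.filter r).card := by
    intro r _
    rw [List.countP_eq_length_filter, ← List.toFinset_card_of_nodup (hl.filter _),
      List.toFinset_filter]
    simp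
  rw [h, h]
  refine Finset.card_le_card_of_injOn g ?_ ?_
  · intro x hx
    simp only [Finset.coe_filter, List.mem_toFinset, Set.mem_ofPred_eq] at hx ⊢
    exact hg x hx.1 hx.2
  · intro x hx y hy
    simp only [Finset.coe_filter, List.mem_toFinset, Set.mem_ofPred_eq] at hx hy
    exact hinj x hx.1 y hy.1 hx.2 hy.2

theorem countP_lt_countP_of_injOn {α : Type} [DecidableEq α] {p q : α → Prop} [DecidablePred p]
    [DecidablePred q] {l : List α} (hl : l.Nodup) (g : α → α) (z : α) (hz : z ∈ l) (hqz : q z)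
    (hg : ∀ x ∈ l, p x → g x ∈ l ∧ q (g x) ∧ g x ≠ z)
    (hinj : ∀ x ∈ l, ∀ y ∈ l, p x → p y → g x = g y → x = y) :
    l.countP p < l.countP q := by
  have h1 : l.countP p ≤ l.countP fun x => q x ∧ x ≠ z :=
    countP_le_countP_of_injOn hl g (fun x hx hp => hg x hx hp) hinj
  refine h1.trans_lt ?_
  obtain ⟨a, b, rfl⟩ := List.append_of_mem hz
  simp only [List.countP_append, List.countP_cons, hqz, decide_true, if_true, ne_eq,
    not_true_eq_false, and_false, decide_false, Bool.false_eq_true, if_false]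
  have h2 : ∀ l : List α, (l.countP fun x => q x ∧ ¬ x = z) ≤ l.countP q :=
    fun l => List.countP_mono_left (by simp; tauto)
  have := h2 a
  have := h2 b
  omega

variable {S O : ℤ × ℤ → Prop} {L L₁ L₂ : List (ℤ × ℤ)} {β : ℤ × ℤ}

theorem CellList.mem_right (h : CellList S O (L₁ ++ β :: L₂)) {p : ℤ × ℤ} (hp : S p ∨ O p)
    (hne : p ≠ β) (h1 : β.1 ≤ p.1) (h2 : p.2 ≤ β.2) : p ∈ L₂ := by
  have hm := h.mem p hp
  have ho := h.order
  rw [List.pairwise_append] at ho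
  simp only [List.mem_append, List.mem_cons, hne, false_or] at hm
  rcases hm with hm | hm
  · exact absurd ⟨hne.symm, h1, h2⟩ (ho.2.2 p hm β (by simp))
  · exact hm

theorem CellList.mem_left (h : CellList S O (L₁ ++ β :: L₂)) {p : ℤ × ℤ} (hp : S p ∨ O p)
    (hne : p ≠ β) (h1 : p.1 ≤ β.1) (h2 : β.2 ≤ p.2) : p ∈ L₁ := by
  have hm := h.mem p hp
  have ho := h.order
  rw [List.pairwise_append, List.pairwise_cons] at ho
  simp only [List.mem_append, List.mem_cons, hne, false_or] at hm
  rcases hm with hm | hm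
  · exact hm
  · exact absurd ⟨hne, h1, h2⟩ (ho.2.1.1 p hm)

theorem CellList.right_not (h : CellList S O (L₁ ++ β :: L₂)) {p : ℤ × ℤ} (hp : p ∈ L₂) :
    p ≠ β ∧ ¬ (p.1 ≤ β.1 ∧ β.2 ≤ p.2) := by
  have ho := h.order
  have hn := h.nodup
  rw [List.pairwise_append, List.pairwise_cons] at ho
  rw [List.nodup_append, List.nodup_cons] at hn
  have h1 : p ≠ β := fun h => hn.2.1.1 (h ▸ hp)
  exact ⟨h1, fun h => ho.2.1.1 p hp ⟨h1, h⟩⟩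

theorem CellList.left_not (h : CellList S O (L₁ ++ β :: L₂)) {p : ℤ × ℤ} (hp : p ∈ L₁) :
    p ≠ β ∧ ¬ (β.1 ≤ p.1 ∧ p.2 ≤ β.2) := by
  have ho := h.order
  have hn := h.nodup
  rw [List.pairwise_append] at ho
  rw [List.nodup_append] at hn
  have h1 : p ≠ β := fun h => hn.2.2 p hp β (by simp) h
  exact ⟨h1, fun h => ho.2.2 p hp β (by simp) ⟨h1.symm, h⟩⟩

/-- A relevant cell incomparable with `β` would lie strictly northwest or strictly southeast of it.
The local rules forbid this, except for an `O` cell to the southeast, which would force one directly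
below `β`. -/
theorem CellList.comparable_of_not_below (hloc : LocalCells S O) (hβ : S β)
    (hO : ¬ O (β.1 + 1, β.2)) {p : ℤ × ℤ} (hp : S p ∨ O p) :
    (p.1 ≤ β.1 ∧ β.2 ≤ p.2) ∨ (β.1 ≤ p.1 ∧ p.2 ≤ β.2) := by
  have key : ¬ (p.1 < β.1 ∧ p.2 < β.2) ∧ ¬ (β.1 < p.1 ∧ β.2 < p.2) := by
    rcases hp with hp | hp
    · exact ⟨fun h => absurd (hloc.comparable hp hβ h.1) (by omega),
        fun h => absurd (hloc.comparable hβ hp h.1) (by omega)⟩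
    · exact ⟨fun h => hloc.not_southeast hp hβ h.1.le h.2.le,
        fun h => hO (hloc.below hβ hp h.1 h.2)⟩
  omega

/-- The right-hand side does not mention the listing: which relevant cells come after `β` is decided
by their position. -/
theorem CellList.mem_right_iff (h : CellList S O (L₁ ++ β :: L₂)) (hloc : LocalCells S O)
    (hβ : S β) (hO : ¬ O (β.1 + 1, β.2)) {p : ℤ × ℤ} (hp : S p ∨ O p) :
    p ∈ L₂ ↔ p ≠ β ∧ β.1 ≤ p.1 ∧ p.2 ≤ β.2 := by
  constructor
  · intro hm
    have h1 := h.right_not hm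
    have h2 := CellList.comparable_of_not_below hloc hβ hO hp
    exact ⟨h1.1, h2.resolve_left h1.2⟩
  · rintro ⟨h1, h2, h3⟩
    exact h.mem_right hp h1 h2 h3

theorem CellList.mem_left_iff (h : CellList S O (L₁ ++ β :: L₂)) (hloc : LocalCells S O)
    (hβ : S β) (hO : ¬ O (β.1 + 1, β.2)) {p : ℤ × ℤ} (hp : S p ∨ O p) :
    p ∈ L₁ ↔ p ≠ β ∧ p.1 ≤ β.1 ∧ β.2 ≤ p.2 := by
  constructor
  · intro hm
    have h1 := h.left_not hm
    have h2 := CellList.comparable_of_not_below hloc hβ hO hp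
    exact ⟨h1.1, h2.resolve_right h1.2⟩
  · rintro ⟨h1, h2, h3⟩
    exact h.mem_left hp h1 h2 h3

variable [DecidablePred S] [DecidablePred O]

/-- An `O` cell below `β` would give `O` cells below all `S` cells to the left in the same row.
Reading on from `β` to the end of this double strip would meet more `O` cells than `S` cells. -/
theorem CellList.not_below (h : CellList S O (L₁ ++ β :: L₂)) (hloc : LocalCells S O) (hβ : S β)
    (hbal : Balanced S O L₁ L₂) : ¬ O (β.1 + 1, β.2) := by
  intro hO
  obtain ⟨r, c⟩ := β
  simp only at hO
  -- `c'` is the leftmost column with an `S` cell in the row of `β`; the offending prefix ends at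
  -- the cell below it.
  obtain ⟨c', hc', hmin⟩ : ∃ c', S (r, c') ∧ ∀ c'', S (r, c'') → c' ≤ c'' := by
    obtain ⟨p, hp, hmin⟩ := Finset.exists_min_image
      ((L₁ ++ (r, c) :: L₂).toFinset.filter fun p => S p ∧ p.1 = r) (fun p => p.2)
      ⟨(r, c), by simp [hβ]⟩
    simp only [Finset.mem_filter, List.mem_toFinset] at hp hmin
    obtain ⟨p1, p2⟩ := p
    obtain ⟨hp0, hp, rfl⟩ := hp
    exact ⟨p2, hp, fun c'' hc'' => hmin (p1, c'') ⟨h.mem _ (Or.inl hc''), hc'', rfl⟩⟩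
  have hcc := hmin c hβ
  have hO' := hloc.row_below hβ hO hc' hcc
  have hmem : (r + 1, c') ∈ L₂ :=
    h.mem_right (Or.inr hO') (by simp) (by simp) (by simpa using hcc)
  obtain ⟨v, v', rfl⟩ := List.append_of_mem hmem
  have hlist : CellList S O ((L₁ ++ (r, c) :: v) ++ (r + 1, c') :: v') := by simpa using h
  have hin : ∀ d, O (r + 1, d) → c' ≤ d → d ≤ c → (r + 1, d) ∈ v ++ [(r + 1, c')] := by
    intro d hd h1 h2
    rcases eq_or_lt_of_le h1 with rfl | h3
    · simp
    · have h4 : (r + 1, d) ∈ L₁ ++ (r, c) :: v :=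
        hlist.mem_left (Or.inr hd) (by simp; omega) (by simp) (by simpa using h1)
      have h5 : (r + 1, d) ∈ v ++ (r + 1, c') :: v' :=
        h.mem_right (Or.inr hd) (by simp) (by simp) (by simpa using h2)
      have h6 : (r + 1, d) ∉ L₁ := fun h7 => (h.left_not h7).2 ⟨by simp, by simpa using h2⟩
      simp only [List.mem_append, List.mem_cons, h6, false_or] at h4
      rcases h4 with h4 | h4
      · simp at h4
      · simp [h4]
  -- The `S` cells of this prefix lie in the row of `β`, strictly to its left. Moving each one down
  -- gives distinct `O` cells of the prefix, and the cell below `β` is not hit.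
  have hlt : (v ++ [(r + 1, c')]).countP S < (v ++ [(r + 1, c')]).countP O := by
    have hkey : ∀ x ∈ v ++ [(r + 1, c')], S x → x.1 = r ∧ c' ≤ x.2 ∧ x.2 < c := by
      rintro ⟨a, b⟩ hx hS
      have hx2 : (a, b) ∈ v ++ (r + 1, c') :: v' := by
        simp only [List.mem_append, List.mem_cons, List.not_mem_nil, or_false] at hx ⊢
        tauto
      have h1 := h.right_not hx2
      have h2 : (a, b) ≠ (r + 1, c') := by
        intro h3
        rw [h3] at hS
        exact hloc.not_southeast hO' hS le_rfl le_rfl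
      have h3 : (a, b) ∈ L₁ ++ (r, c) :: v := by
        simp only [List.mem_append, List.mem_cons, List.not_mem_nil, h2, or_false] at hx ⊢
        tauto
      have h4 := hlist.left_not h3
      simp only [ne_eq, Prod.mk.injEq, not_and, not_le] at h1 h2 h4 ⊢
      have h5 : r ≤ a := by
        by_contra h6
        push Not at h6
        have := hloc.comparable hS hβ h6
        simp only at this
        have := h1.2 (by omega)
        omega
      have h6 : a = r := by
        by_contra h7
        have h8 := h4.2 (by omega)
        exact hloc.not_southeast hO' hS (by simp; omega) (by simp; omega)
      subst h6
      have := hmin b hS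
      have h7 := h1.2
      have h8 := h1.1 rfl
      refine ⟨rfl, this, ?_⟩
      by_contra h9
      have := h1.2 le_rfl
      omega
    refine countP_lt_countP_of_injOn ?_ (fun p => (p.1 + 1, p.2)) (r + 1, c)
      (hin c hO hcc le_rfl) hO ?_ ?_
    · refine List.Nodup.sublist ?_ h.nodup
      rw [show L₁ ++ (r, c) :: (v ++ (r + 1, c') :: v') =
        (L₁ ++ [(r, c)]) ++ ((v ++ [(r + 1, c')]) ++ v') by simp]
      exact (List.sublist_append_left _ _).trans (List.sublist_append_right _ _)
    · rintro ⟨a, b⟩ hx hS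
      obtain ⟨h1, h2, h3⟩ := hkey _ hx hS
      simp only at h1 h2 h3
      subst h1
      have := hloc.row_below hβ hO hS h3.le
      exact ⟨hin b this h2 h3.le, this, by simp; omega⟩
    · rintro ⟨a, b⟩ _ ⟨a', b'⟩ _ _ _ h
      simpa using h
  exact absurd (hbal.2 (v ++ [(r + 1, c')]) ⟨v', by simp⟩) (by omega)

/-- An `S` cell right of `β` would be read earlier, and no `O` cell can be read between the two. It
would therefore be unmatched. -/
theorem CellList.not_right (h : CellList S O (L₁ ++ β :: L₂)) (hloc : LocalCells S O) (hβ : S β)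
    (hbal : Balanced S O L₁ L₂) : ¬ S (β.1, β.2 + 1) := by
  intro hS
  have hO := h.not_below hloc hβ hbal
  have hm : (β.1, β.2 + 1) ∈ L₁ := h.mem_left (Or.inl hS) (by simp [Prod.ext_iff]) le_rfl (by simp)
  obtain ⟨v', v, rfl⟩ := List.append_of_mem hm
  have hlist : CellList S O (v' ++ (β.1, β.2 + 1) :: (v ++ β :: L₂)) := by simpa using h
  have h1 := hbal.1 ((β.1, β.2 + 1) :: v) ⟨v', rfl⟩
  have h2 : ((β.1, β.2 + 1) :: v).countP O = 0 := by
    rw [List.countP_eq_zero]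
    intro p hp hOp
    simp only [decide_eq_true_eq] at hOp
    have h3 : p ≠ (β.1, β.2 + 1) := by
      rintro rfl
      exact hloc.not_southeast hOp hS le_rfl le_rfl
    simp only [List.mem_cons, h3, false_or] at hp
    have h4 := (h.left_not (show p ∈ v' ++ (β.1, β.2 + 1) :: v by simp [hp])).2
    have h5 := (hlist.right_not (show p ∈ v ++ β :: L₂ by simp [hp])).2
    simp only at h5
    rcases CellList.comparable_of_not_below hloc hβ hO (Or.inr hOp) with h6 | h6
    · exact hloc.not_southeast hOp hβ h6.1 (by omega)
    · exact h4 h6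
  rw [h2, List.countP_cons] at h1
  simp [hS] at h1

theorem countP_eq_countP_of_mem_iff {α : Type} {p : α → Prop} [DecidablePred p] {l l' : List α}
    (hl : l.Nodup) (hl' : l'.Nodup) (h : ∀ x, p x → (x ∈ l ↔ x ∈ l')) :
    l.countP p = l'.countP p := by
  rw [List.countP_eq_length_filter, List.countP_eq_length_filter]
  apply List.Perm.length_eq
  rw [List.perm_ext_iff_of_nodup (hl.filter _) (hl'.filter _)]
  intro a
  simp only [List.mem_filter, decide_eq_true_eq]
  exact and_congr_left (h a)

/-- The relevant cells read between `β` and `γ` are the same in both listings. Balance at `β` says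
that they contain at least as many `S` as `O`; balance at `γ`, where `β` is an additional `S`, says
that they contain fewer. -/
theorem CellList.not_precede {M₁ M₂ : List (ℤ × ℤ)} {γ : ℤ × ℤ}
    (h : CellList S O (L₁ ++ β :: L₂)) (h' : CellList S O (M₁ ++ γ :: M₂))
    (hloc : LocalCells S O) (hβ : S β) (hγ : S γ) (hbal : Balanced S O L₁ L₂)
    (hbal' : Balanced S O M₁ M₂) (hne : γ ≠ β) (h1 : β.1 ≤ γ.1) (h2 : γ.2 ≤ β.2) : False := by
  have hOβ := h.not_below hloc hβ hbal
  have hOγ := h'.not_below hloc hγ hbal'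
  have hL := h.mem_right (Or.inl hγ) hne h1 h2
  have hM := h'.mem_left (Or.inl hβ) hne.symm h1 h2
  obtain ⟨A, A', rfl⟩ := List.append_of_mem hL
  obtain ⟨B', B, rfl⟩ := List.append_of_mem hM
  have k1 := hbal.2 A ⟨γ :: A', rfl⟩
  have k2 := hbal'.1 (β :: B) ⟨B', rfl⟩
  have hA : CellList S O ((L₁ ++ β :: A) ++ γ :: A') := by simpa using h
  have hB : CellList S O (B' ++ β :: (B ++ γ :: M₂)) := by simpa using h'
  have hmem : ∀ p, S p ∨ O p → (p ∈ A ↔ p ∈ B) := by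
    intro p hp
    constructor
    · intro hpA
      have h3 := (h.mem_right_iff hloc hβ hOβ hp).1 (by simp [hpA])
      have h4 := (hA.mem_left_iff hloc hγ hOγ hp).1 (by simp [hpA])
      have h5 := (hB.mem_right_iff hloc hβ hOβ hp).2 h3
      have h6 : p ∉ M₂ := fun h7 => (h'.right_not h7).2 h4.2
      simpa [h6, h4.1] using h5
    · intro hpB
      have h3 := (hB.mem_right_iff hloc hβ hOβ hp).1 (by simp [hpB])
      have h4 := (h'.mem_left_iff hloc hγ hOγ hp).1 (by simp [hpB])
      have h5 := (h.mem_right_iff hloc hβ hOβ hp).2 h3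
      have h6 : p ∉ A' := fun h7 => (hA.right_not h7).2 h4.2
      simpa [h6, h4.1] using h5
  have hnA : A.Nodup := by
    have := h.nodup
    simp only [List.nodup_append, List.nodup_cons] at this
    tauto
  have hnB : B.Nodup := by
    have := h'.nodup
    simp only [List.nodup_append, List.nodup_cons] at this
    tauto
  have e1 := countP_eq_countP_of_mem_iff hnA hnB fun p (hp : S p) => hmem p (Or.inl hp)
  have e2 := countP_eq_countP_of_mem_iff hnA hnB fun p (hp : O p) => hmem p (Or.inr hp)
  have : ¬ O β := fun hO => hloc.not_southeast hO hβ le_rfl le_rfl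
  simp only [List.countP_cons, hβ, this, decide_true, decide_false, if_true, Bool.false_eq_true,
    if_false] at k2
  omega

/-- The cell on which a bracketing rule acts does not depend on the listing of the cells. -/
theorem CellList.balanced_unique {L' : List (ℤ × ℤ)}
    (h : CellList S O (L₁ ++ β :: L₂)) (h' : CellList S O L')
    (hloc : LocalCells S O) (hβ : S β) (hbal : Balanced S O L₁ L₂)
    (halt : (∃ M₁ γ M₂, L' = M₁ ++ γ :: M₂ ∧ S γ ∧ Balanced S O M₁ M₂) ∨
      ∀ v, v <:+ L' → v.countP S ≤ v.countP O) :
    ∃ M₁ M₂, L' = M₁ ++ β :: M₂ ∧ Balanced S O M₁ M₂ := by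
  have hO := h.not_below hloc hβ hbal
  rcases halt with ⟨M₁, γ, M₂, rfl, hγ, hbal'⟩ | halt
  · by_cases hne : γ = β
    · subst hne
      exact ⟨M₁, M₂, rfl, hbal'⟩
    · rcases CellList.comparable_of_not_below hloc hβ hO (Or.inl hγ) with h1 | h1
      · exact (h'.not_precede h hloc hγ hβ hbal' hbal (Ne.symm hne) h1.1 h1.2).elim
      · exact (h.not_precede h' hloc hβ hγ hbal hbal' hne h1.1 h1.2).elim
  -- If every `S` were matched in the second listing, the suffix from `β` on would contain at least
  -- as many `O` as `S`. It has the same relevant cells as in the first listing, where the `O` after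
  -- `β` do not exceed the `S` after `β`.
  · exfalso
    obtain ⟨M₁, M₂, rfl⟩ := List.append_of_mem (h'.mem β (Or.inl hβ))
    have k1 := halt (β :: M₂) ⟨M₁, rfl⟩
    have k2 := hbal.2 L₂ List.prefix_rfl
    have hn := h.nodup
    have hn' := h'.nodup
    simp only [List.nodup_append, List.nodup_cons] at hn hn'
    have hmem : ∀ p, S p ∨ O p → (p ∈ L₂ ↔ p ∈ M₂) := fun p hp => by
      rw [h.mem_right_iff hloc hβ hO hp, h'.mem_right_iff hloc hβ hO hp]
    have e1 := countP_eq_countP_of_mem_iff hn.2.1.2 hn'.2.1.2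
      fun p (hp : S p) => hmem p (Or.inl hp)
    have e2 := countP_eq_countP_of_mem_iff hn.2.1.2 hn'.2.1.2
      fun p (hp : O p) => hmem p (Or.inr hp)
    have : ¬ O β := fun hO => hloc.not_southeast hO hβ le_rfl le_rfl
    simp only [List.countP_cons, hβ, this, decide_true, decide_false, if_true, Bool.false_eq_true,
      if_false] at k1
    omega

end Cells

/-! ### Arrow conditions as counting conditions on words -/

section WordBalance

variable {m n : ℕ}

/-- The bracketing condition on the words before and after a letter. -/
def WordBalanced {α : Type} [DecidableEq α] (a b : α) (x y : List α) : Prop :=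
  (∀ v, v <:+ x → v.count a ≤ v.count b) ∧ ∀ v, v <+: y → v.count b ≤ v.count a

/-- Reversal turns the condition for changing `a` into `b` into the one for changing `b` into `a`;
it also interchanges the rules for the two signs of `ℓ_i`. -/
theorem WordBalanced.reverse {α : Type} [DecidableEq α] {a b : α} {x y : List α}
    (h : WordBalanced a b x y) : WordBalanced b a y.reverse x.reverse := by
  constructor
  · intro v hv
    have := h.2 v.reverse (by rwa [← List.reverse_suffix, List.reverse_reverse])
    simpa using this
  · intro v hv
    obtain ⟨t, ht⟩ := hv
    have := h.1 v.reverse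
      ⟨t.reverse, by rw [← List.reverse_append, ht, List.reverse_reverse]⟩
    simpa using this

theorem actsBetween_plus_iff {i : Node m n} (hi : i.1 + 1 < m) (x y : List (Letter m n)) :
    ActsBetween i x y ↔ WordBalanced i.src i.tgt x y := by
  have h1 : ¬ i.IsOdd := by unfold Node.IsOdd; omega
  have h2 : 0 < ell i := (ell_pos_iff i).2 (by omega)
  have h3 := (bracket_plus hi x 0).2
  have h4 := (bracket_plus hi y 0).1
  simp only [Nat.le_zero, add_zero] at h3 h4
  simp only [ActsBetween, h1, h2, if_true, if_false, WordBalanced, h3, h4]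

theorem actsBetween_minus_iff {i : Node m n} (hi : m ≤ i.1) (x y : List (Letter m n)) :
    ActsBetween i x y ↔ WordBalanced i.tgt i.src x y := by
  have h1 : ¬ i.IsOdd := by unfold Node.IsOdd; omega
  have h2 : ¬ 0 < ell i := by rw [ell_pos_iff]; omega
  have h3 := (bracket_minus hi x 0).2
  have h4 := (bracket_minus hi y 0).1
  simp only [Nat.le_zero, add_zero] at h3 h4
  simp only [ActsBetween, h1, h2, if_false, WordBalanced, h3, h4]

theorem actsBetween_odd_iff {i : Node m n} (hi : i.IsOdd) (x y : List (Letter m n)) :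
    ActsBetween i x y ↔ i.src ∉ x ∧ i.tgt ∉ x := by
  rw [← odd_word_trivial_iff hi]
  simp only [ActsBetween, hi, if_true]

end WordBalance

/-! ### Strips of two consecutive letters in a monotone filling -/

section LocalOfFunction

variable {w : ℕ → ℕ → ℕ} {s : ℕ}

/-- The cells of the filling `w` with the entry `x`. -/
def cellsOf (w : ℕ → ℕ → ℕ) (x : ℕ) (p : ℤ × ℤ) : Prop :=
  ∃ i j : ℕ, p = ((i : ℤ), (j : ℤ)) ∧ w i j = x

/-- The cells of the filling `w` with the entry `x`, rotated by a half turn. -/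
def negCellsOf (w : ℕ → ℕ → ℕ) (x : ℕ) (p : ℤ × ℤ) : Prop :=
  ∃ i j : ℕ, p = (-(i : ℤ), -(j : ℤ)) ∧ w i j = x

theorem mono_of_steps (hrow : ∀ i j, w i j ≤ w i (j + 1)) (hcol : ∀ i j, w i j ≤ w (i + 1) j)
    {i j i' j' : ℕ} (hi : i ≤ i') (hj : j ≤ j') : w i j ≤ w i' j' :=
  (monotone_nat_of_le_succ (f := fun k => w i k) (hrow i) hj).trans
    (monotone_nat_of_le_succ (f := fun k => w k j') (fun k => hcol k j') hi)

theorem localCells_cellsOf (hrow : ∀ i j, w i j ≤ w i (j + 1))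
    (hcol : ∀ i j, w i j ≤ w (i + 1) j) (hs : ∀ i j, w i j = s → s < w (i + 1) j) :
    LocalCells (cellsOf w s) (cellsOf w (s + 1)) := by
  have hm := fun {i j i' j' : ℕ} => mono_of_steps hrow hcol (i := i) (j := j) (i' := i') (j' := j')
  constructor
  · rintro _ _ ⟨i, j, rfl, h1⟩ ⟨i', j', rfl, h2⟩ h
    simp only [Nat.cast_lt, Nat.cast_le] at h ⊢
    by_contra hj
    have := hs i j h1
    have := hm (i := i + 1) (i' := i') (j := j) (j' := j') (by omega) (by omega)
    omega
  · rintro r c c' ⟨i, j, h, h1⟩ ⟨i', j', h', h2⟩ ⟨i₂, j₂, h₂, h3⟩ hc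
    simp only [Prod.mk.injEq] at h h' h₂
    refine ⟨i₂ + 1, j₂, by simp only [Prod.mk.injEq]; omega, ?_⟩
    have := hs _ _ h3
    have := hm (i := i₂ + 1) (i' := i') (j := j₂) (j' := j') (by omega) (by omega)
    omega
  · rintro _ _ ⟨i, j, rfl, h1⟩ ⟨i', j', rfl, h2⟩ h h'
    simp only [Nat.cast_le] at h h'
    have := hm h h'
    omega
  · rintro _ _ ⟨i, j, rfl, h1⟩ ⟨i', j', rfl, h2⟩ h h'
    simp only [Nat.cast_lt] at h h'
    refine ⟨i + 1, j, by simp, ?_⟩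
    have := hs _ _ h1
    have := hm (i := i + 1) (i' := i') (j := j) (j' := j') (by omega) (by omega)
    omega

/-- A half turn reverses the order of the letters, so the larger letter now plays the part of `S`.
This is the presentation used for `ẽ_i`. -/
theorem localCells_negCellsOf (hrow : ∀ i j, w i j ≤ w i (j + 1))
    (hcol : ∀ i j, w i j ≤ w (i + 1) j) (ht : ∀ i j, w i j = s + 1 → s + 1 < w (i + 1) j) :
    LocalCells (negCellsOf w (s + 1)) (negCellsOf w s) := by
  have hm := fun {i j i' j' : ℕ} => mono_of_steps hrow hcol (i := i) (j := j) (i' := i') (j' := j')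
  have hup : ∀ i j, w (i + 1) j = s + 1 → w i j ≤ s := by
    intro i j h
    have h1 := hcol i j
    by_contra h2
    have := ht i j (by omega)
    omega
  constructor
  · rintro _ _ ⟨i, j, rfl, h1⟩ ⟨i', j', rfl, h2⟩ h
    simp only [neg_lt_neg_iff, neg_le_neg_iff, Nat.cast_lt, Nat.cast_le] at h ⊢
    by_contra hj
    have := ht i' j' h2
    have := hm (i := i' + 1) (i' := i) (j := j') (j' := j) (by omega) (by omega)
    omega
  · rintro r c c' ⟨i, j, h, h1⟩ ⟨i', j', h', h2⟩ ⟨i₂, j₂, h₂, h3⟩ hc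
    simp only [Prod.mk.injEq] at h h' h₂
    have hi : i₂ = i' + 1 := by omega
    subst hi
    refine ⟨i', j₂, by simp only [Prod.mk.injEq]; omega, ?_⟩
    have := hup _ _ h3
    have := hm (i := i') (i' := i') (j := j') (j' := j₂) (by omega) (by omega)
    omega
  · rintro _ _ ⟨i, j, rfl, h1⟩ ⟨i', j', rfl, h2⟩ h h'
    simp only [neg_le_neg_iff, Nat.cast_le] at h h'
    have := hm h h'
    omega
  · rintro _ _ ⟨i, j, rfl, h1⟩ ⟨i', j', rfl, h2⟩ h h'
    simp only [neg_lt_neg_iff, Nat.cast_lt] at h h'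
    obtain ⟨k, rfl⟩ : ∃ k, i = k + 1 := ⟨i - 1, by omega⟩
    refine ⟨k, j, by simp, ?_⟩
    have := hup _ _ h1
    have := hm (i := i') (i' := k) (j := j') (j' := j) (by omega) (by omega)
    omega

end LocalOfFunction

/-! ### From cells to letters -/

section Transfer

variable {α β : Type} [DecidableEq β] {S O : ℤ × ℤ → Prop} [DecidablePred S] [DecidablePred O]
  {e : α → β} {κ : α → ℤ × ℤ} {a b : β}

theorem balanced_map (hS : ∀ x, S (κ x) ↔ e x = a) (hO : ∀ x, O (κ x) ↔ e x = b)
    {l₁ l₂ : List α} :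
    Balanced S O (l₁.map κ) (l₂.map κ) ↔ WordBalanced a b (l₁.map e) (l₂.map e) := by
  have h1 : ∀ l : List α, (l.map κ).countP S = (l.map e).count a := by
    intro l
    rw [List.count, List.countP_map, List.countP_map]
    exact List.countP_congr fun x _ => by simp [hS]
  have h2 : ∀ l : List α, (l.map κ).countP O = (l.map e).count b := by
    intro l
    rw [List.count, List.countP_map, List.countP_map]
    exact List.countP_congr fun x _ => by simp [hO]
  simp only [Balanced, WordBalanced, List.suffix_map_iff, List.prefix_map_iff,
    forall_exists_index, and_imp]
  constructor
  · rintro ⟨k1, k2⟩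
    refine ⟨fun v u hu hv => ?_, fun v u hu hv => ?_⟩
    · subst hv; rw [← h1, ← h2]; exact k1 _ u hu rfl
    · subst hv; rw [← h1, ← h2]; exact k2 _ u hu rfl
  · rintro ⟨k1, k2⟩
    refine ⟨fun v u hu hv => ?_, fun v u hu hv => ?_⟩
    · subst hv; rw [h1, h2]; exact k1 _ u hu rfl
    · subst hv; rw [h1, h2]; exact k2 _ u hu rfl

theorem suffix_balanced_map (hS : ∀ x, S (κ x) ↔ e x = a) (hO : ∀ x, O (κ x) ↔ e x = b)
    {l : List α} (h : ∀ v, v <:+ l.map e → v.count a ≤ v.count b) :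
    ∀ v, v <:+ l.map κ → v.countP S ≤ v.countP O :=
  ((balanced_map hS hO (l₁ := l) (l₂ := [])).2 ⟨h, by simp⟩).1

end Transfer

/-! ### Fillings of Young diagrams -/

/-- The function `v` with values in `{0, …, m + n}` is a semistandard filling of `Y`, extended by
`m + n` outside `Y`. -/
structure IsFilling (m n : ℕ) (Y : YoungDiagram) (v : ℕ → ℕ → ℕ) : Prop where
  lt_iff : ∀ i j, v i j < m + n ↔ (i, j) ∈ Y
  le : ∀ i j, v i j ≤ m + n
  row : ∀ i j, v i j ≤ v i (j + 1)
  col : ∀ i j, v i j ≤ v (i + 1) j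
  row_lt : ∀ i j, m ≤ v i j → v i j < m + n → v i j < v i (j + 1)
  col_lt : ∀ i j, v i j < m → v i j < v (i + 1) j

section Filling

variable {m n : ℕ} {Y : YoungDiagram} {v : ℕ → ℕ → ℕ}

/-- The entries of a tableau as numbers, extended by `m + n` outside the diagram. -/
def Tableau.val (T : Tableau m n Y) (i j : ℕ) : ℕ :=
  if h : (i, j) ∈ Y then (T.entry ⟨(i, j), h⟩).val else m + n

theorem Tableau.val_box (T : Tableau m n Y) (β : Box Y) : T.val β.1.1 β.1.2 = (T.entry β).val := by
  rw [Tableau.val, dif_pos β.2]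

theorem Tableau.val_of_mem (T : Tableau m n Y) {i j : ℕ} (h : (i, j) ∈ Y) :
    T.val i j = (T.entry ⟨(i, j), h⟩).val := by
  rw [Tableau.val, dif_pos h]

theorem Tableau.val_injective : Function.Injective (Tableau.val (m := m) (n := n) (Y := Y)) := by
  intro T T' h
  ext β
  rw [← T.val_box, ← T'.val_box, h]

theorem Tableau.isFilling (T : Tableau m n Y) : IsFilling m n Y T.val where
  lt_iff i j := by
    unfold Tableau.val
    split_ifs with h
    · simp [h]
    · simp [h]
  le i j := by
    unfold Tableau.val
    split_ifs <;> omega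
  row i j := by
    unfold Tableau.val
    split_ifs with h h'
    · have := T.row_ok ⟨(i, j), h⟩ ⟨(i, j + 1), h'⟩ rfl (Nat.lt_succ_self j)
      rcases this with h1 | h1
      · exact le_of_lt h1
      · exact le_of_eq (congrArg Fin.val h1.1)
    · omega
    · rename_i h'
      exact absurd (Y.up_left_mem le_rfl (Nat.le_succ j) h') h
    · rfl
  col i j := by
    unfold Tableau.val
    split_ifs with h h'
    · have := T.col_ok ⟨(i, j), h⟩ ⟨(i + 1, j), h'⟩ rfl (Nat.lt_succ_self i)
      rcases this with h1 | h1
      · exact le_of_lt h1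
      · exact le_of_eq (congrArg Fin.val h1.1)
    · omega
    · rename_i h'
      exact absurd (Y.up_left_mem (Nat.le_succ i) le_rfl h') h
    · rfl
  row_lt i j := by
    unfold Tableau.val
    split_ifs with h h'
    · intro h2 _
      have := T.row_ok ⟨(i, j), h⟩ ⟨(i, j + 1), h'⟩ rfl (Nat.lt_succ_self j)
      rcases this with h1 | h1
      · exact h1
      · exact absurd h1.2 (by simpa [Letter.IsPlus] using h2)
    all_goals omega
  col_lt i j := by
    unfold Tableau.val
    split_ifs with h h'
    · intro h2
      have := T.col_ok ⟨(i, j), h⟩ ⟨(i + 1, j), h'⟩ rfl (Nat.lt_succ_self i)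
      rcases this with h1 | h1
      · exact h1
      · exact absurd h2 h1.2
    all_goals omega

theorem IsFilling.mono (h : IsFilling m n Y v) {i j i' j' : ℕ} (hi : i ≤ i') (hj : j ≤ j') :
    v i j ≤ v i' j' := mono_of_steps h.row h.col hi hj

/-- The tableau with the entries `v`. -/
def IsFilling.toTableau (h : IsFilling m n Y v) : Tableau m n Y where
  entry β := ⟨v β.1.1 β.1.2, (h.lt_iff _ _).2 β.2⟩
  row_ok := by
    rintro ⟨⟨i, j⟩, hβ⟩ ⟨⟨i', j'⟩, hβ'⟩ hi hj
    simp only at hi hj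
    subst hi
    have h1 := h.mono (le_refl i) (show j + 1 ≤ j' from hj)
    have h2 := h.row i j
    have h3 := h.row_lt i j
    have h4 := (h.lt_iff i j).2 hβ
    simp only [RowOK, Letter.IsPlus, Fin.lt_def, Fin.ext_iff]
    omega
  col_ok := by
    rintro ⟨⟨i, j⟩, hβ⟩ ⟨⟨i', j'⟩, hβ'⟩ hj hi
    simp only at hi hj
    subst hj
    have h1 := h.mono (show i + 1 ≤ i' from hi) (le_refl j)
    have h2 := h.col i j
    have h3 := h.col_lt i j
    simp only [ColOK, Letter.IsPlus, Fin.lt_def, Fin.ext_iff]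
    omega

theorem IsFilling.val_toTableau (h : IsFilling m n Y v) : h.toTableau.val = v := by
  funext i j
  unfold Tableau.val
  split_ifs with h1
  · rfl
  · have := h.le i j
    have := (h.lt_iff i j).not.2 h1
    omega

/-- Change of one entry of a filling. -/
theorem IsFilling.update (h : IsFilling m n Y v) {i₀ j₀ x : ℕ} (hβ : (i₀, j₀) ∈ Y)
    (hx : x < m + n)
    (hl : ∀ j, j + 1 = j₀ → v i₀ j ≤ x ∧ (m ≤ v i₀ j → v i₀ j < x))
    (hr : x ≤ v i₀ (j₀ + 1) ∧ (m ≤ x → x < v i₀ (j₀ + 1)))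
    (hu : ∀ i, i + 1 = i₀ → v i j₀ ≤ x ∧ (v i j₀ < m → v i j₀ < x))
    (hd : x ≤ v (i₀ + 1) j₀ ∧ (x < m → x < v (i₀ + 1) j₀)) :
    IsFilling m n Y fun i j => if i = i₀ ∧ j = j₀ then x else v i j := by
  constructor
  · intro i j
    split_ifs with h1
    · obtain ⟨rfl, rfl⟩ := h1; simp [hx, hβ]
    · exact h.lt_iff i j
  · intro i j
    split_ifs with h1
    · omega
    · exact h.le i j
  · intro i j
    split_ifs with h1 h2 h2
    · omega
    · obtain ⟨rfl, rfl⟩ := h1; exact hr.1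
    · obtain ⟨rfl, rfl⟩ := h2; exact (hl j rfl).1
    · exact h.row i j
  · intro i j
    split_ifs with h1 h2 h2
    · omega
    · obtain ⟨rfl, rfl⟩ := h1; exact hd.1
    · obtain ⟨rfl, rfl⟩ := h2; exact (hu i rfl).1
    · exact h.col i j
  · intro i j
    split_ifs with h1 h2 h2
    · omega
    · obtain ⟨rfl, rfl⟩ := h1; exact fun k _ => hr.2 k
    · obtain ⟨rfl, rfl⟩ := h2; exact fun k _ => (hl j rfl).2 k
    · exact h.row_lt i j
  · intro i j
    split_ifs with h1 h2 h2
    · omega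
    · obtain ⟨rfl, rfl⟩ := h1; exact hd.2
    · obtain ⟨rfl, rfl⟩ := h2; exact (hu i rfl).2
    · exact h.col_lt i j

end Filling

/-! ### The cell arguments restated for words of fillings -/

section Transfer

variable {α β : Type} [DecidableEq β] {S O : ℤ × ℤ → Prop} {e : α → β} {κ : α → ℤ × ℤ} {a b : β}

theorem cellList_map {l : List α} (hκ : Function.Injective κ) (hl : l.Nodup)
    (hmem : ∀ p, S p ∨ O p → ∃ x ∈ l, κ x = p)
    (ho : l.Pairwise fun x y => ¬ (y ≠ x ∧ (κ y).1 ≤ (κ x).1 ∧ (κ x).2 ≤ (κ y).2)) :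
    CellList S O (l.map κ) where
  nodup := hl.map hκ
  mem p hp := List.mem_map.2 (hmem p hp)
  order := by
    rw [List.pairwise_map]
    exact ho.imp fun h h' => h ⟨fun h2 => h'.1 (by rw [h2]), h'.2⟩

theorem LocalCells.forbidden (hloc : LocalCells S O) (hS : ∀ x, S (κ x) ↔ e x = a)
    (hO : ∀ x, O (κ x) ↔ e x = b) {l₁ l₂ : List α} {x : α}
    (h : CellList S O ((l₁ ++ x :: l₂).map κ)) (hx : e x = a)
    (hbal : WordBalanced a b (l₁.map e) (l₂.map e)) :
    ¬ O ((κ x).1 + 1, (κ x).2) ∧ ¬ S ((κ x).1, (κ x).2 + 1) := by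
  classical
  rw [List.map_append, List.map_cons] at h
  have hb := (balanced_map hS hO).2 hbal
  exact ⟨h.not_below hloc ((hS x).2 hx) hb, h.not_right hloc ((hS x).2 hx) hb⟩

theorem LocalCells.balanced_unique (hloc : LocalCells S O) (hκ : Function.Injective κ)
    (hS : ∀ x, S (κ x) ↔ e x = a)
    (hO : ∀ x, O (κ x) ↔ e x = b) {l₁ l₂ l' : List α} {x : α}
    (h : CellList S O ((l₁ ++ x :: l₂).map κ)) (h' : CellList S O (l'.map κ)) (hx : e x = a)
    (hbal : WordBalanced a b (l₁.map e) (l₂.map e))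
    (halt : (∃ u z v, l'.map e = u ++ z :: v ∧ z = a ∧ WordBalanced a b u v) ∨
      ∀ v, v <:+ l'.map e → v.count a ≤ v.count b) :
    ∃ m₁ m₂, l' = m₁ ++ x :: m₂ ∧ WordBalanced a b (m₁.map e) (m₂.map e) := by
  classical
  rw [List.map_append, List.map_cons] at h
  have hb := (balanced_map hS hO).2 hbal
  obtain ⟨M₁, M₂, h1, h2⟩ := h.balanced_unique h' hloc ((hS x).2 hx) hb (by
    rcases halt with ⟨u, z, v, h1, h2, h3⟩ | h1
    · left
      obtain ⟨m₁, m₃, rfl, rfl, h4⟩ := List.map_eq_append_iff.1 h1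
      obtain ⟨y, m₂, rfl, rfl, rfl⟩ := List.map_eq_cons_iff.1 h4
      exact ⟨m₁.map κ, κ y, m₂.map κ, by simp, (hS y).2 h2, (balanced_map hS hO).2 h3⟩
    · right
      exact suffix_balanced_map hS hO h1)
  obtain ⟨m₁, m₃, rfl, rfl, h4⟩ := List.map_eq_append_iff.1 h1
  obtain ⟨y, m₂, rfl, h5, rfl⟩ := List.map_eq_cons_iff.1 h4
  obtain rfl := hκ h5
  exact ⟨m₁, m₂, rfl, (balanced_map hS hO).1 h2⟩

end Transfer

/-! ### Readings -/

section Readings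

variable {m n : ℕ} {Y : YoungDiagram}

/-- An admissible reading as a list of boxes. -/
structure IsReading (l : List (Box Y)) : Prop where
  nodup : l.Nodup
  mem : ∀ β, β ∈ l
  order : l.Pairwise fun p q => ¬ StrictlyHigher q p

theorem AdmissibleReading.isReading (r : AdmissibleReading Y) : IsReading (List.ofFn r.box) where
  nodup := List.nodup_ofFn.2 r.box.injective
  mem β := List.mem_ofFn.2 ⟨r.box.symm β, by simp⟩
  order := by
    rw [List.pairwise_ofFn]
    intro p q hpq h
    exact absurd (r.admissible q p h) (by omega)

/-- The word of a tableau along a list of boxes. -/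
def Tableau.word (T : Tableau m n Y) (l : List (Box Y)) : List (Letter m n) := l.map T.entry

theorem AdmissibleReading.ofFn_word (r : AdmissibleReading Y) (T : Tableau m n Y) :
    List.ofFn (r.word T) = T.word (List.ofFn r.box) := by
  rw [Tableau.word, List.map_ofFn]
  rfl

theorem Tableau.val_eq_iff (T : Tableau m n Y) (β : Box Y) (x : Letter m n) :
    T.val β.1.1 β.1.2 = x.val ↔ T.entry β = x := by
  rw [T.val_box, Fin.ext_iff]

theorem Tableau.mem_of_val_eq (T : Tableau m n Y) {i j : ℕ} {x : Letter m n}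
    (h : T.val i j = x.val) : (i, j) ∈ Y :=
  (T.isFilling.lt_iff i j).1 (by omega)

/-! ### Four placements in the plane: direct or turned, transposed or not -/

section Presentations

variable (T : Tableau m n Y) {l : List (Box Y)}

theorem cellsOf_iff (x : Letter m n) (β : Box Y) :
    cellsOf T.val x.val ((β.1.1 : ℤ), (β.1.2 : ℤ)) ↔ T.entry β = x := by
  rw [← T.val_eq_iff]
  constructor
  · rintro ⟨i, j, h, h1⟩
    simp only [Prod.mk.injEq, Nat.cast_inj] at h
    rw [h.1, h.2]
    exact h1
  · intro h
    exact ⟨_, _, rfl, h⟩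

theorem negCellsOf_iff (x : Letter m n) (β : Box Y) :
    negCellsOf T.val x.val (-(β.1.1 : ℤ), -(β.1.2 : ℤ)) ↔ T.entry β = x := by
  rw [← T.val_eq_iff]
  constructor
  · rintro ⟨i, j, h, h1⟩
    simp only [Prod.mk.injEq, neg_inj, Nat.cast_inj] at h
    rw [h.1, h.2]
    exact h1
  · intro h
    exact ⟨_, _, rfl, h⟩

theorem cellsOf_swap_iff (x : Letter m n) (β : Box Y) :
    cellsOf (fun i j => T.val j i) x.val ((β.1.2 : ℤ), (β.1.1 : ℤ)) ↔ T.entry β = x := by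
  rw [← T.val_eq_iff]
  constructor
  · rintro ⟨i, j, h, h1⟩
    simp only [Prod.mk.injEq, Nat.cast_inj] at h
    rw [h.1, h.2]
    exact h1
  · intro h
    exact ⟨_, _, rfl, h⟩

theorem negCellsOf_swap_iff (x : Letter m n) (β : Box Y) :
    negCellsOf (fun i j => T.val j i) x.val (-(β.1.2 : ℤ), -(β.1.1 : ℤ)) ↔ T.entry β = x := by
  rw [← T.val_eq_iff]
  constructor
  · rintro ⟨i, j, h, h1⟩
    simp only [Prod.mk.injEq, neg_inj, Nat.cast_inj] at h
    rw [h.1, h.2]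
    exact h1
  · intro h
    exact ⟨_, _, rfl, h⟩

theorem cellList_plus (hl : IsReading l) (x y : Letter m n) :
    CellList (cellsOf T.val x.val) (cellsOf T.val y.val)
      (l.map fun β => ((β.1.1 : ℤ), (β.1.2 : ℤ))) := by
  refine cellList_map ?_ hl.nodup ?_ ?_
  · rintro ⟨⟨_, _⟩, _⟩ ⟨⟨_, _⟩, _⟩ h
    simpa using h
  · rintro p (⟨i, j, rfl, h⟩ | ⟨i, j, rfl, h⟩) <;>
      exact ⟨⟨(i, j), T.mem_of_val_eq h⟩, hl.mem _, rfl⟩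
  · refine hl.order.imp fun h h' => h ⟨h'.1, ?_⟩
    simp only [Nat.cast_le] at h'
    exact h'.2

theorem cellList_neg_plus (hl : IsReading l) (x y : Letter m n) :
    CellList (negCellsOf T.val x.val) (negCellsOf T.val y.val)
      (l.reverse.map fun β => (-(β.1.1 : ℤ), -(β.1.2 : ℤ))) := by
  refine cellList_map ?_ (List.nodup_reverse.2 hl.nodup) ?_ ?_
  · rintro ⟨⟨_, _⟩, _⟩ ⟨⟨_, _⟩, _⟩ h
    simpa using h
  · rintro p (⟨i, j, rfl, h⟩ | ⟨i, j, rfl, h⟩) <;>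
      exact ⟨⟨(i, j), T.mem_of_val_eq h⟩, List.mem_reverse.2 (hl.mem _), rfl⟩
  · rw [List.pairwise_reverse]
    refine hl.order.imp fun h h' => h ⟨h'.1.symm, ?_⟩
    simp only [neg_le_neg_iff, Nat.cast_le] at h'
    exact h'.2

theorem cellList_minus (hl : IsReading l) (x y : Letter m n) :
    CellList (cellsOf (fun i j => T.val j i) x.val) (cellsOf (fun i j => T.val j i) y.val)
      (l.reverse.map fun β => ((β.1.2 : ℤ), (β.1.1 : ℤ))) := by
  refine cellList_map ?_ (List.nodup_reverse.2 hl.nodup) ?_ ?_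
  · rintro ⟨⟨_, _⟩, _⟩ ⟨⟨_, _⟩, _⟩ h
    simpa [and_comm] using h
  · rintro p (⟨i, j, rfl, h⟩ | ⟨i, j, rfl, h⟩) <;>
      exact ⟨⟨(j, i), T.mem_of_val_eq h⟩, List.mem_reverse.2 (hl.mem _), rfl⟩
  · rw [List.pairwise_reverse]
    refine hl.order.imp fun h h' => h ⟨h'.1.symm, ?_⟩
    simp only [Nat.cast_le] at h'
    exact h'.2.symm

theorem cellList_neg_minus (hl : IsReading l) (x y : Letter m n) :
    CellList (negCellsOf (fun i j => T.val j i) x.val) (negCellsOf (fun i j => T.val j i) y.val)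
      (l.map fun β => (-(β.1.2 : ℤ), -(β.1.1 : ℤ))) := by
  refine cellList_map ?_ hl.nodup ?_ ?_
  · rintro ⟨⟨_, _⟩, _⟩ ⟨⟨_, _⟩, _⟩ h
    simpa [and_comm] using h
  · rintro p (⟨i, j, rfl, h⟩ | ⟨i, j, rfl, h⟩) <;>
      exact ⟨⟨(j, i), T.mem_of_val_eq h⟩, hl.mem _, rfl⟩
  · refine hl.order.imp fun h h' => h ⟨h'.1, ?_⟩
    simp only [neg_le_neg_iff, Nat.cast_le] at h'
    exact h'.2.symm

end Presentations

theorem Tableau.local_plus (T : Tableau m n Y) {i : Node m n} (hi : i.1 + 1 < m) :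
    LocalCells (cellsOf T.val i.src.val) (cellsOf T.val i.tgt.val) :=
  localCells_cellsOf T.isFilling.row T.isFilling.col fun a b (h : T.val a b = i.1) => by
    have := T.isFilling.col_lt a b (by omega)
    rwa [h] at this

theorem Tableau.local_neg_plus (T : Tableau m n Y) {i : Node m n} (hi : i.1 + 1 < m) :
    LocalCells (negCellsOf T.val i.tgt.val) (negCellsOf T.val i.src.val) :=
  localCells_negCellsOf T.isFilling.row T.isFilling.col fun a b (h : T.val a b = i.1 + 1) => by
    have := T.isFilling.col_lt a b (by omega)
    rwa [h] at this

theorem Tableau.local_minus (T : Tableau m n Y) {i : Node m n} (hi : m ≤ i.1) :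
    LocalCells (cellsOf (fun a b => T.val b a) i.src.val)
      (cellsOf (fun a b => T.val b a) i.tgt.val) :=
  localCells_cellsOf (fun a b => T.isFilling.col b a) (fun a b => T.isFilling.row b a)
    fun a b (h : T.val b a = i.1) => by
      have := T.isFilling.row_lt b a (by omega) (by have := i.2; omega)
      rwa [h] at this

theorem Tableau.local_neg_minus (T : Tableau m n Y) {i : Node m n} (hi : m ≤ i.1) :
    LocalCells (negCellsOf (fun a b => T.val b a) i.tgt.val)
      (negCellsOf (fun a b => T.val b a) i.src.val) :=
  localCells_negCellsOf (fun a b => T.isFilling.col b a) (fun a b => T.isFilling.row b a)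
    fun a b (h : T.val b a = i.1 + 1) => by
      have := T.isFilling.row_lt b a (by omega) (by have := i.2; omega)
      rwa [h] at this

variable {i : Node m n} {l₁ l₂ : List (Box Y)} {β : Box Y}

/-- Where columns are strict, only the source letter on the right or the target letter below could
prevent raising the entry of `β`; both are excluded by the bracketing. -/
theorem Tableau.src_forbidden_plus (T : Tableau m n Y) (hi : i.1 + 1 < m)
    (hl : IsReading (l₁ ++ β :: l₂)) (hβ : T.entry β = i.src)
    (hA : ActsBetween i (T.word l₁) (T.word l₂)) :
    T.val (β.1.1 + 1) β.1.2 ≠ i.1 + 1 ∧ T.val β.1.1 (β.1.2 + 1) ≠ i.1 := by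
  have h := (T.local_plus hi).forbidden (cellsOf_iff T _) (cellsOf_iff T _)
    (cellList_plus T hl i.src i.tgt) hβ ((actsBetween_plus_iff hi _ _).1 hA)
  exact ⟨fun h1 => h.1 ⟨β.1.1 + 1, β.1.2, by simp, h1⟩,
    fun h1 => h.2 ⟨β.1.1, β.1.2 + 1, by simp, h1⟩⟩

/-- The corresponding obstructions to lowering an entry, obtained from the half turn. -/
theorem Tableau.tgt_forbidden_plus (T : Tableau m n Y) (hi : i.1 + 1 < m)
    (hl : IsReading (l₁ ++ β :: l₂)) (hβ : T.entry β = i.tgt)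
    (hA : ActsBetween i (T.word l₁) (T.word l₂)) :
    (∀ a, a + 1 = β.1.1 → T.val a β.1.2 ≠ i.1) ∧
      ∀ b, b + 1 = β.1.2 → T.val β.1.1 b ≠ i.1 + 1 := by
  have hc := cellList_neg_plus T hl i.tgt i.src
  rw [List.reverse_append, List.reverse_cons, List.append_assoc, List.singleton_append] at hc
  have h := (T.local_neg_plus hi).forbidden (negCellsOf_iff T _) (negCellsOf_iff T _) hc hβ (by
    rw [List.map_reverse, List.map_reverse]
    exact ((actsBetween_plus_iff hi _ _).1 hA).reverse)
  exact ⟨fun a ha h1 => h.1 ⟨a, β.1.2, by simp [← ha], h1⟩,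
    fun b hb h1 => h.2 ⟨β.1.1, b, by simp [← hb], h1⟩⟩

/-- For the letters of `𝐁₋` rows are strict instead of columns, so the transposed filling and the
reversed reading are used. -/
theorem Tableau.src_forbidden_minus (T : Tableau m n Y) (hi : m ≤ i.1)
    (hl : IsReading (l₁ ++ β :: l₂)) (hβ : T.entry β = i.src)
    (hA : ActsBetween i (T.word l₁) (T.word l₂)) :
    T.val β.1.1 (β.1.2 + 1) ≠ i.1 + 1 ∧ T.val (β.1.1 + 1) β.1.2 ≠ i.1 := by
  have hc := cellList_minus T hl i.src i.tgt
  rw [List.reverse_append, List.reverse_cons, List.append_assoc, List.singleton_append] at hc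
  have h := (T.local_minus hi).forbidden (cellsOf_swap_iff T _) (cellsOf_swap_iff T _) hc hβ (by
    rw [List.map_reverse, List.map_reverse]
    exact ((actsBetween_minus_iff hi _ _).1 hA).reverse)
  exact ⟨fun h1 => h.1 ⟨β.1.2 + 1, β.1.1, by simp, h1⟩,
    fun h1 => h.2 ⟨β.1.2, β.1.1 + 1, by simp, h1⟩⟩

theorem Tableau.tgt_forbidden_minus (T : Tableau m n Y) (hi : m ≤ i.1)
    (hl : IsReading (l₁ ++ β :: l₂)) (hβ : T.entry β = i.tgt)
    (hA : ActsBetween i (T.word l₁) (T.word l₂)) :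
    (∀ b, b + 1 = β.1.2 → T.val β.1.1 b ≠ i.1) ∧
      ∀ a, a + 1 = β.1.1 → T.val a β.1.2 ≠ i.1 + 1 := by
  have h := (T.local_neg_minus hi).forbidden (negCellsOf_swap_iff T _) (negCellsOf_swap_iff T _)
    (cellList_neg_minus T hl i.tgt i.src) hβ ((actsBetween_minus_iff hi _ _).1 hA)
  exact ⟨fun b hb h1 => h.1 ⟨b, β.1.1, by simp [← hb], h1⟩,
    fun a ha h1 => h.2 ⟨β.1.2, a, by simp [← ha], h1⟩⟩

theorem IsReading.mem_left (hl : IsReading (l₁ ++ β :: l₂)) {γ : Box Y}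
    (h : StrictlyHigher γ β) : γ ∈ l₁ := by
  have ho := hl.order
  rw [List.pairwise_append, List.pairwise_cons] at ho
  have hm := hl.mem γ
  simp only [List.mem_append, List.mem_cons, h.1, false_or] at hm
  rcases hm with hm | hm
  · exact hm
  · exact absurd h (ho.2.1.1 γ hm)

/-- A strictly higher box is read earlier, and the odd operator acts on the first of its two
letters. -/
theorem Tableau.forbidden_odd (T : Tableau m n Y) (hi : i.IsOdd)
    (hl : IsReading (l₁ ++ β :: l₂))
    (hA : ActsBetween i (T.word l₁) (T.word l₂)) {γ : Box Y} (hγ : StrictlyHigher γ β) :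
    T.entry γ ≠ i.src ∧ T.entry γ ≠ i.tgt := by
  rw [actsBetween_odd_iff hi] at hA
  have := List.mem_map_of_mem (f := T.entry) (hl.mem_left hγ)
  exact ⟨fun h => hA.1 (h ▸ this), fun h => hA.2 (h ▸ this)⟩

theorem IsReading.left_right_ne (hl : IsReading (l₁ ++ β :: l₂)) :
    (∀ γ ∈ l₁, γ ≠ β) ∧ ∀ γ ∈ l₂, γ ≠ β := by
  have hn := hl.nodup
  rw [List.nodup_append, List.nodup_cons] at hn
  exact ⟨fun γ hγ h => hn.2.2 γ hγ β (by simp) h, fun γ hγ h => hn.2.1.1 (h ▸ hγ)⟩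

/-- The tableau obtained by changing one entry. -/
theorem Tableau.exists_update (T : Tableau m n Y) (β : Box Y) (x : Letter m n)
    (h : IsFilling m n Y fun i j => if i = β.1.1 ∧ j = β.1.2 then x.val else T.val i j) :
    ∃ T' : Tableau m n Y, T'.entry β = x ∧ ∀ γ, γ ≠ β → T'.entry γ = T.entry γ := by
  refine ⟨h.toTableau, ?_, ?_⟩
  · rw [← Tableau.val_eq_iff, h.val_toTableau]
    simp
  · rintro ⟨⟨a, b⟩, hγ⟩ hne
    rw [← Tableau.val_eq_iff, h.val_toTableau]
    have : ¬ (a = β.1.1 ∧ b = β.1.2) := by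
      rintro ⟨rfl, rfl⟩; exact hne rfl
    simp only [this, if_false]
    exact T.val_of_mem hγ

theorem Tableau.word_update {T T' : Tableau m n Y} (hl : IsReading (l₁ ++ β :: l₂))
    (h : ∀ γ, γ ≠ β → T'.entry γ = T.entry γ) :
    T'.word (l₁ ++ β :: l₂) = T.word l₁ ++ T'.entry β :: T.word l₂ := by
  obtain ⟨h1, h2⟩ := hl.left_right_ne
  simp only [Tableau.word, List.map_append, List.map_cons]
  rw [List.map_congr_left fun γ hγ => h γ (h1 γ hγ), List.map_congr_left fun γ hγ => h γ (h2 γ hγ)]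

theorem Tableau.exists_update_tgt (T : Tableau m n Y) (hl : IsReading (l₁ ++ β :: l₂))
    (hβ : T.entry β = i.src) (hA : ActsBetween i (T.word l₁) (T.word l₂)) :
    ∃ T' : Tableau m n Y, T'.entry β = i.tgt ∧ ∀ γ, γ ≠ β → T'.entry γ = T.entry γ := by
  apply T.exists_update
  have hF := T.isFilling
  have hv : T.val β.1.1 β.1.2 = i.1 := by rw [T.val_box, hβ]; rfl
  have hi2 := i.2
  obtain ⟨⟨⟨a, b⟩, hY⟩, rfl⟩ : ∃ γ : Box Y, β = γ := ⟨β, rfl⟩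
  simp only at hv ⊢
  have g1 := hF.row a b
  have g2 := hF.col a b
  have g3 := hF.row_lt a b
  have g4 := hF.col_lt a b
  have hr : i.1 + 1 ≤ T.val a (b + 1) ∧ (m ≤ i.1 + 1 → i.1 + 1 < T.val a (b + 1)) := by
    rcases lt_trichotomy (i.1 + 1) m with h | h | h
    · have := (T.src_forbidden_plus h hl hβ hA).2
      simp only at this
      omega
    -- At the odd node the right neighbour is the only obstacle. It is a strictly higher box, unless
    -- it lies outside the diagram, where the value is `m + n`.
    · have : T.val a (b + 1) ≠ i.1 ∧ T.val a (b + 1) ≠ i.1 + 1 := by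
        by_cases hm : (a, b + 1) ∈ Y
        · have := T.forbidden_odd h hl hA (γ := ⟨(a, b + 1), hm⟩) ⟨by simp, by simp, by simp⟩
          rw [T.val_of_mem hm]
          simpa [Fin.ext_iff, Node.src, Node.tgt] using this
        · have := (hF.lt_iff a (b + 1)).not.2 hm
          omega
      omega
    · have := (T.src_forbidden_minus (by omega) hl hβ hA).1
      simp only at this
      omega
  have hd : i.1 + 1 ≤ T.val (a + 1) b ∧ (i.1 + 1 < m → i.1 + 1 < T.val (a + 1) b) := by
    rcases lt_trichotomy (i.1 + 1) m with h | h | h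
    · have := (T.src_forbidden_plus h hl hβ hA).1
      simp only at this
      omega
    · omega
    · have := (T.src_forbidden_minus (by omega) hl hβ hA).2
      simp only at this
      omega
  refine hF.update hY hi2 ?_ hr ?_ hd
  · rintro j rfl
    have := hF.row a j
    change T.val a j ≤ i.1 + 1 ∧ (m ≤ T.val a j → T.val a j < i.1 + 1)
    omega
  · rintro j rfl
    have := hF.col j b
    change T.val j b ≤ i.1 + 1 ∧ (T.val j b < m → T.val j b < i.1 + 1)
    omega

theorem Tableau.exists_update_src (T : Tableau m n Y) (hl : IsReading (l₁ ++ β :: l₂))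
    (hβ : T.entry β = i.tgt) (hA : ActsBetween i (T.word l₁) (T.word l₂)) :
    ∃ T' : Tableau m n Y, T'.entry β = i.src ∧ ∀ γ, γ ≠ β → T'.entry γ = T.entry γ := by
  apply T.exists_update
  have hF := T.isFilling
  have hv : T.val β.1.1 β.1.2 = i.1 + 1 := by rw [T.val_box, hβ]; rfl
  have hi2 := i.2
  obtain ⟨⟨⟨a, b⟩, hY⟩, rfl⟩ : ∃ γ : Box Y, β = γ := ⟨β, rfl⟩
  simp only at hv ⊢
  have g1 := hF.row a b
  have g2 := hF.col a b
  refine hF.update hY (show i.1 < m + n by omega) ?_ ⟨?_, ?_⟩ ?_ ⟨?_, ?_⟩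
  · rintro j rfl
    have h1 := hF.row a j
    have h2 := hF.row_lt a j
    change T.val a j ≤ i.1 ∧ (m ≤ T.val a j → T.val a j < i.1)
    rcases lt_trichotomy (i.1 + 1) m with h | h | h
    · have := (T.tgt_forbidden_plus h hl hβ hA).2 j rfl
      simp only at this
      omega
    · omega
    · have := (T.tgt_forbidden_minus (by omega) hl hβ hA).1 j rfl
      simp only at this
      omega
  · change i.1 ≤ _; omega
  · change m ≤ i.1 → i.1 < _; omega
  · rintro j rfl
    have h1 := hF.col j b
    have h2 := hF.col_lt j b
    change T.val j b ≤ i.1 ∧ (T.val j b < m → T.val j b < i.1)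
    rcases lt_trichotomy (i.1 + 1) m with h | h | h
    · have := (T.tgt_forbidden_plus h hl hβ hA).1 j rfl
      simp only at this
      omega
    -- When the target of the odd arrow is lowered, the obstacle is the box above. It too is
    -- strictly higher and so contains neither letter.
    · have hm : (j, b) ∈ Y := Y.up_left_mem (Nat.le_succ j) le_rfl hY
      have := T.forbidden_odd h hl hA (γ := ⟨(j, b), hm⟩) ⟨by simp, by simp, by simp⟩
      have h3 : T.val j b ≠ i.1 ∧ T.val j b ≠ i.1 + 1 := by
        rw [T.val_of_mem hm]
        simpa [Fin.ext_iff, Node.src, Node.tgt] using this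
      omega
    · have := (T.tgt_forbidden_minus (by omega) hl hβ hA).2 j rfl
      simp only at this
      omega
  · change i.1 ≤ _; omega
  · change i.1 < m → i.1 < _; omega

theorem Tableau.word_eq_append_cons_iff {T : Tableau m n Y} {l : List (Box Y)}
    {x y : List (Letter m n)} {c : Letter m n} (h : T.word l = x ++ c :: y) :
    ∃ l₁ β l₂, l = l₁ ++ β :: l₂ ∧ T.word l₁ = x ∧ T.entry β = c ∧ T.word l₂ = y := by
  obtain ⟨l₁, l₃, rfl, h1, h4⟩ := List.map_eq_append_iff.1 h
  obtain ⟨β, l₂, rfl, h5, h6⟩ := List.map_eq_cons_iff.1 h4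
  exact ⟨l₁, β, l₂, rfl, h1, h5, h6⟩

/-- The words of the tableaux of a given shape are stable under the `f̃_i`. -/
theorem Tableau.exists_of_f_word (T : Tableau m n Y) {l : List (Box Y)} (hl : IsReading l)
    {w : List (Letter m n)} (h : (listCrystal m n).f i (T.word l) = some w) :
    ∃ T' : Tableau m n Y, w = T'.word l := by
  obtain ⟨x, y, h1, rfl, hA⟩ := (listCrystal_f_eq_some_iff i _ _).1 h
  obtain ⟨l₁, β, l₂, rfl, rfl, hβ, rfl⟩ := Tableau.word_eq_append_cons_iff h1
  obtain ⟨T', h2, h3⟩ := T.exists_update_tgt hl hβ hA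
  exact ⟨T', by rw [Tableau.word_update hl h3, h2]⟩

/-- The words of the tableaux of a given shape are stable under the `ẽ_i`. -/
theorem Tableau.exists_of_e_word (T : Tableau m n Y) {l : List (Box Y)} (hl : IsReading l)
    {w : List (Letter m n)} (h : (listCrystal m n).f i w = some (T.word l)) :
    ∃ T' : Tableau m n Y, w = T'.word l := by
  obtain ⟨x, y, rfl, h1, hA⟩ := (listCrystal_f_eq_some_iff i _ _).1 h
  obtain ⟨l₁, β, l₂, rfl, rfl, hβ, rfl⟩ := Tableau.word_eq_append_cons_iff h1
  obtain ⟨T', h2, h3⟩ := T.exists_update_src hl hβ hA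
  exact ⟨T', by rw [Tableau.word_update hl h3, h2]⟩

theorem AdmissibleReading.stable (r : AdmissibleReading Y) (m n : ℕ) : r.Stable m n := by
  intro i T w hw
  have key : (∃ T' : Tableau m n Y, List.ofFn w = T'.word (List.ofFn r.box)) →
      w ∈ Set.range (r.word (m := m) (n := n)) := by
    rintro ⟨T', h⟩
    rw [← r.ofFn_word] at h
    exact ⟨T', (List.ofFn_injective h).symm⟩
  apply key
  rcases hw with hw | hw
  · rw [← Crystal.f_eq_some, wordCrystal_f_iff, r.ofFn_word] at hw
    exact T.exists_of_e_word r.isReading hw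
  · rw [wordCrystal_f_iff, r.ofFn_word] at hw
    exact T.exists_of_f_word r.isReading hw

end Readings

/-! ### Independence of the arrows from the reading -/

section Independence

variable {m n : ℕ} {Y : YoungDiagram} {i : Node m n} {l₁ l₂ l' : List (Box Y)} {β : Box Y}

/-- This is the alternative for the second reading that `LocalCells.balanced_unique` asks for: some
box is selected there, or all source letters are matched. -/
theorem f_word_alternative (i : Node m n) (w : List (Letter m n)) :
    (∃ u z v, w = u ++ z :: v ∧ z = i.src ∧ ActsBetween i u v) ∨
      (listCrystal m n).φ i w = 0 := by
  rcases h : (listCrystal m n).f i w with _ | w'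
  · exact Or.inr (((listCrystal m n).f_eq_none i w).1 h)
  · obtain ⟨x, y, h1, _, hA⟩ := (listCrystal_f_eq_some_iff i _ _).1 h
    exact Or.inl ⟨x, _, y, h1, rfl, hA⟩

theorem Tableau.acts_plus (T : Tableau m n Y) (hi : i.1 + 1 < m)
    (hl : IsReading (l₁ ++ β :: l₂)) (hl' : IsReading l') (hβ : T.entry β = i.src)
    (hA : ActsBetween i (T.word l₁) (T.word l₂)) :
    ∃ m₁ m₂, l' = m₁ ++ β :: m₂ ∧ ActsBetween i (T.word m₁) (T.word m₂) := by
  simp only [actsBetween_plus_iff hi] at hA ⊢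
  refine (T.local_plus hi).balanced_unique (κ := fun β : Box Y => ((β.1.1 : ℤ), (β.1.2 : ℤ)))
    ?_ (cellsOf_iff T _) (cellsOf_iff T _)
    (cellList_plus T hl i.src i.tgt) (cellList_plus T hl' i.src i.tgt) hβ hA ?_
  · rintro ⟨⟨_, _⟩, _⟩ ⟨⟨_, _⟩, _⟩ h
    simpa using h
  · rcases f_word_alternative i (T.word l') with h | h
    · left
      simpa only [actsBetween_plus_iff hi, Tableau.word] using h
    · right
      simpa [Tableau.word] using (bracket_plus hi (T.word l') 0).2.1 h.le

theorem Tableau.acts_minus (T : Tableau m n Y) (hi : m ≤ i.1)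
    (hl : IsReading (l₁ ++ β :: l₂)) (hl' : IsReading l') (hβ : T.entry β = i.src)
    (hA : ActsBetween i (T.word l₁) (T.word l₂)) :
    ∃ m₁ m₂, l' = m₁ ++ β :: m₂ ∧ ActsBetween i (T.word m₁) (T.word m₂) := by
  simp only [actsBetween_minus_iff hi] at hA ⊢
  have hc := cellList_minus T hl i.src i.tgt
  rw [List.reverse_append, List.reverse_cons, List.append_assoc, List.singleton_append] at hc
  obtain ⟨m₁, m₂, h1, h2⟩ := (T.local_minus hi).balanced_unique
    (κ := fun β : Box Y => ((β.1.2 : ℤ), (β.1.1 : ℤ))) (l' := l'.reverse)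
    (by
      rintro ⟨⟨_, _⟩, _⟩ ⟨⟨_, _⟩, _⟩ h
      simpa [and_comm] using h) (cellsOf_swap_iff T _) (cellsOf_swap_iff T _)
    hc (cellList_minus T hl' i.src i.tgt) hβ
    (by
      rw [List.map_reverse, List.map_reverse]
      exact hA.reverse)
    (by
      rw [List.map_reverse]
      rcases f_word_alternative i (T.word l') with ⟨u, z, v, h1, h2, h3⟩ | h
      · left
        rw [actsBetween_minus_iff hi] at h3
        exact ⟨v.reverse, z, u.reverse, by rw [← Tableau.word, h1]; simp, h2, h3.reverse⟩
      · right
        intro v hv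
        have := (bracket_minus hi (T.word l') 0).1.1 h.le v.reverse
          (by rw [← List.reverse_suffix, List.reverse_reverse]; exact hv)
        simpa using this)
  refine ⟨m₂.reverse, m₁.reverse, ?_, ?_⟩
  · rw [← List.reverse_reverse l', h1]; simp
  · have := h2.reverse
    simpa only [Tableau.word, List.map_reverse] using this

/-- Two boxes with these letters that are incomparable for the reading order span a rectangle. By
monotonicity its northeast corner also carries one of the letters, and it precedes both boxes in
every reading. -/
theorem Tableau.acts_odd (T : Tableau m n Y) (hi : i.IsOdd)
    (hl : IsReading (l₁ ++ β :: l₂)) (hl' : IsReading l') (hβ : T.entry β = i.src)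
    (hA : ActsBetween i (T.word l₁) (T.word l₂)) :
    ∃ m₁ m₂, l' = m₁ ++ β :: m₂ ∧ ActsBetween i (T.word m₁) (T.word m₂) := by
  have hmem : β ∈ l' := hl'.mem β
  obtain ⟨m₁, m₂, rfl⟩ := List.append_of_mem hmem
  refine ⟨m₁, m₂, rfl, (actsBetween_odd_iff hi _ _).2 ?_⟩
  have key : ∀ γ ∈ m₁, ¬ (T.entry γ = i.src ∨ T.entry γ = i.tgt) := by
    by_contra hcon
    push Not at hcon
    obtain ⟨γ₀, hγ₀, hγ₀'⟩ := hcon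
    -- `γ` is the first box of the second reading with one of the two letters; it plays there the
    -- part that `β` plays in the first reading.
    obtain ⟨a, γ, b, hab, hγ, hfirst⟩ : ∃ a γ b, m₁ = a ++ γ :: b ∧
        (T.entry γ = i.src ∨ T.entry γ = i.tgt) ∧
        ∀ δ ∈ a, ¬ (T.entry δ = i.src ∨ T.entry δ = i.tgt) := by
      clear hl' hmem
      induction m₁ with
      | nil => simp at hγ₀
      | cons c m₁ ih =>
        by_cases hc : T.entry c = i.src ∨ T.entry c = i.tgt
        · exact ⟨[], c, m₁, rfl, hc, by simp⟩
        · have : γ₀ ∈ m₁ := by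
            rcases List.mem_cons.1 hγ₀ with rfl | h
            · exact absurd hγ₀' hc
            · exact h
          obtain ⟨a, γ, b, rfl, h1, h2⟩ := ih this
          refine ⟨c :: a, γ, b, rfl, h1, ?_⟩
          intro δ hδ
          rcases List.mem_cons.1 hδ with rfl | h
          · exact hc
          · exact h2 δ h
    subst hab
    have hγβ : γ ≠ β := hl'.left_right_ne.1 γ (by simp)
    have hl'' : IsReading (a ++ γ :: (b ++ β :: m₂)) := by simpa using hl'
    have hfirst' : ∀ δ, StrictlyHigher δ γ → T.entry δ ≠ i.src ∧ T.entry δ ≠ i.tgt :=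
      fun δ h => by
        have := hfirst δ (hl''.mem_left h)
        tauto
    have h1 : ¬ StrictlyHigher γ β := fun h => by
      have := T.forbidden_odd hi hl hA h
      tauto
    have h2 : ¬ StrictlyHigher β γ := fun h => (hfirst' β h).1 hβ
    have hF := T.isFilling
    have hv : T.val β.1.1 β.1.2 = i.1 := by rw [T.val_box, hβ]; rfl
    have hw : T.val γ.1.1 γ.1.2 = i.1 ∨ T.val γ.1.1 γ.1.2 = i.1 + 1 := by
      rcases hγ with h | h
      · left; rw [T.val_box, h]; rfl
      · right; rw [T.val_box, h]; rfl
    have hletters : ∀ δ : Box Y, (T.entry δ ≠ i.src ∧ T.entry δ ≠ i.tgt) →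
        T.val δ.1.1 δ.1.2 ≠ i.1 ∧ T.val δ.1.1 δ.1.2 ≠ i.1 + 1 := by
      intro δ h
      rw [T.val_box]
      simpa [Fin.ext_iff, Node.src, Node.tgt] using h
    obtain ⟨⟨⟨r, c⟩, hrc⟩, rfl⟩ : ∃ δ : Box Y, β = δ := ⟨β, rfl⟩
    obtain ⟨⟨⟨r', c'⟩, hrc'⟩, rfl⟩ : ∃ δ : Box Y, γ = δ := ⟨γ, rfl⟩
    simp only [StrictlyHigher, ne_eq, hγβ, hγβ.symm, not_false_eq_true, true_and] at h1 h2 hv hw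
    -- `β` and `γ` are now incomparable. The corner `(r, c')` contradicts the choice of `γ`, and the
    -- corner `(r', c)` contradicts the action on `β` in the first reading.
    rcases lt_or_ge r r' with hr | hr
    · have hc : c < c' := by omega
      have hm : (r, c') ∈ Y := Y.up_left_mem hr.le le_rfl hrc'
      have h3 := hletters ⟨(r, c'), hm⟩ (hfirst' _ ⟨by simp; omega, by simp; omega, by simp⟩)
      have h4 := hF.mono (le_refl r) hc.le
      have h5 := hF.mono hr.le (le_refl c')
      simp only at h3
      omega
    · have hc : c' < c := by omega
      have hr' : r' < r := by omega
      have hm : (r', c) ∈ Y := Y.up_left_mem hr le_rfl hrc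
      have h3 := hletters ⟨(r', c), hm⟩
        (T.forbidden_odd hi hl hA ⟨by simp; omega, by simp; omega, by simp⟩)
      have h4 := hF.mono (le_refl r') hc.le
      have h5 := hF.mono hr (le_refl c)
      simp only at h3
      omega
  constructor <;> intro h <;> obtain ⟨γ, hγ, h⟩ := List.mem_map.1 h
  · exact key γ hγ (Or.inl h)
  · exact key γ hγ (Or.inr h)

/-- The arrows between tableaux do not depend on the reading. -/
theorem Tableau.f_word_congr {T T' : Tableau m n Y} {l : List (Box Y)} (hl : IsReading l)
    (hl' : IsReading l') (h : (listCrystal m n).f i (T.word l) = some (T'.word l)) :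
    (listCrystal m n).f i (T.word l') = some (T'.word l') := by
  obtain ⟨x, y, h1, h2, hA⟩ := (listCrystal_f_eq_some_iff i _ _).1 h
  obtain ⟨l₁, β, l₂, rfl, rfl, hβ, rfl⟩ := Tableau.word_eq_append_cons_iff h1
  have h3 : ∃ m₁ m₂, l' = m₁ ++ β :: m₂ ∧ ActsBetween i (T.word m₁) (T.word m₂) := by
    rcases lt_trichotomy (i.1 + 1) m with hi | hi | hi
    · exact T.acts_plus hi hl hl' hβ hA
    · exact T.acts_odd hi hl hl' hβ hA
    · exact T.acts_minus (by omega) hl hl' hβ hA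
  obtain ⟨m₁, m₂, rfl, hA'⟩ := h3
  have h4 : T'.entry β = i.tgt ∧ ∀ γ, γ ≠ β → T'.entry γ = T.entry γ := by
    simp only [Tableau.word, List.map_append, List.map_cons] at h2
    obtain ⟨h5, h6⟩ := List.append_inj h2 (by simp)
    obtain ⟨h6, h7⟩ := List.cons_eq_cons.1 h6
    refine ⟨h6, fun γ hγ => ?_⟩
    have := hl.mem γ
    simp only [List.mem_append, List.mem_cons, hγ, false_or] at this
    rcases this with h | h
    · exact List.map_inj_left.1 h5 γ h
    · exact List.map_inj_left.1 h7 γ h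
  rw [listCrystal_f_eq_some_iff]
  refine ⟨T.word m₁, T.word m₂, ?_, ?_, hA'⟩
  · simp [Tableau.word, hβ]
  · rw [Tableau.word_update hl' h4.2, h4.1]

end Independence

/-! ### Connectedness of the crystal of a hook shape -/

section Connectivity

variable {m n : ℕ} {Y : YoungDiagram} {v : ℕ → ℕ → ℕ}

/-- Entries from `𝐁₊` increase strictly down a column, so each row passed costs at least one letter.
-/
theorem IsFilling.le_or_le (h : IsFilling m n Y v) (i j : ℕ) : i ≤ v i j ∨ m ≤ v i j := by
  induction i with
  | zero => exact Or.inl (Nat.zero_le _)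
  | succ i ih =>
    have h1 := h.col i j
    have h2 := h.col_lt i j
    omega

/-- From row `m` on, all entries are `≥ m` and hence strictly increasing along the row until the row
ends. -/
theorem IsFilling.add_le_or_le (h : IsFilling m n Y v) {i : ℕ} (hi : m ≤ i) (j : ℕ) :
    m + j ≤ v i j ∨ m + n ≤ v i j := by
  induction j with
  | zero =>
    have := h.le_or_le i 0
    omega
  | succ j ih =>
    have h1 := h.row i j
    have h2 := h.row_lt i j
    omega

/-- The smallest entries of a semistandard tableau: row number in the first `m` rows, column number
shifted by `m` below. -/
def leastEntry (m i j : ℕ) : ℕ := if i < m then i else m + j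

theorem IsFilling.leastEntry_le (h : IsFilling m n Y v) {i j : ℕ} (hv : v i j < m + n) :
    leastEntry m i j ≤ v i j := by
  unfold leastEntry
  have h1 := h.le_or_le i j
  split_ifs with h2
  · omega
  · have := h.add_le_or_le (not_lt.1 h2) j
    omega

/-- The diagram of a semistandard tableau is a hook diagram. -/
theorem IsFilling.isHook (h : IsFilling m n Y v) : IsHook m n Y := by
  unfold IsHook
  by_contra hcon
  have h1 : (m, n) ∈ Y := YoungDiagram.mem_iff_lt_rowLen.2 (by omega)
  have h2 := (h.lt_iff m n).2 h1
  have := h.add_le_or_le (le_refl m) n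
  omega

theorem isFilling_leastEntry (hY : IsHook m n Y) [DecidablePred (· ∈ Y)] :
    IsFilling m n Y fun i j => if (i, j) ∈ Y then leastEntry m i j else m + n := by
  have hlt : ∀ i j, (i, j) ∈ Y → leastEntry m i j < m + n := by
    intro i j h
    unfold leastEntry
    split_ifs with h1
    · omega
    · have h2 := YoungDiagram.mem_iff_lt_rowLen.1 h
      have h3 := Y.rowLen_anti m i (by omega)
      unfold IsHook at hY
      omega
  have hr : ∀ i j, (i, j + 1) ∈ Y → (i, j) ∈ Y := fun i j h => Y.up_left_mem le_rfl (by omega) h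
  have hc : ∀ i j, (i + 1, j) ∈ Y → (i, j) ∈ Y := fun i j h => Y.up_left_mem (by omega) le_rfl h
  constructor
  · intro i j
    split_ifs with h
    · simp [h, hlt i j h]
    · simp [h]
  · intro i j
    split_ifs with h
    · exact (hlt i j h).le
    · exact le_rfl
  · intro i j
    have := hr i j
    have := hlt i j
    unfold leastEntry at *
    split_ifs at * <;> first | tauto | omega | (have := this ‹_›; omega)
  · intro i j
    have := hc i j
    have := hlt i j
    unfold leastEntry at *
    split_ifs at * <;> first | tauto | omega | (have := this ‹_›; omega)
  · intro i j
    have := hr i j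
    have := hlt i j
    unfold leastEntry at *
    split_ifs at * <;> first | tauto | omega
  · intro i j
    have := hc i j
    have := hlt i j
    unfold leastEntry at *
    split_ifs at * <;> first | tauto | omega

/-- Replacement of the entries `< k` by the row numbers, for `k ≤ m`. -/
theorem IsFilling.replace_rows (h : IsFilling m n Y v) {k : ℕ} (hk : k ≤ m) :
    IsFilling m n Y fun i j => if k ≤ v i j then v i j else i := by
  have hlow := fun i j => h.le_or_le i j
  constructor
  · intro i j
    have := hlow i j
    rw [← h.lt_iff i j]
    split_ifs <;> omega
  · intro i j
    have := hlow i j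
    have := h.le i j
    split_ifs <;> omega
  · intro i j
    have := hlow i j
    have := h.row i j
    split_ifs <;> omega
  · intro i j
    have := hlow i j
    have := h.col i j
    split_ifs <;> omega
  · intro i j
    have := hlow i j
    have := h.row i j
    have := h.row_lt i j
    split_ifs <;> omega
  · intro i j
    have := hlow i j
    have := h.col i j
    have := h.col_lt i j
    split_ifs <;> omega

/-- Replacement of the entries `< k` by `k - 1` at the ends of the rows and by the least possible
entries elsewhere, for `k > m`. -/
theorem IsFilling.replace_ends (h : IsFilling m n Y v) {k : ℕ} (hk : m < k) (hk' : k < m + n) :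
    IsFilling m n Y fun i j => if k ≤ v i j then v i j else if k ≤ v i (j + 1) then k - 1
      else leastEntry m i j := by
  have hlow : ∀ i j, v i j < k → leastEntry m i j ≤ v i j :=
    fun i j hv => h.leastEntry_le (by omega)
  constructor
  · intro i j
    have := hlow i j
    rw [← h.lt_iff i j]
    split_ifs <;> omega
  · intro i j
    have := hlow i j
    have := h.le i j
    split_ifs <;> omega
  · intro i j
    have h1 := hlow i j
    have h2 := hlow i (j + 1)
    have := h.row i j
    unfold leastEntry at *
    split_ifs at * <;> omega
  · intro i j
    have h1 := hlow i j
    have h2 := hlow (i + 1) j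
    have := h.col i j
    have := h.col i (j + 1)
    unfold leastEntry at *
    split_ifs at * <;> omega
  · intro i j
    have h1 := hlow i j
    have h2 := hlow i (j + 1)
    have := h.row i j
    have := h.row_lt i j
    unfold leastEntry at *
    split_ifs at * <;> omega
  · intro i j
    have h1 := hlow i j
    have h2 := hlow (i + 1) j
    have := h.col i j
    have := h.col i (j + 1)
    have := h.col_lt i j
    unfold leastEntry at *
    split_ifs at * <;> omega

variable {l : List (Box Y)}

/-- The tableaux `T`, `T'` are joined by a path of arrows. -/
def Tableau.Joined (l : List (Box Y)) : Tableau m n Y → Tableau m n Y → Prop :=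
  Relation.EqvGen fun T T' => ∃ i, (listCrystal m n).f i (T.word l) = some (T'.word l)

/-- The entries `≥ k` of two tableaux are the same. -/
def Tableau.AgreeFrom (k : ℕ) (T T' : Tableau m n Y) : Prop :=
  ∀ i j, k ≤ T.val i j ∨ k ≤ T'.val i j → T.val i j = T'.val i j

theorem Tableau.AgreeFrom.symm {k : ℕ} {T T' : Tableau m n Y} (h : T.AgreeFrom k T') :
    T'.AgreeFrom k T := fun i j h' => (h i j h'.symm).symm

theorem Tableau.AgreeFrom.trans {k : ℕ} {T T' T'' : Tableau m n Y} (h : T.AgreeFrom k T')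
    (h' : T'.AgreeFrom k T'') : T.AgreeFrom k T'' := by
  intro i j h1
  have h2 := h i j
  have h3 := h' i j
  omega

theorem Tableau.AgreeFrom.mono {k k' : ℕ} (hk : k ≤ k') {T T' : Tableau m n Y}
    (h : T.AgreeFrom k T') : T.AgreeFrom k' T' := fun i j h' => h i j (by omega)

/-- The two ends of an arrow differ in one box. -/
theorem Tableau.agreeFrom_of_arrow (hl : IsReading l) {i : Node m n} {T T' : Tableau m n Y}
    (h : (listCrystal m n).f i (T.word l) = some (T'.word l)) :
    T.AgreeFrom (i.1 + 2) T' ∧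
      (T.word l).countP (fun b => b.val < i.1 + 1) =
        (T'.word l).countP (fun b => b.val < i.1 + 1) + 1 := by
  obtain ⟨x, y, h1, h2, -⟩ := (listCrystal_f_eq_some_iff i _ _).1 h
  constructor
  · have key : ∀ β : Box Y, T.entry β = T'.entry β ∨
        (T.entry β = i.src ∧ T'.entry β = i.tgt) := by
      intro β
      obtain ⟨l₁, γ, l₂, rfl, rfl, hγ, rfl⟩ := Tableau.word_eq_append_cons_iff h1
      simp only [Tableau.word, List.map_append, List.map_cons] at h2
      obtain ⟨h5, h6⟩ := List.append_inj h2 (by simp)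
      obtain ⟨h6, h7⟩ := List.cons_eq_cons.1 h6
      have := hl.mem β
      simp only [List.mem_append, List.mem_cons] at this
      rcases this with h | rfl | h
      · exact Or.inl (List.map_inj_left.1 h5 β h).symm
      · exact Or.inr ⟨hγ, h6⟩
      · exact Or.inl (List.map_inj_left.1 h7 β h).symm
    intro a b hab
    by_cases hY : (a, b) ∈ Y
    · rw [T.val_of_mem hY, T'.val_of_mem hY] at hab ⊢
      rcases key ⟨(a, b), hY⟩ with h | ⟨h3, h4⟩
      · rw [h]
      · rw [h3, h4] at hab
        simp only [Node.src, Node.tgt] at hab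
        omega
    · rw [Tableau.val, Tableau.val, dif_neg hY, dif_neg hY]
  · rw [h1, h2]
    simp only [List.countP_append, List.countP_cons, Node.src, Node.tgt, lt_irrefl]
    simp
    omega

theorem Tableau.countP_word_congr {T T' : Tableau m n Y} {k : ℕ} (h : T.AgreeFrom k T')
    (l : List (Box Y)) : (T.word l).countP (fun b => b.val < k) =
      (T'.word l).countP (fun b => b.val < k) := by
  rw [Tableau.word, Tableau.word, List.countP_map, List.countP_map]
  refine List.countP_congr fun β _ => ?_
  have := h β.1.1 β.1.2
  rw [T.val_box, T'.val_box] at this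
  simp only [Function.comp, decide_eq_true_eq]
  omega

/-- The normal form used for the letters `≤ k`: for `k ≤ m` the entries `k` are in the rows `≥ k`,
and for `k > m` each row with entries `≤ k` ends with the entry `k` or with larger entries in the
place of all of them. -/
def Tableau.IsNormal (k : ℕ) (T : Tableau m n Y) : Prop :=
  if k ≤ m then ∀ a b, T.val a b = k → k ≤ a else ∀ a b, T.val a b < k → T.val a (b + 1) ≤ k

/-- In normal form the boxes with entry `k` can be recovered from the larger entries. For `k ≤ m`
they are the boxes with entries `≤ k` in the rows from `k` on. For `k > m` they are the last boxes
with entries `≤ k` of the rows. -/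
theorem Tableau.AgreeFrom.of_isNormal {k : ℕ} (hk : k < m + n) {T T' : Tableau m n Y}
    (h : T.AgreeFrom (k + 1) T') (hT : T.IsNormal k) (hT' : T'.IsNormal k) : T.AgreeFrom k T' := by
  have key : ∀ {T T' : Tableau m n Y}, T.AgreeFrom (k + 1) T' → T.IsNormal k → T'.IsNormal k →
      ∀ a b, k ≤ T.val a b → T.val a b = T'.val a b := by
    clear h hT hT' T T'
    intro T T' h hT hT' a b hab
    have h1 := h a b
    have h2 := h a (b + 1)
    unfold Tableau.IsNormal at hT hT'
    split_ifs at hT hT' with hkm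
    · have h3 := hT a b
      have h4 := T'.isFilling.le_or_le a b
      omega
    · have h3 := hT' a b
      have h4 := T.isFilling.row_lt a b
      omega
  intro a b hab
  rcases hab with hab | hab
  · exact key h hT hT' a b hab
  · exact (key h.symm hT' hT a b hab).symm

/-- A letter `i.1 + 1` in too high a row can be lowered once the smaller entries are replaced by row
numbers, since the source letters then all lie in row `i.1`, out of the way. -/
theorem Tableau.exists_raise (hl : IsReading l) {i : Node m n} (hi : i.1 + 1 ≤ m)
    {T : Tableau m n Y} (hT : ¬ T.IsNormal (i.1 + 1)) :
    ∃ U V : Tableau m n Y, T.AgreeFrom (i.1 + 1) U ∧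
      (listCrystal m n).f i (V.word l) = some (U.word l) := by
  unfold Tableau.IsNormal at hT
  rw [if_pos hi] at hT
  push Not at hT
  obtain ⟨a, b, hab, ha⟩ := hT
  have hU := T.isFilling.replace_rows hi
  refine ⟨hU.toTableau, ?_⟩
  have hv := hU.val_toTableau
  generalize hU.toTableau = U at hv
  have hagree : T.AgreeFrom (i.1 + 1) U := by
    intro x y hxy
    have := T.isFilling.le_or_le x y
    rw [hv] at hxy ⊢
    simp only at hxy ⊢
    split_ifs at hxy ⊢ <;> omega
  have hY : (a, b) ∈ Y := (T.isFilling.lt_iff a b).1 (by have := i.2; omega)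
  have hUβ : U.entry ⟨(a, b), hY⟩ = i.tgt := by
    rw [← U.val_eq_iff, ← hagree _ _ (Or.inl hab.ge)]
    exact hab
  obtain ⟨l₁, l₂, rfl⟩ := List.append_of_mem (hl.mem ⟨(a, b), hY⟩)
  -- A source letter of `U` in row `i.1 ≥ a` that is read before `(a, b)` would lie in a column
  -- right of `b`. There the entry of `T` would be at least `T.val a b`, hence not one of the
  -- replaced entries.
  have hsrc : i.src ∉ U.word l₁ := by
    intro hmem
    obtain ⟨⟨⟨x, y⟩, hxy⟩, hγ, hγ'⟩ := List.mem_map.1 hmem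
    rw [← U.val_eq_iff, hv] at hγ'
    simp only [Node.src] at hγ'
    have hl2 := hl.order
    rw [List.pairwise_append] at hl2
    have h1 := hl2.2.2 _ hγ ⟨(a, b), hY⟩ (by simp)
    have h2 := hl.left_right_ne.1 _ hγ
    simp only [StrictlyHigher, ne_eq, h2.symm, not_false_eq_true, true_and] at h1
    split_ifs at hγ' with h3
    · omega
    · have := T.isFilling.mono (show a ≤ x by omega) (show b ≤ y by omega)
      omega
  have he := listCrystal_e_ne_none (show i.1 < m by omega) (y := U.word l₂) hsrc
  obtain ⟨w, hw⟩ := Option.ne_none_iff_exists'.1 he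
  rw [← Crystal.f_eq_some] at hw
  have hword : U.word l₁ ++ i.tgt :: U.word l₂ = U.word (l₁ ++ ⟨(a, b), hY⟩ :: l₂) := by
    simp [Tableau.word, hUβ]
  rw [hword] at hw
  obtain ⟨V, rfl⟩ := U.exists_of_e_word hl hw
  exact ⟨V, hagree, hw⟩

/-- If a row jumps from below `i.1 + 1` to above it, filling the ends of the small parts of all rows
with `i.1` creates an unmatched source letter. The operator may act on any source of `U`; only the
number of small entries has to drop. -/
theorem Tableau.exists_lower (hl : IsReading l) {i : Node m n} (hi : m ≤ i.1)
    {T : Tableau m n Y} (hT : ¬ T.IsNormal (i.1 + 1)) :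
    ∃ U V : Tableau m n Y, T.AgreeFrom (i.1 + 1) U ∧
      (listCrystal m n).f i (U.word l) = some (V.word l) := by
  classical
  unfold Tableau.IsNormal at hT
  rw [if_neg (by omega)] at hT
  push Not at hT
  obtain ⟨a, b, hab, hab'⟩ := hT
  have hi2 := i.2
  have hF := T.isFilling
  have hU := hF.replace_ends (k := i.1 + 1) (by omega) hi2
  refine ⟨hU.toTableau, ?_⟩
  have hv := hU.val_toTableau
  generalize hU.toTableau = U at hv
  have hagree : T.AgreeFrom (i.1 + 1) U := by
    intro x y hxy
    rw [hv] at hxy ⊢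
    simp only at hxy ⊢
    have := fun h => hF.leastEntry_le (i := x) (j := y) h
    split_ifs at hxy ⊢ <;> omega
  have hY : (a, b) ∈ Y := (hF.lt_iff a b).1 (by omega)
  have hUβ : U.entry ⟨(a, b), hY⟩ = i.src := by
    rw [← U.val_eq_iff, hv]
    simp only
    rw [if_neg (by omega), if_pos (by omega)]
    rfl
  obtain ⟨l₁, l₂, hl12⟩ := List.append_of_mem (hl.mem ⟨(a, b), hY⟩)
  have hl' := hl
  rw [hl12] at hl'
  have hφ : (listCrystal m n).φ i (U.word l) ≠ 0 := by
    intro h0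
    have h1 := (bracket_minus hi _ 0).1.1 h0.le (U.word (l₁ ++ [(⟨(a, b), hY⟩ : Box Y)]))
      ⟨U.word l₂, by rw [hl12]; simp [Tableau.word]⟩
    -- In the prefix that ends at `(a, b)` each target letter has a source letter immediately to its
    -- left, which also belongs to the prefix. The source in `(a, b)` has no target on its right and
    -- remains over.
    have h2 : (l₁ ++ [(⟨(a, b), hY⟩ : Box Y)]).countP (fun γ : Box Y => U.entry γ = i.tgt) <
        (l₁ ++ [(⟨(a, b), hY⟩ : Box Y)]).countP (fun γ : Box Y => U.entry γ = i.src) := by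
      have hkey : ∀ γ ∈ l₁ ++ [(⟨(a, b), hY⟩ : Box Y)], U.entry γ = i.tgt →
          γ.1.1 < a ∧ b < γ.1.2 ∧ T.val γ.1.1 γ.1.2 = i.1 + 1 := by
        rintro ⟨⟨x, y⟩, hxy⟩ hγ hγ'
        have hne : (⟨(x, y), hxy⟩ : Box Y) ≠ ⟨(a, b), hY⟩ := by
          rintro h
          rw [h, hUβ] at hγ'
          exact i.src_ne_tgt hγ'
        have hγl : ⟨(x, y), hxy⟩ ∈ l₁ := by simpa [hne] using hγ
        have hT2 : T.val x y = i.1 + 1 := by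
          rw [← U.val_eq_iff] at hγ'
          exact (hagree x y (Or.inr hγ'.ge)).trans hγ'
        have ho := hl'.order
        rw [List.pairwise_append] at ho
        have h3 := ho.2.2 _ hγl ⟨(a, b), hY⟩ (by simp)
        simp only [StrictlyHigher, ne_eq, hne.symm, not_false_eq_true, true_and] at h3
        -- In a row `≥ a` such a box would lie right of column `b`, where the entries exceed `i.1 +
        -- 1` because of the jump.
        have hxa : x < a := by
          by_contra hx
          have := hF.mono (show a ≤ x by omega) (show b + 1 ≤ y by omega)
          omega
        refine ⟨hxa, ?_, hT2⟩
        change b < y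
        by_contra hyb
        have := hF.mono hxa.le (show y ≤ b by omega)
        omega
      refine countP_lt_countP_of_injOn ?_
        (fun γ => ⟨(γ.1.1, γ.1.2 - 1), Y.up_left_mem le_rfl (Nat.sub_le _ _) γ.2⟩)
        ⟨(a, b), hY⟩ (by simp) hUβ ?_ ?_
      · refine List.Nodup.sublist ?_ hl'.nodup
        exact List.Sublist.append (List.Sublist.refl _) (by simp)
      · rintro ⟨⟨x, y⟩, hxy⟩ hγ hγ'
        obtain ⟨h3, h4, h5⟩ := hkey _ hγ hγ'
        simp only at h3 h4 h5 ⊢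
        obtain ⟨y, rfl⟩ : ∃ z, y = z + 1 := ⟨y - 1, by omega⟩
        simp only [Nat.add_sub_cancel]
        have hmem : (⟨(x, y), Y.up_left_mem le_rfl (Nat.le_succ _) hxy⟩ : Box Y) ∈ l₁ :=
          hl'.mem_left ⟨by simp; omega, h3.le, by simp; omega⟩
        refine ⟨by simp [hmem], ?_, by simp; omega⟩
        rw [← U.val_eq_iff, hv]
        simp only
        have h6 := hF.row x y
        have h7 := hF.row_lt x y
        rw [if_neg (by omega), if_pos (by omega)]
        rfl
      · rintro ⟨⟨x, y⟩, hxy⟩ hγ ⟨⟨x', y'⟩, hxy'⟩ hδ hγ' hδ' h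
        have h3 := (hkey _ hγ hγ').2.1
        have h4 := (hkey _ hδ hδ').2.1
        simp only [Subtype.mk.injEq, Prod.mk.injEq] at h h3 h4 ⊢
        omega
    simp only [Tableau.word, List.count, List.countP_map, Function.comp_def, beq_eq_decide] at h1
    omega
  rw [Ne, ← Crystal.f_eq_none] at hφ
  obtain ⟨w, hw⟩ := Option.ne_none_iff_exists'.1 hφ
  obtain ⟨V, rfl⟩ := U.exists_of_f_word hl hw
  exact ⟨V, hagree, hw⟩

/-- Both tableaux are brought into normal form for the letter `k`. They then agree in the entries
`k` too, and the induction hypothesis joins them. -/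
theorem Tableau.joined_of_agreeFrom (hl : IsReading l) (k : ℕ) (hk : k ≤ m + n)
    {T T' : Tableau m n Y} (h : T.AgreeFrom k T') : T.Joined l T' := by
  induction k generalizing T T' with
  | zero =>
    have : T = T' := Tableau.val_injective (by funext a b; exact h a b (by omega))
    subst this
    exact Relation.EqvGen.refl _
  | succ k ih =>
    rcases Nat.eq_zero_or_pos k with rfl | hk0
    · have : T = T' := Tableau.val_injective (by
        funext a b
        have := h a b
        omega)
      subst this
      exact Relation.EqvGen.refl _
    · obtain ⟨i, rfl⟩ : ∃ i : Node m n, k = i.1 + 1 := ⟨⟨k - 1, by omega⟩, by simp; omega⟩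
      -- Normalisation stops because each arrow changes the number of entries `< i.1 + 1` by one:
      -- upwards when `i.1 + 1 ≤ m`, downwards otherwise. Rearranging the smaller entries leaves
      -- this number fixed.
      have hnorm : ∀ (N : ℕ) (T : Tableau m n Y),
          (if i.1 + 1 ≤ m then l.length - (T.word l).countP (fun b => b.val < i.1 + 1)
            else (T.word l).countP (fun b => b.val < i.1 + 1)) = N →
          ∃ U : Tableau m n Y, T.Joined l U ∧ T.AgreeFrom (i.1 + 2) U ∧ U.IsNormal (i.1 + 1) := by
        intro N
        induction N using Nat.strong_induction_on with
        | _ N ihN =>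
          intro T hN
          by_cases hT : T.IsNormal (i.1 + 1)
          · exact ⟨T, Relation.EqvGen.refl _, fun _ _ _ => rfl, hT⟩
          · by_cases him : i.1 + 1 ≤ m
            · obtain ⟨U, V, h1, h2⟩ := Tableau.exists_raise hl him hT
              obtain ⟨h3, h4⟩ := Tableau.agreeFrom_of_arrow hl h2
              have h5 := Tableau.countP_word_congr h1 l
              have h6 : (V.word l).countP (fun b => b.val < i.1 + 1) ≤ l.length := by
                have := List.countP_le_length (p := fun b : Letter m n => b.val < i.1 + 1)
                  (l := V.word l)
                rwa [Tableau.word, List.length_map] at this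
              rw [if_pos him] at hN
              obtain ⟨W, h7, h8, h9⟩ := ihN _ (by rw [if_pos him]; omega) V rfl
              -- The path runs from `T` to `U` by the induction hypothesis on entries, backwards
              -- along one arrow to `V`, and then on to the normal form.
              exact ⟨W, (ih (by omega) h1).trans _ _ _ (((Relation.EqvGen.rel _ _ ⟨i, h2⟩).symm).trans
                _ _ _ h7), ((h1.mono (by omega)).trans h3.symm).trans h8, h9⟩
            · obtain ⟨U, V, h1, h2⟩ := Tableau.exists_lower hl (by omega) hT
              obtain ⟨h3, h4⟩ := Tableau.agreeFrom_of_arrow hl h2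
              have h5 := Tableau.countP_word_congr h1 l
              rw [if_neg him] at hN
              obtain ⟨W, h7, h8, h9⟩ := ihN _ (by rw [if_neg him]; omega) V rfl
              exact ⟨W, (ih (by omega) h1).trans _ _ _ ((Relation.EqvGen.rel _ _ ⟨i, h2⟩).trans
                _ _ _ h7), ((h1.mono (by omega)).trans h3).trans h8, h9⟩
      obtain ⟨U, h1, h2, h3⟩ := hnorm _ T rfl
      obtain ⟨U', h1', h2', h3'⟩ := hnorm _ T' rfl
      have h4 := ((h2.symm.trans h).trans h2').of_isNormal i.2 h3 h3'
      exact h1.trans _ _ _ ((ih (by omega) h4).trans _ _ _ (h1'.symm))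

theorem tableauCrystal_f_iff (r : AdmissibleReading Y) (hst : r.Stable m n) (i : Node m n)
    (T T' : Tableau m n Y) : (tableauCrystal r hst).f i T = some T' ↔
      (listCrystal m n).f i (T.word (List.ofFn r.box)) = some (T'.word (List.ofFn r.box)) := by
  rw [← r.ofFn_word, ← r.ofFn_word, ← wordCrystal_f_iff]
  change ((wordCrystal m n Y.card).f i (r.word T)).bind (Function.partialInv r.word) = some T' ↔ _
  rw [Option.bind_eq_some_iff]
  constructor
  · rintro ⟨w, h1, h2⟩
    rw [r.word_injective.isPartialInv T' w] at h2
    rw [h1, h2]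
  · intro h
    exact ⟨_, h, (r.word_injective.isPartialInv T' _).2 rfl⟩

theorem tableauCrystal_connected (r : AdmissibleReading Y) (hst : r.Stable m n)
    (hY : IsHook m n Y) : (tableauCrystal r hst).Connected := by
  classical
  refine ⟨⟨(isFilling_leastEntry hY).toTableau⟩, fun T T' => ?_⟩
  have h := Tableau.joined_of_agreeFrom r.isReading (m + n) le_rfl (T := T) (T' := T') (by
    intro a b hab
    have h1 := T.isFilling.lt_iff a b
    have h2 := T'.isFilling.lt_iff a b
    have h3 := T.isFilling.le a b
    have h4 := T'.isFilling.le a b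
    have h5 := h1.trans h2.symm
    omega)
  exact h.mono fun a b ⟨i, hi⟩ => ⟨i, (tableauCrystal_f_iff r hst i a b).2 hi⟩

end Connectivity

/-! ### Sliding a letter into one column preserves string lengths -/

section ColumnBump

variable {m n : ℕ} {i : Node m n}

theorem rowOK_iff {a b : Letter m n} :
    RowOK a b ↔ a.val < b.val ∨ (a.val = b.val ∧ a.val < m) := by
  simp only [RowOK, Letter.IsPlus, Fin.lt_def, Fin.ext_iff]

theorem colOK_iff {a b : Letter m n} :
    ColOK a b ↔ a.val < b.val ∨ (a.val = b.val ∧ ¬ a.val < m) := by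
  simp only [ColOK, Letter.IsPlus, Fin.lt_def, Fin.ext_iff]

theorem eq_src_iff {a : Letter m n} : a = i.src ↔ a.val = i.1 := by
  simp only [Fin.ext_iff, Node.src]

theorem eq_tgt_iff {a : Letter m n} : a = i.tgt ↔ a.val = i.1 + 1 := by
  simp only [Fin.ext_iff, Node.tgt]

theorem listCrystal_φ_eq_zero {w : List (Letter m n)} (h : i.src ∉ w) :
    (listCrystal m n).φ i w = 0 := by
  rw [← Crystal.f_eq_none]
  by_contra hne
  obtain ⟨w', hw⟩ := Option.ne_none_iff_exists'.1 hne
  obtain ⟨x, y, rfl, -⟩ := (listCrystal_f_eq_some_iff i _ _).1 hw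
  simp at h

theorem listCrystal_ε_eq_zero {w : List (Letter m n)} (h : i.tgt ∉ w) :
    (listCrystal m n).ε i w = 0 := by
  rw [← Crystal.e_eq_none]
  by_contra hne
  obtain ⟨w', hw⟩ := Option.ne_none_iff_exists'.1 hne
  rw [← Crystal.f_eq_some] at hw
  obtain ⟨x, y, -, rfl, -⟩ := (listCrystal_f_eq_some_iff i _ _).1 hw
  simp at h

theorem listCrystal_ε_singleton (a : Letter m n) :
    (listCrystal m n).ε i [a] = if a.val = i.1 + 1 then 1 else 0 := by
  have h1 : ∀ w, (listCrystal m n).ε i [a] = w ↔ (letterCrystal m n).ε i a = w := by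
    intro w
    rw [listCrystal_ε_cons, Crystal.tensorε]
    have := (letterCrystal m n).odd_law i a
    have := (letterCrystal m n).odd_nonneg i a
    simp only [listCrystal_ε_nil, zero_tsub, add_zero, zero_add, tsub_zero, listCrystal_φ_nil]
    split_ifs with h2 h3 h3
    · rfl
    · have h4 := (h2.coroot_eq_zero_iff (letterCrystal m n) a).1 (by have := this h2; omega)
      rw [h4.1]
    · rfl
    · rfl
  rw [h1, letterCrystal_ε]
  simp only [eq_tgt_iff]

theorem listCrystal_φ_singleton (a : Letter m n) :
    (listCrystal m n).φ i [a] = if a.val = i.1 then 1 else 0 := by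
  have h1 : ∀ w, (listCrystal m n).φ i [a] = w ↔ (letterCrystal m n).φ i a = w := by
    intro w
    rw [listCrystal_φ_cons, Crystal.tensorφ]
    have := (letterCrystal m n).odd_nonneg i a
    simp only [listCrystal_ε_nil, zero_tsub, add_zero, zero_add, tsub_zero, listCrystal_φ_nil]
    split_ifs with h2 h3 h3
    · rfl
    · have h4 := (h2.coroot_eq_zero_iff (letterCrystal m n) a).1 (by have := this h2; omega)
      rw [h4.2]
    · rfl
    · rfl
  rw [h1, letterCrystal_φ]
  simp only [eq_src_iff]

theorem append_plus (hi : i.1 + 1 < m) (u v : List (Letter m n)) :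
    (listCrystal m n).ε i (u ++ v) = (listCrystal m n).ε i u +
      ((listCrystal m n).ε i v - (listCrystal m n).φ i u) ∧
    (listCrystal m n).φ i (u ++ v) = (listCrystal m n).φ i v +
      ((listCrystal m n).φ i u - (listCrystal m n).ε i v) := by
  have h1 : ¬ i.IsOdd := by unfold Node.IsOdd; omega
  have h2 : 0 < ell i := (ell_pos_iff i).2 (by omega)
  simpa only [Crystal.tensorε, Crystal.tensorφ, h1, h2, if_true, if_false]
    using listCrystal_ε_append i u v

theorem append_minus (hi : m ≤ i.1) (u v : List (Letter m n)) :
    (listCrystal m n).ε i (u ++ v) = (listCrystal m n).ε i v +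
      ((listCrystal m n).ε i u - (listCrystal m n).φ i v) ∧
    (listCrystal m n).φ i (u ++ v) = (listCrystal m n).φ i u +
      ((listCrystal m n).φ i v - (listCrystal m n).ε i u) := by
  have h1 : ¬ i.IsOdd := by unfold Node.IsOdd; omega
  have h2 : ¬ 0 < ell i := by rw [ell_pos_iff]; omega
  simpa only [Crystal.tensorε, Crystal.tensorφ, h1, h2, if_false]
    using listCrystal_ε_append i u v

theorem append_odd (hi : i.IsOdd) (u v : List (Letter m n)) :
    (listCrystal m n).ε i (u ++ v) = (if i.src ∉ u ∧ i.tgt ∉ u then (listCrystal m n).ε i v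
      else (listCrystal m n).ε i u) ∧
    (listCrystal m n).φ i (u ++ v) = (if i.src ∉ u ∧ i.tgt ∉ u then (listCrystal m n).φ i v
      else (listCrystal m n).φ i u) := by
  have h1 := listCrystal_ε_append i u v
  have h2 := hi.coroot_eq_zero_iff (listCrystal m n) u
  rw [odd_word_trivial_iff hi] at h2
  have h3 := (listCrystal m n).odd_nonneg i u hi
  simp only [Crystal.tensorε, Crystal.tensorφ, hi, if_true] at h1
  rw [h1.1, h1.2]
  by_cases h4 : coroot i ((listCrystal m n).wt u) = 0
  · have h5 : ¬ 0 < coroot i ((listCrystal m n).wt u) := by omega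
    simp only [h2.1 h4, h5, not_false_eq_true, and_self, if_true, if_false]
  · have h5 : 0 < coroot i ((listCrystal m n).wt u) := by omega
    rw [if_neg (h2.not.1 h4), if_neg (h2.not.1 h4), if_pos h5, if_pos h5]
    exact ⟨rfl, rfl⟩

theorem bumpColumn_cases (x : List (Letter m n)) (c : Letter m n) :
    (∃ p a q, x = p ++ a :: q ∧ (∀ b ∈ p, ¬ RowOK c b) ∧ RowOK c a ∧
      bumpColumn x c = (p ++ c :: q, some a)) ∨
    ((∀ b ∈ x, ¬ RowOK c b) ∧ bumpColumn x c = (x ++ [c], none)) := by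
  induction x with
  | nil => right; simp [bumpColumn]
  | cons b x ih =>
    by_cases hb : RowOK c b
    · left; exact ⟨[], b, x, rfl, by simp, hb, by simp [bumpColumn, hb]⟩
    · rcases ih with ⟨p, a, q, rfl, h1, h2, h3⟩ | ⟨h1, h2⟩
      · left
        exact ⟨b :: p, a, q, rfl, by simpa [hb] using h1, h2, by simp [bumpColumn, hb, h3]⟩
      · right
        exact ⟨by simpa [hb] using h1, by simp [bumpColumn, hb, h2]⟩

theorem bumpColumn_append {p r : List (Letter m n)} {c : Letter m n} (h : ∀ b ∈ p, ¬ RowOK c b) :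
    bumpColumn (p ++ r) c = (p ++ (bumpColumn r c).1, (bumpColumn r c).2) := by
  induction p with
  | nil => rfl
  | cons b p ih =>
    simp only [List.forall_mem_cons] at h
    simp [bumpColumn, h.1, ih h.2]

theorem bumpColumn_eq {p q : List (Letter m n)} {a c : Letter m n} (h : ∀ b ∈ p, ¬ RowOK c b)
    (ha : RowOK c a) : bumpColumn (p ++ a :: q) c = (p ++ c :: q, some a) := by
  rw [bumpColumn_append h]
  simp [bumpColumn, ha]

/-- A column, as a list, is semistandard. -/
def IsColumn (x : List (Letter m n)) : Prop := x.Pairwise ColOK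

/-- The word of the pair of columns that results from sliding `c` into the column `x`. -/
def bumpWord (x : List (Letter m n)) (c : Letter m n) : List (Letter m n) :=
  (bumpColumn x c).2.toList ++ (bumpColumn x c).1

theorem bumpWord_eq {p q : List (Letter m n)} {a c : Letter m n} (h : ∀ b ∈ p, ¬ RowOK c b)
    (ha : RowOK c a) : bumpWord (p ++ a :: q) c = a :: p ++ c :: q := by
  rw [bumpWord, bumpColumn_eq h ha]
  rfl

theorem IsColumn.append_cons {p q : List (Letter m n)} {a : Letter m n}
    (h : IsColumn (p ++ a :: q)) :
    (∀ b ∈ p, ColOK b a) ∧ (∀ b ∈ q, ColOK a b) ∧ (∀ b ∈ p, ∀ d ∈ q, ColOK b d) ∧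
      IsColumn p ∧ IsColumn q := by
  unfold IsColumn at *
  rw [List.pairwise_append, List.pairwise_cons] at h
  exact ⟨fun b hb => h.2.2 b hb a (by simp), h.2.1.1,
    fun b hb d hd => h.2.2 b hb d (by simp [hd]), h.1, h.2.1.2⟩

/-- Sliding a letter into a column does not change `ε_i` and `φ_i`. -/
theorem bumpWord_ε_φ {x : List (Letter m n)} (hx : IsColumn x) (c : Letter m n) :
    (listCrystal m n).ε i (bumpWord x c) = (listCrystal m n).ε i (x ++ [c]) ∧
      (listCrystal m n).φ i (bumpWord x c) = (listCrystal m n).φ i (x ++ [c]) := by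
  rcases bumpColumn_cases x c with ⟨p, a, q, rfl, h1, h2, -⟩ | ⟨-, h2⟩
  swap
  · rw [bumpWord, h2]; simp
  obtain ⟨h3, h4, -, h5, h6⟩ := hx.append_cons
  rw [bumpWord_eq h1 h2]
  -- Only the order of `p`, `a`, `q`, `c` changes. The column condition leaves few places for source
  -- and target letters, so most of the four lengths `ε`, `φ` of `p` and `q` vanish in each case.
  have e1 : a :: p ++ c :: q = [a] ++ (p ++ ([c] ++ q)) := by simp
  have e2 : (p ++ a :: q) ++ [c] = p ++ ([a] ++ (q ++ [c])) := by simp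
  rw [e1, e2]
  simp only [rowOK_iff] at h1 h2
  simp only [colOK_iff] at h3 h4
  have hpt : (∀ b ∈ p, b.val ≠ i.1 + 1) → (listCrystal m n).ε i p = 0 := fun h =>
    listCrystal_ε_eq_zero fun hm => h _ hm rfl
  have hps : (∀ b ∈ p, b.val ≠ i.1) → (listCrystal m n).φ i p = 0 := fun h =>
    listCrystal_φ_eq_zero fun hm => h _ hm rfl
  have hqt : (∀ b ∈ q, b.val ≠ i.1 + 1) → (listCrystal m n).ε i q = 0 := fun h =>
    listCrystal_ε_eq_zero fun hm => h _ hm rfl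
  have hqs : (∀ b ∈ q, b.val ≠ i.1) → (listCrystal m n).φ i q = 0 := fun h =>
    listCrystal_φ_eq_zero fun hm => h _ hm rfl
  rcases lt_trichotomy (i.1 + 1) m with hi | hi | hi
  · simp only [append_plus hi, listCrystal_ε_singleton, listCrystal_φ_singleton]
    by_cases ha : a.val = i.1 + 1
    · by_cases hc : c.val = i.1 + 1
      · by_cases hp : i.src ∈ p
        · obtain ⟨p₁, p₂, rfl⟩ := List.append_of_mem hp
          -- Columns are strict here and `a` is the target, so nothing fits between the source in
          -- `p` and `a`.
          have hp2 : p₂ = [] := by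
            rcases p₂ with _ | ⟨d, p₂⟩
            · rfl
            · have k1 := h5.append_cons.2.1 d (by simp)
              have k2 := h3 d (by simp)
              simp only [colOK_iff, Node.src] at k1
              omega
          subst hp2
          have k1 : ∀ b ∈ p₁, b.val < i.1 := by
            intro b hb
            have := h5.append_cons.1 b hb
            simp only [colOK_iff, Node.src] at this
            omega
          have k2 : (listCrystal m n).ε i p₁ = 0 :=
            listCrystal_ε_eq_zero fun hm => by have := k1 _ hm; simp [Node.tgt] at this
          have k3 : (listCrystal m n).φ i p₁ = 0 :=
            listCrystal_φ_eq_zero fun hm => by have := k1 _ hm; simp [Node.src] at this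
          have k4 := hqt (fun b hb => by have := h4 b hb; omega)
          have k5 := hqs (fun b hb => by have := h4 b hb; omega)
          simp only [append_plus hi, listCrystal_ε_singleton, listCrystal_φ_singleton, ha, hc, k2,
            k3, k4, k5, Node.src]
          simp
        · have k1 : (listCrystal m n).φ i p = 0 := listCrystal_φ_eq_zero hp
          have k2 := hpt (fun b hb => by have := h3 b hb; omega)
          have k4 := hqt (fun b hb => by have := h4 b hb; omega)
          have k5 := hqs (fun b hb => by have := h4 b hb; omega)
          simp only [ha, hc, k1, k2, k4, k5]
          simp
      · have k2 := hpt (fun b hb => by have := h3 b hb; omega)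
        have k1 := hps (fun b hb => by have := h1 b hb; have := h3 b hb; omega)
        have k4 := hqt (fun b hb => by have := h4 b hb; omega)
        have k5 := hqs (fun b hb => by have := h4 b hb; omega)
        simp only [ha, hc, k1, k2, k4, k5]
        split_ifs <;> simp
    · by_cases ha' : a.val = i.1
      · have k2 := hpt (fun b hb => by have := h3 b hb; omega)
        have k1 := hps (fun b hb => by have := h3 b hb; omega)
        have k5 := hqs (fun b hb => by have := h4 b hb; omega)
        by_cases hc : c.val = i.1
        · simp only [ha', hc, k1, k2, k5]
          simp
          by_cases hq : i.tgt ∈ q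
          -- A strict column contains the target at most once.
          · have k6 : (listCrystal m n).ε i q ≤ 1 := by
              rcases q with _ | ⟨d, q⟩
              · simp
              · rw [← List.singleton_append, (append_plus hi [d] q).1]
                have k7 : ∀ b ∈ q, b.val ≠ i.1 + 1 := fun b hb => by
                  have k8 := (List.pairwise_cons.1 h6).1 b hb
                  have k9 := h4 d (by simp)
                  simp only [colOK_iff] at k8
                  omega
                rw [listCrystal_ε_singleton, listCrystal_ε_eq_zero (w := q) fun hm => k7 _ hm rfl]
                split_ifs <;> simp
            omega
          · rw [listCrystal_ε_eq_zero hq]; simp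
        · have hc2 : c.val ≠ i.1 + 1 := by omega
          simp only [ha', hc, hc2, k1, k2, k5]
          simp
      · simp only [ha, ha', if_false]
        by_cases hc : c.val = i.1
        · have k4 := hqt (fun b hb => by have := h4 b hb; omega)
          have k5 := hqs (fun b hb => by have := h4 b hb; omega)
          simp only [hc, k4, k5]
          simp
        · by_cases hc' : c.val = i.1 + 1
          · have k4 := hqt (fun b hb => by have := h4 b hb; omega)
            have k5 := hqs (fun b hb => by have := h4 b hb; omega)
            simp only [hc', k4, k5]
            simp
          · simp only [hc, hc', if_false]
            simp
  · have hodd : i.IsOdd := hi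
    have hn : ∀ w : List (Letter m n), (i.src ∉ w ∧ i.tgt ∉ w) →
        (listCrystal m n).ε i w = 0 ∧ (listCrystal m n).φ i w = 0 :=
      fun w h => (odd_word_trivial_iff hodd w).2 h
    simp only [append_odd hodd, List.mem_singleton, eq_comm (b := a), eq_comm (b := c),
      eq_src_iff, eq_tgt_iff]
    by_cases ha : a.val = i.1 ∨ a.val = i.1 + 1
    -- The first relevant letter decides at the odd node. In both words it is `a`, as `p` contains
    -- neither letter.
    · have hp : i.src ∉ p ∧ i.tgt ∉ p := by
        constructor
        · intro hm
          have := h1 _ hm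
          have := h3 _ hm
          simp only [Node.src] at *
          omega
        · intro hm
          have := h1 _ hm
          have := h3 _ hm
          simp only [Node.tgt] at *
          omega
      have ha' : ¬ (¬ a.val = i.1 ∧ ¬ a.val = i.1 + 1) := by tauto
      simp only [hp, ha', not_false_eq_true, and_self, if_true, if_false]
    · push Not at ha
      have ha' : (¬ a.val = i.1 ∧ ¬ a.val = i.1 + 1) := ha
      simp only [ha', not_false_eq_true, and_self, if_true]
      by_cases hp : i.src ∉ p ∧ i.tgt ∉ p
      · simp only [hp, not_false_eq_true, and_self, if_true]
        by_cases hc : c.val = i.1 ∨ c.val = i.1 + 1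
        · have hq : i.src ∉ q ∧ i.tgt ∉ q := by
            constructor
            · intro hm
              have := h4 _ hm
              simp only [Node.src] at *
              omega
            · intro hm
              have := h4 _ hm
              simp only [Node.tgt] at *
              omega
          have hc' : ¬ (¬ c.val = i.1 ∧ ¬ c.val = i.1 + 1) := by tauto
          simp only [hq, hc', not_false_eq_true, and_self, if_true, if_false]
        · push Not at hc
          have hc' : (¬ c.val = i.1 ∧ ¬ c.val = i.1 + 1) := hc
          have hc2 := hn [c] (by
            simpa only [List.mem_singleton, eq_comm (b := c), eq_src_iff, eq_tgt_iff] using hc')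
          simp only [hc', hc2, not_false_eq_true, and_self, if_true]
          split_ifs with hq
          · exact hn q hq
          · exact ⟨rfl, rfl⟩
      · simp only [hp, if_false, and_self]
  · have hi' : m ≤ i.1 := by omega
    simp only [append_minus hi', listCrystal_ε_singleton, listCrystal_φ_singleton]
    by_cases hc : c.val = i.1
    · have k5 := hqs (fun b hb => by have := h4 b hb; omega)
      have k2 := hpt (fun b hb => by have := h1 b hb; omega)
      by_cases ha : a.val = i.1 + 1
      · simp only [ha, hc, k5, k2]
        simp
        omega
      · have k4 := hqt (fun b hb => by have := h4 b hb; omega)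
        have ha' : a.val ≠ i.1 := by omega
        simp only [ha, ha', hc, k2, k4, k5]
        simp
    · by_cases hc' : c.val = i.1 + 1
      · have k4 := hqt (fun b hb => by have := h4 b hb; omega)
        have k5 := hqs (fun b hb => by have := h4 b hb; omega)
        have ha' : a.val ≠ i.1 ∧ a.val ≠ i.1 + 1 := by omega
        simp only [ha', hc', k4, k5]
        simp
      · simp only [hc, hc', if_false]
        by_cases ha : a.val = i.1 ∨ a.val = i.1 + 1
        · have k2 := hpt (fun b hb => by have := h1 b hb; omega)
          have k1 := hps (fun b hb => by have := h1 b hb; omega)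
          simp only [k1, k2]
          simp
        · push Not at ha
          simp only [ha, if_false]
          simp

end ColumnBump

/-! ### Sliding a letter into one column commutes with the arrows -/

section ColumnBumpArrow

variable {m n : ℕ} {i : Node m n}

theorem actsBetween_iff (x y : List (Letter m n)) : ActsBetween i x y ↔
    (i.1 + 1 < m → (listCrystal m n).φ i x = 0 ∧ (listCrystal m n).ε i y = 0) ∧
    (i.1 + 1 = m → i.src ∉ x ∧ i.tgt ∉ x) ∧
    (m ≤ i.1 → (listCrystal m n).ε i x = 0 ∧ (listCrystal m n).φ i y = 0) := by
  rcases lt_trichotomy (i.1 + 1) m with hi | hi | hi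
  · have h1 : ¬ i.IsOdd := by unfold Node.IsOdd; omega
    have h2 : 0 < ell i := (ell_pos_iff i).2 (by omega)
    have h3 : ¬ i.1 + 1 = m := by omega
    have h4 : ¬ m ≤ i.1 := by omega
    simp only [ActsBetween, h1, h2, hi, h3, h4, if_true, if_false, true_imp_iff, false_imp_iff,
      and_true]
  · have h3 : ¬ i.1 + 1 < m := by omega
    have h4 : ¬ m ≤ i.1 := by omega
    rw [actsBetween_odd_iff hi]
    simp only [hi, h4, true_imp_iff, false_imp_iff, and_true, true_and, lt_irrefl]
  · have h1 : ¬ i.IsOdd := by unfold Node.IsOdd; omega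
    have h2 : ¬ 0 < ell i := by rw [ell_pos_iff]; omega
    have h3 : ¬ i.1 + 1 < m := by omega
    have h4 : ¬ i.1 + 1 = m := by omega
    have h5 : m ≤ i.1 := by omega
    simp only [ActsBetween, h1, h2, h3, h4, h5, if_false, true_imp_iff, false_imp_iff, true_and]

theorem src_not_mem {w : List (Letter m n)} (h : ∀ b ∈ w, b.val ≠ i.1) : i.src ∉ w :=
  fun hm => h _ hm rfl

theorem tgt_not_mem {w : List (Letter m n)} (h : ∀ b ∈ w, b.val ≠ i.1 + 1) : i.tgt ∉ w :=
  fun hm => h _ hm rfl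

/-- With `φ` equal to zero every source letter is matched, so a target letter must exist. -/
theorem tgt_mem_of_φ_plus (hi : i.1 + 1 < m) {w : List (Letter m n)} (hs : i.src ∈ w)
    (h : (listCrystal m n).φ i w = 0) : i.tgt ∈ w := by
  have := (bracket_plus hi w 0).2.1 h.le w List.suffix_rfl
  have := List.count_pos_iff.2 hs
  exact List.count_pos_iff.1 (by omega)

theorem tgt_mem_of_φ_minus (hi : m ≤ i.1) {w : List (Letter m n)} (hs : i.src ∈ w)
    (h : (listCrystal m n).φ i w = 0) : i.tgt ∈ w := by
  have := (bracket_minus hi w 0).1.1 h.le w List.prefix_rfl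
  have := List.count_pos_iff.2 hs
  exact List.count_pos_iff.1 (by omega)

theorem mem_of_mem_bumped {α : Type*} {a b c : α} {p q : List α} (h : a ∈ b :: p ++ c :: q) :
    a = c ∨ a ∈ p ++ b :: q := by
  simp only [List.mem_append, List.mem_cons] at h ⊢
  tauto

/-- The letter slides past the position of the arrow both before and after it, so the same letter is
bumped out of `y` and the arrow stays at its position. -/
theorem bumpWord_f_below {u y : List (Letter m n)} {c : Letter m n}
    (hx : IsColumn (u ++ i.src :: y)) (hx' : IsColumn (u ++ i.tgt :: y))
    (hA : ActsBetween i u (y ++ [c])) (h1 : ∀ b ∈ u, ¬ RowOK c b) (hcs : ¬ RowOK c i.src)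
    (hct : ¬ RowOK c i.tgt) :
    (bumpColumn (u ++ i.src :: y) c).2.isSome = (bumpColumn (u ++ i.tgt :: y) c).2.isSome ∧
      (listCrystal m n).f i (bumpWord (u ++ i.src :: y) c) =
        some (bumpWord (u ++ i.tgt :: y) c) := by
  obtain ⟨hu, -, -, -, -⟩ := hx.append_cons
  obtain ⟨-, hy, -, -, -⟩ := hx'.append_cons
  obtain ⟨-, hA2, -⟩ := (actsBetween_iff _ _).1 hA
  have hsv : (i.src : Letter m n).val = i.1 := rfl
  have htv : (i.tgt : Letter m n).val = i.1 + 1 := rfl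
  simp only [colOK_iff, hsv, htv] at hu hy
  have hplus : i.1 + 1 < m → (∀ b ∈ u, b.val < i.1) ∧ (∀ b ∈ y, i.1 + 1 < b.val) :=
    fun hi => ⟨fun b hb => by have := hu b hb; omega, fun b hb => by have := hy b hb; omega⟩
  have hs' : ∀ b ∈ u ++ [i.src], ¬ RowOK c b := by
    intro b hb
    rcases List.mem_append.1 hb with hb | hb
    · exact h1 b hb
    · rw [List.mem_singleton.1 hb]; exact hcs
  have ht' : ∀ b ∈ u ++ [i.tgt], ¬ RowOK c b := by
    intro b hb
    rcases List.mem_append.1 hb with hb | hb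
    · exact h1 b hb
    · rw [List.mem_singleton.1 hb]; exact hct
  have h4 : ∀ d, u ++ d :: y = (u ++ [d]) ++ y := by simp
  rw [bumpWord, bumpWord, h4, h4, bumpColumn_append hs', bumpColumn_append ht']
  refine ⟨rfl, ?_⟩
  rw [rowOK_iff, htv] at hct
  rcases bumpColumn_cases y c with ⟨p, b, q, rfl, h5, h6, h7⟩ | ⟨-, h7⟩
  · rw [h7]
    rw [rowOK_iff] at h6
    refine (listCrystal_f_eq_some_iff i _ _).2 ⟨b :: u, p ++ c :: q, by simp, by simp,
      (actsBetween_iff _ _).2 ⟨fun hi => ⟨listCrystal_φ_eq_zero (src_not_mem fun d hd => ?_),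
        listCrystal_ε_eq_zero (tgt_not_mem fun d hd => ?_)⟩, fun hi => ?_,
        fun hi => ⟨listCrystal_ε_eq_zero (tgt_not_mem fun d hd => ?_),
        listCrystal_φ_eq_zero (src_not_mem fun d hd => ?_)⟩⟩⟩
    · rcases List.mem_cons.1 hd with rfl | hd
      · omega
      · have := (hplus hi).1 d hd; omega
    · rcases mem_of_mem_bumped (b := b) (List.mem_cons_of_mem _ hd) with rfl | hd
      · omega
      · have := (hplus hi).2 d hd; omega
    · have := hA2 hi
      simp only [List.mem_cons, not_or, this, not_false_eq_true, and_true, eq_comm (b := b),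
        eq_src_iff, eq_tgt_iff]
      omega
    · rcases List.mem_cons.1 hd with rfl | hd
      · omega
      · have := hu d hd; omega
    · rcases mem_of_mem_bumped (b := b) (List.mem_cons_of_mem _ hd) with rfl | hd
      · omega
      · have := hy d hd; omega
  · rw [h7]
    exact (listCrystal_f_eq_some_iff i _ _).2 ⟨u, y ++ [c], by simp, by simp, hA⟩

/-- A pair of a column and a letter before and after sliding, with the arrow on a letter of the
column. -/
theorem bumpWord_f_column {u y : List (Letter m n)} {c : Letter m n}
    (hx : IsColumn (u ++ i.src :: y)) (hx' : IsColumn (u ++ i.tgt :: y))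
    (hA : ActsBetween i u (y ++ [c])) :
    (bumpColumn (u ++ i.src :: y) c).2.isSome = (bumpColumn (u ++ i.tgt :: y) c).2.isSome ∧
      (listCrystal m n).f i (bumpWord (u ++ i.src :: y) c) =
        some (bumpWord (u ++ i.tgt :: y) c) := by
  obtain ⟨hu, -, huy, -, -⟩ := hx.append_cons
  obtain ⟨-, hy, -, -, hyc⟩ := hx'.append_cons
  obtain ⟨hA1, hA2, hA3⟩ := (actsBetween_iff _ _).1 hA
  have hsv : (i.src : Letter m n).val = i.1 := rfl
  have htv : (i.tgt : Letter m n).val = i.1 + 1 := rfl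
  simp only [colOK_iff, hsv, htv] at hu hy
  have hplus : i.1 + 1 < m → (∀ b ∈ u, b.val < i.1) ∧ (∀ b ∈ y, i.1 + 1 < b.val) :=
    fun hi => ⟨fun b hb => by have := hu b hb; omega, fun b hb => by have := hy b hb; omega⟩
  have hyε : i.1 + 1 < m → (listCrystal m n).ε i y = 0 := fun hi => by
    have := (hA1 hi).2
    rw [(append_plus hi y [c]).1] at this
    omega
  have hcε : i.1 + 1 < m → c.val ≠ i.1 + 1 := fun hi => by
    have h1 := tgt_not_mem (i := i) (w := y) fun b hb => by have := (hplus hi).2 b hb; omega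
    have h2 := src_not_mem (i := i) (w := y) fun b hb => by have := (hplus hi).2 b hb; omega
    have := (hA1 hi).2
    rw [(append_plus hi y [c]).1, listCrystal_ε_singleton, listCrystal_φ_eq_zero h2] at this
    intro hc
    rw [if_pos hc] at this
    omega
  -- Either `c` stops above the letter of the arrow, or it bumps that letter, or it passes it. Only
  -- when `c` passes the source but bumps the target do the two bumps happen at different places.
  rcases bumpColumn_cases u c with ⟨p, b, q, rfl, h1, h2, -⟩ | ⟨h1, -⟩
  · have h0 : ∀ d, bumpColumn (p ++ b :: q ++ d :: y) c = (p ++ c :: (q ++ d :: y), some b) :=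
      fun d => by rw [List.append_assoc, List.cons_append, bumpColumn_eq h1 h2]
    rw [bumpWord, bumpWord, h0, h0]
    refine ⟨rfl, (listCrystal_f_eq_some_iff i _ _).2
      ⟨b :: p ++ c :: q, y, by simp, by simp, (actsBetween_iff _ _).2 ⟨fun hi => ?_, fun hi => ?_,
        fun hi => ?_⟩⟩⟩
    all_goals
      rw [rowOK_iff] at h2
      have h3 := hu b (by simp)
      have h4 : ∀ d ∈ b :: p ++ c :: q, d = c ∨ d ∈ p ++ b :: q :=
        fun d hd => mem_of_mem_bumped hd
    · refine ⟨listCrystal_φ_eq_zero (src_not_mem fun d hd => ?_), hyε hi⟩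
      rcases h4 d hd with rfl | hd
      · omega
      · have := (hplus hi).1 d hd; omega
    · have h5 := hA2 hi
      have h6 : ∀ d ∈ p ++ b :: q, d.val ≠ i.1 ∧ d.val ≠ i.1 + 1 := fun d hd =>
        ⟨fun h => h5.1 (eq_src_iff.2 h ▸ hd), fun h => h5.2 (eq_tgt_iff.2 h ▸ hd)⟩
      have h7 := h6 b (by simp)
      constructor
      · refine src_not_mem fun d hd => ?_
        rcases h4 d hd with rfl | hd
        · omega
        · exact (h6 d hd).1
      · refine tgt_not_mem fun d hd => ?_
        rcases h4 d hd with rfl | hd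
        · omega
        · exact (h6 d hd).2
    · refine ⟨listCrystal_ε_eq_zero (tgt_not_mem fun d hd => ?_),
        listCrystal_φ_eq_zero (src_not_mem fun d hd => by have := hy d hd; omega)⟩
      rcases h4 d hd with rfl | hd
      · omega
      · have := hu d hd; omega
  by_cases hcs : RowOK c i.src
  · have hct : RowOK c i.tgt := by
      rw [rowOK_iff, htv]; rw [rowOK_iff, hsv] at hcs; omega
    rw [bumpWord, bumpWord, bumpColumn_eq h1 hcs, bumpColumn_eq h1 hct]
    refine ⟨rfl, (listCrystal_f_eq_some_iff i _ _).2
      ⟨[], u ++ c :: y, by simp, by simp, (actsBetween_iff _ _).2 ⟨fun hi => ?_, fun hi => ?_,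
        fun hi => ?_⟩⟩⟩
    · refine ⟨rfl, listCrystal_ε_eq_zero (tgt_not_mem fun d hd => ?_)⟩
      simp only [List.mem_append, List.mem_cons] at hd
      rcases hd with hd | rfl | hd
      · have := (hplus hi).1 d hd; omega
      · exact hcε hi
      · have := (hplus hi).2 d hd; omega
    · simp
    · refine ⟨rfl, listCrystal_φ_eq_zero (src_not_mem fun d hd => ?_)⟩
      rw [rowOK_iff, hsv] at hcs
      simp only [List.mem_append, List.mem_cons] at hd
      rcases hd with hd | rfl | hd
      · have h3 := h1 d hd
        rw [rowOK_iff] at h3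
        omega
      · omega
      · have := hy d hd; omega
  by_cases hct : RowOK c i.tgt
  · rw [rowOK_iff, htv] at hct
    have hcs' := hcs
    rw [rowOK_iff, hsv] at hcs'
    have hi : m ≤ i.1 := by
      by_contra hi
      by_cases hi2 : i.1 + 1 < m
      · have := hcε hi2; omega
      · omega
    have hc : c = i.src := by rw [eq_src_iff]; omega
    subst hc
    -- The source letter `c` at the end of the word must be matched, which forces a target in `y`;
    -- being minimal there it stands at the top. Both bumps then eject a target, and the arrow moves
    -- to the source just above the new letter.
    have htm : i.tgt ∈ y := by
      have := tgt_mem_of_φ_minus hi (w := y ++ [i.src]) (by simp) (hA3 hi).2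
      simpa [i.src_ne_tgt.symm] using this
    obtain ⟨y₁, rfl⟩ : ∃ y₁, y = i.tgt :: y₁ := by
      rcases y with _ | ⟨d, y⟩
      · simp at htm
      · rcases List.mem_cons.1 htm with rfl | h3
        · exact ⟨y, rfl⟩
        · have h4 := (List.pairwise_cons.1 hyc).1 _ h3
          have h5 := hy d (by simp)
          rw [colOK_iff, htv] at h4
          have : d = i.tgt := by rw [eq_tgt_iff]; omega
          exact ⟨y, by rw [this]⟩
    have h3 : RowOK i.src i.tgt := by rw [rowOK_iff, htv, hsv]; omega
    have h4 : u ++ i.src :: i.tgt :: y₁ = (u ++ [i.src]) ++ i.tgt :: y₁ := by simp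
    have h5 : ∀ b ∈ u ++ [i.src], ¬ RowOK i.src b := by
      intro b hb
      rcases List.mem_append.1 hb with hb | hb
      · exact h1 b hb
      · rw [List.mem_singleton.1 hb]; exact hcs
    rw [bumpWord, bumpWord, h4, bumpColumn_eq h5 h3, bumpColumn_eq h1 h3]
    refine ⟨rfl, (listCrystal_f_eq_some_iff i _ _).2
      ⟨i.tgt :: u ++ [i.src], y₁, by simp, by simp, (actsBetween_iff _ _).2
        ⟨fun hi => by omega, fun hi => by omega, fun hi => ⟨?_, ?_⟩⟩⟩⟩
    · have h6 : (listCrystal m n).ε i u = 0 :=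
        listCrystal_ε_eq_zero (tgt_not_mem fun d hd => by have := hu d hd; omega)
      rw [show i.tgt :: u ++ [i.src] = ([i.tgt] ++ u) ++ [i.src] by simp]
      simp only [append_minus hi, listCrystal_ε_singleton, listCrystal_φ_singleton, h6, hsv, htv]
      simp
    · exact listCrystal_φ_eq_zero (src_not_mem fun d hd => by
        have := hy d (by simp [hd]); omega)
  · exact bumpWord_f_below hx hx' hA h1 hcs hct

/-- The arrow acts on the letter that slides into the column. -/
theorem bumpWord_f_letter {u : List (Letter m n)} (hx : IsColumn u) (hA : ActsBetween i u []) :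
    (bumpColumn u i.src).2.isSome = (bumpColumn u i.tgt).2.isSome ∧
      (listCrystal m n).f i (bumpWord u i.src) = some (bumpWord u i.tgt) := by
  have hsv : (i.src : Letter m n).val = i.1 := rfl
  have htv : (i.tgt : Letter m n).val = i.1 + 1 := rfl
  have hst : ∀ b : Letter m n, ¬ RowOK i.src b → ¬ RowOK i.tgt b := by
    intro b
    rw [rowOK_iff, rowOK_iff, hsv, htv]
    omega
  obtain ⟨hA1, hA2, hA3⟩ := (actsBetween_iff _ _).1 hA
  rcases bumpColumn_cases u i.src with ⟨p, a, q, rfl, h1, h2, -⟩ | ⟨h1, h2⟩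
  · obtain ⟨hp, hq, -, -, -⟩ := hx.append_cons
    have h1' := fun b hb => hst b (h1 b hb)
    have h2' := h2
    simp only [rowOK_iff, colOK_iff, hsv] at hp hq h1 h2'
    -- A bumped letter beyond the target is bumped by both `i.src` and `i.tgt`. The remaining
    -- possibilities are that `i.src` bumps a target or a source.
    by_cases ha : i.1 + 1 < a.val
    · have h3 : RowOK i.tgt a := by rw [rowOK_iff, htv]; omega
      rw [bumpWord, bumpWord, bumpColumn_eq (fun b hb => by rw [rowOK_iff]; exact h1 b hb) h2,
        bumpColumn_eq h1' h3]
      refine ⟨rfl, (listCrystal_f_eq_some_iff i _ _).2 ⟨a :: p, q, by simp, by simp,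
        (actsBetween_iff _ _).2 ⟨fun hi => ⟨listCrystal_φ_eq_zero (src_not_mem fun d hd => ?_),
          listCrystal_ε_eq_zero (tgt_not_mem fun d hd => ?_)⟩, fun hi => ?_,
          fun hi => ⟨listCrystal_ε_eq_zero (tgt_not_mem fun d hd => ?_),
          listCrystal_φ_eq_zero (src_not_mem fun d hd => ?_)⟩⟩⟩⟩
      · rcases List.mem_cons.1 hd with rfl | hd
        · omega
        · have := h1 d hd; omega
      · have := hq d hd; omega
      · have := hA2 hi
        simp only [List.mem_append, List.mem_cons, not_or] at this ⊢
        tauto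
      · rcases List.mem_cons.1 hd with rfl | hd
        · omega
        · have := h1 d hd; omega
      · have := hq d hd; omega
    · rcases Nat.lt_or_ge i.1 a.val with ha1 | ha1
      · have haeq : a = i.tgt := by rw [eq_tgt_iff]; omega
        subst haeq
        -- At the odd node the column contains no target letter. For `m ≤ i.1` the suffix that
        -- starts at this target would be an excess of targets, against the vanishing of `ε`.
        have hi : i.1 + 1 < m := by
          by_contra hi
          by_cases hi2 : i.1 + 1 = m
          · exact (hA2 hi2).2 (by simp)
          · have h3 := (bracket_minus (i := i) (by omega) (p ++ i.tgt :: q) 0).2.1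
              (hA3 (by omega)).1.le (i.tgt :: q) ⟨p, rfl⟩
            rw [List.count_eq_zero_of_not_mem (a := i.src)] at h3
            · simp at h3
            · refine src_not_mem fun d hd => ?_
              rcases List.mem_cons.1 hd with rfl | hd
              · omega
              · have := hq d hd; omega
        have h3 : RowOK i.tgt i.tgt := by rw [rowOK_iff, htv]; omega
        rw [bumpWord, bumpWord, bumpColumn_eq (fun b hb => by rw [rowOK_iff]; exact h1 b hb) h2,
          bumpColumn_eq h1' h3]
        refine ⟨rfl, (listCrystal_f_eq_some_iff i _ _).2 ⟨i.tgt :: p, q, by simp, by simp,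
          (actsBetween_plus_iff hi _ _).2 ?_⟩⟩
        rw [← actsBetween_plus_iff hi, actsBetween_iff]
        refine ⟨fun hi => ⟨listCrystal_φ_eq_zero (src_not_mem fun d hd => ?_),
          listCrystal_ε_eq_zero (tgt_not_mem fun d hd => ?_)⟩, fun _ => by omega,
          fun _ => by omega⟩
        · rcases List.mem_cons.1 hd with rfl | hd
          · omega
          · have := h1 d hd; omega
        · have := hq d hd; omega
      · have haeq : a = i.src := by rw [eq_src_iff]; omega
        subst haeq
        have hi : i.1 + 1 < m := by
          by_contra hi
          exact (hA2 (by omega)).1 (by simp)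
        -- The bumped source is matched in the column, necessarily by a target directly below it.
        -- Then `i.src` ejects the source, `i.tgt` ejects the target, and the arrow acts on the
        -- ejected letter.
        have htm : i.tgt ∈ q := by
          have h3 := tgt_mem_of_φ_plus hi (w := p ++ i.src :: q) (by simp) (hA1 hi).1
          simp only [List.mem_append, List.mem_cons, i.src_ne_tgt.symm, false_or] at h3
          refine h3.resolve_left (tgt_not_mem fun d hd => ?_)
          have := hp d hd; omega
        have hqc : IsColumn q := hx.append_cons.2.2.2.2
        obtain ⟨q₁, rfl⟩ : ∃ q₁, q = i.tgt :: q₁ := by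
          rcases q with _ | ⟨d, q⟩
          · simp at htm
          · rcases List.mem_cons.1 htm with rfl | h3
            · exact ⟨q, rfl⟩
            · have h4 := (List.pairwise_cons.1 hqc).1 _ h3
              have h5 := hq d (by simp)
              rw [colOK_iff, htv] at h4
              omega
        have hq₁ : ∀ d ∈ q₁, i.1 + 1 < d.val := by
          intro d hd
          have := (List.pairwise_cons.1 hqc).1 d hd
          rw [colOK_iff, htv] at this
          omega
        have h3 : RowOK i.tgt i.tgt := by rw [rowOK_iff, htv]; omega
        have h4 : p ++ i.src :: i.tgt :: q₁ = (p ++ [i.src]) ++ i.tgt :: q₁ := by simp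
        have h5 : ∀ b ∈ p ++ [i.src], ¬ RowOK i.tgt b := by
          intro b hb
          rcases List.mem_append.1 hb with hb | hb
          · exact h1' b hb
          · rw [List.mem_singleton.1 hb, rowOK_iff, hsv, htv]; omega
        have h6 : bumpWord (p ++ i.src :: i.tgt :: q₁) i.src =
            i.src :: p ++ i.src :: i.tgt :: q₁ :=
          bumpWord_eq (fun b hb => by rw [rowOK_iff]; exact h1 b hb) h2
        have h7 : bumpWord (p ++ i.src :: i.tgt :: q₁) i.tgt =
            i.tgt :: (p ++ [i.src]) ++ i.tgt :: q₁ := by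
          rw [h4]; exact bumpWord_eq h5 h3
        refine ⟨?_, ?_⟩
        · rw [bumpColumn_eq (fun b hb => by rw [rowOK_iff]; exact h1 b hb) h2, h4,
            bumpColumn_eq h5 h3]
          rfl
        · rw [h6, h7]
          refine (listCrystal_f_eq_some_iff i _ _).2 ⟨[], p ++ i.src :: i.tgt :: q₁, by simp,
            by simp, (actsBetween_iff _ _).2 ⟨fun hi => ⟨rfl, ?_⟩, fun _ => by omega,
              fun _ => by omega⟩⟩
          have k1 : (listCrystal m n).ε i p = 0 :=
            listCrystal_ε_eq_zero (tgt_not_mem fun d hd => by have := hp d hd; omega)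
          have k2 : (listCrystal m n).ε i q₁ = 0 :=
            listCrystal_ε_eq_zero (tgt_not_mem fun d hd => by have := hq₁ d hd; omega)
          rw [show p ++ i.src :: i.tgt :: q₁ = p ++ ([i.src] ++ ([i.tgt] ++ q₁)) by simp]
          simp only [append_plus hi, listCrystal_ε_singleton, listCrystal_φ_singleton, k1, k2, hsv,
            htv]
          simp
  · have h3 := bumpColumn_append (r := []) fun b hb => hst b (h1 b hb)
    rw [List.append_nil] at h3
    rw [bumpWord, bumpWord, h2, h3]
    refine ⟨rfl, (listCrystal_f_eq_some_iff i _ _).2 ⟨u, [], by simp, ?_, hA⟩⟩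
    simp [bumpColumn]

theorem bumpWord_f {x x' : List (Letter m n)} {c c' : Letter m n} (hx : IsColumn x)
    (hx' : IsColumn x')
    (h : (listCrystal m n).f i (x ++ [c]) = some (x' ++ [c'])) :
    (bumpColumn x c).2.isSome = (bumpColumn x' c').2.isSome ∧
      (listCrystal m n).f i (bumpWord x c) = some (bumpWord x' c') := by
  obtain ⟨u, y, h1, h2, hA⟩ := (listCrystal_f_eq_some_iff i _ _).1 h
  -- The part after the changed letter is empty exactly when the arrow acts on the letter that
  -- slides in.
  rcases List.eq_nil_or_concat' y with rfl | ⟨y, d, rfl⟩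
  · obtain ⟨rfl, h3⟩ := List.append_inj' h1 rfl
    obtain ⟨rfl, h4⟩ := List.append_inj' h2 rfl
    obtain rfl : c = i.src := by simpa using h3
    obtain rfl : c' = i.tgt := by simpa using h4
    exact bumpWord_f_letter hx hA
  · rw [← List.cons_append, ← List.append_assoc] at h1 h2
    obtain ⟨rfl, h3⟩ := List.append_inj' h1 rfl
    obtain ⟨rfl, h4⟩ := List.append_inj' h2 rfl
    obtain rfl : c = d := by simpa using h3
    obtain rfl : c' = c := by simpa using h4
    exact bumpWord_f_column hx hx' hA

end ColumnBumpArrow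

/-! ### From one column to lists of columns -/

section ColumnLists

variable {m n : ℕ} {i : Node m n}

/-- The operator `f̃_i` acts on the left part of the concatenation of `u` and `v`, if at all. -/
def ActsLeft (i : Node m n) (u v : List (Letter m n)) : Prop :=
  if i.IsOdd then 0 < coroot i ((listCrystal m n).wt u)
  else if 0 < ell i then (listCrystal m n).ε i v < (listCrystal m n).φ i u
  else ¬ (listCrystal m n).ε i u < (listCrystal m n).φ i v

theorem f_append_iff {u v w : List (Letter m n)} :
    (listCrystal m n).f i (u ++ v) = some w ↔
      (ActsLeft i u v ∧ ∃ u', (listCrystal m n).f i u = some u' ∧ u' ++ v = w) ∨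
      (¬ ActsLeft i u v ∧ ∃ v', (listCrystal m n).f i v = some v' ∧ u ++ v' = w) := by
  rw [listCrystal_f_append, Crystal.tensorF]
  unfold ActsLeft
  split_ifs <;> simp [Option.map_map, *]

theorem length_of_f {w w' : List (Letter m n)} (h : (listCrystal m n).f i w = some w') :
    w'.length = w.length := by
  obtain ⟨x, y, rfl, rfl, -⟩ := (listCrystal_f_eq_some_iff i w w').1 h
  simp

/-- The words `u` and `v` have the same weight, and the same strings pass through them. -/
structure SameStrings (u v : List (Letter m n)) : Prop where
  perm : u.Perm v
  ε : ∀ i, (listCrystal m n).ε i u = (listCrystal m n).ε i v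
  φ : ∀ i, (listCrystal m n).φ i u = (listCrystal m n).φ i v

theorem SameStrings.rfl {u : List (Letter m n)} : SameStrings u u :=
  ⟨List.Perm.refl _, fun _ => Eq.refl _, fun _ => Eq.refl _⟩

theorem SameStrings.trans {u v w : List (Letter m n)} (h : SameStrings u v)
    (h' : SameStrings v w) : SameStrings u w :=
  ⟨h.perm.trans h'.perm, fun i => (h.ε i).trans (h'.ε i), fun i => (h.φ i).trans (h'.φ i)⟩

theorem SameStrings.append {u u' v v' : List (Letter m n)} (h : SameStrings u u')
    (h' : SameStrings v v') : SameStrings (u ++ v) (u' ++ v') := by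
  have hw := listCrystal_wt_perm h.perm
  refine ⟨h.perm.append h'.perm, fun i => ?_, fun i => ?_⟩
  · rw [(listCrystal_ε_append i u v).1, (listCrystal_ε_append i u' v').1]
    simp only [Crystal.tensorε, h.ε, h.φ, h'.ε, hw]
    simp only [h'.φ]
  · rw [(listCrystal_ε_append i u v).2, (listCrystal_ε_append i u' v').2]
    simp only [Crystal.tensorφ, h.ε, h.φ, h'.ε, hw]
    simp only [h'.φ]

/-- Replacing a part of a word by one with the same weight and string lengths does not change the
side on which the operator acts; this makes the column-by-column argument possible. -/
theorem SameStrings.actsLeft_iff {u u' v v' : List (Letter m n)} (h : SameStrings u u')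
    (h' : SameStrings v v') : ActsLeft i u v ↔ ActsLeft i u' v' := by
  simp only [ActsLeft, h.ε, h.φ, h'.ε, h'.φ, listCrystal_wt_perm h.perm]

theorem bumpWord_perm (x : List (Letter m n)) (c : Letter m n) :
    (bumpWord x c).Perm (x ++ [c]) := by
  rcases bumpColumn_cases x c with ⟨p, a, q, rfl, h1, h2, -⟩ | ⟨-, h⟩
  · rw [bumpWord_eq h1 h2]
    calc (a :: p ++ c :: q).Perm (a :: c :: (p ++ q)) := by
          rw [List.cons_append]; exact (List.perm_middle).cons a
      _ |>.Perm (c :: a :: (p ++ q)) := List.Perm.swap _ _ _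
      _ |>.Perm (c :: (p ++ a :: q)) := (List.perm_middle.symm).cons c
      _ |>.Perm (p ++ a :: q ++ [c]) := (List.perm_append_singleton _ _).symm
  · rw [bumpWord, h]
    simp

theorem bumpWord_sameStrings {x : List (Letter m n)} (hx : IsColumn x) (c : Letter m n) :
    SameStrings (bumpWord x c) (x ++ [c]) :=
  ⟨bumpWord_perm x c, fun _ => (bumpWord_ε_φ hx c).1, fun _ => (bumpWord_ε_φ hx c).2⟩

/-- The columns read from right to left, each from top to bottom. -/
def columnsWord (ts : List (List (Letter m n))) : List (Letter m n) := ts.reverse.flatten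

@[simp] theorem columnsWord_cons (t : List (Letter m n)) (ts : List (List (Letter m n))) :
    columnsWord (t :: ts) = columnsWord ts ++ t := by
  simp [columnsWord]

theorem length_columnsWord {ts ts' : List (List (Letter m n))}
    (h : ts.map List.length = ts'.map List.length) :
    (columnsWord ts).length = (columnsWord ts').length := by
  simp [columnsWord, List.length_flatten, List.map_reverse, h]

theorem columnsWord_inj {ts ts' : List (List (Letter m n))}
    (h : ts.map List.length = ts'.map List.length) (hw : columnsWord ts = columnsWord ts') :
    ts = ts' := by
  induction ts generalizing ts' with
  | nil => cases ts' with
    | nil => rfl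
    | cons t' ts' => simp at h
  | cons t ts ih => cases ts' with
    | nil => simp at h
    | cons t' ts' =>
      simp only [List.map_cons, List.cons.injEq] at h
      simp only [columnsWord_cons] at hw
      obtain ⟨h1, h2⟩ := List.append_inj hw (length_columnsWord h.2)
      rw [ih h.2 h1, h2]

theorem columnBump_cons (t : List (Letter m n)) (ts : List (List (Letter m n))) (c : Letter m n) :
    ((bumpColumn t c).2 = none ∧ columnBump (t :: ts) c = (bumpColumn t c).1 :: ts ∧
      bumpWord t c = (bumpColumn t c).1) ∨
    ∃ a, (bumpColumn t c).2 = some a ∧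
      columnBump (t :: ts) c = (bumpColumn t c).1 :: columnBump ts a ∧
      bumpWord t c = [a] ++ (bumpColumn t c).1 := by
  cases h : (bumpColumn t c).2 with
  | none => exact Or.inl ⟨rfl, by rw [columnBump, h], by rw [bumpWord, h]; rfl⟩
  | some a => exact Or.inr ⟨a, rfl, by rw [columnBump, h], by rw [bumpWord, h]; rfl⟩

theorem columnBump_sameStrings {ts : List (List (Letter m n))} (h : ∀ t ∈ ts, IsColumn t)
    (c : Letter m n) : SameStrings (columnsWord (columnBump ts c)) (columnsWord ts ++ [c]) := by
  induction ts generalizing c with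
  | nil => exact SameStrings.rfl
  | cons t ts ih =>
    have hb := (SameStrings.rfl (u := columnsWord ts)).append
      (bumpWord_sameStrings (h t (by simp)) c)
    rw [columnsWord_cons, List.append_assoc]
    rcases columnBump_cons t ts c with ⟨-, h1, h2⟩ | ⟨a, -, h1, h2⟩
    · rw [h1, columnsWord_cons, ← h2]
      exact hb
    · rw [h1, columnsWord_cons]
      refine SameStrings.trans ?_ hb
      rw [h2, ← List.append_assoc]
      exact (ih (fun t ht => h t (by simp [ht])) a).append SameStrings.rfl

theorem length_bumpColumn (x : List (Letter m n)) (c : Letter m n) :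
    (bumpColumn x c).1.length = x.length + if (bumpColumn x c).2.isSome then 0 else 1 := by
  rcases bumpColumn_cases x c with ⟨p, a, q, rfl, -, -, h⟩ | ⟨-, h⟩ <;> simp [h]

/-- Column bumping commutes with the operators `f̃_i`. -/
theorem columnBump_f {ts ts' : List (List (Letter m n))} {c c' : Letter m n}
    (h : ∀ t ∈ ts, IsColumn t) (h' : ∀ t ∈ ts', IsColumn t)
    (hl : ts.map List.length = ts'.map List.length)
    (hf : (listCrystal m n).f i (columnsWord ts ++ [c]) = some (columnsWord ts' ++ [c'])) :
    (columnBump ts c).map List.length = (columnBump ts' c').map List.length ∧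
      (listCrystal m n).f i (columnsWord (columnBump ts c)) =
        some (columnsWord (columnBump ts' c')) := by
  induction ts generalizing ts' c c' with
  | nil =>
    cases ts' with
    | nil => exact ⟨rfl, hf⟩
    | cons t' ts' => simp at hl
  | cons t ts ih =>
    cases ts' with
    | nil => simp at hl
    | cons t' ts' =>
      have ht := h t (by simp)
      have hts := fun t ht => h t (List.mem_cons_of_mem _ ht)
      have hts' := fun t ht => h' t (List.mem_cons_of_mem _ ht)
      simp only [List.map_cons, List.cons.injEq] at hl
      simp only [columnsWord_cons, List.append_assoc] at hf
      have hlw := length_columnsWord hl.2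
      have hs := bumpWord_sameStrings ht c
      -- The word splits into the later columns and the first column with `c`. An arrow on the
      -- former does not affect the first slide, and an arrow on the latter is handled by
      -- `bumpWord_f`.
      have key : (bumpColumn t c).2.isSome = (bumpColumn t' c').2.isSome ∧
          (listCrystal m n).f i (columnsWord ts ++ bumpWord t c) =
            some (columnsWord ts' ++ bumpWord t' c') := by
        rcases f_append_iff.1 hf with ⟨hA, u, hu, he⟩ | ⟨hA, v, hv, he⟩
        · obtain ⟨h1, h2⟩ := List.append_inj he ((length_of_f hu).trans hlw)
          obtain ⟨h3, h4⟩ := List.append_inj h2 hl.1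
          rw [← h3, ← (List.cons.inj h4).1, ← h1]
          exact ⟨rfl, f_append_iff.2 (Or.inl
            ⟨(SameStrings.rfl.actsLeft_iff hs).2 hA, u, hu, rfl⟩)⟩
        · obtain ⟨h1, h2⟩ := List.append_inj he hlw
          rw [h2] at hv
          obtain ⟨h3, h4⟩ := bumpWord_f ht (h' t' (by simp)) hv
          exact ⟨h3, f_append_iff.2 (Or.inr
            ⟨fun hA' => hA ((SameStrings.rfl.actsLeft_iff hs).1 hA'), _, h4, by rw [h1]⟩)⟩
      obtain ⟨hsome, hkey⟩ := key
      have hlen : (bumpColumn t c).1.length = (bumpColumn t' c').1.length := by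
        rw [length_bumpColumn, length_bumpColumn, hsome, hl.1]
      rcases columnBump_cons t ts c with ⟨h0, h1, h2⟩ | ⟨a, h0, h1, h2⟩ <;>
        rcases columnBump_cons t' ts' c' with ⟨h0', h1', h2'⟩ | ⟨a', h0', h1', h2'⟩ <;>
        simp only [h0, h0', Option.isSome, Bool.false_eq_true, reduceCtorEq] at hsome
      · rw [h1, h1', columnsWord_cons, columnsWord_cons, ← h2, ← h2']
        exact ⟨by simp [hl.2, h2, h2', hlen], hkey⟩
      · rw [h1, h1', columnsWord_cons, columnsWord_cons]
        rw [h2, h2', ← List.append_assoc, ← List.append_assoc] at hkey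
        have hs' := columnBump_sameStrings hts a
        -- Now the word is cut the other way: later columns together with the ejected letter, to
        -- which the induction hypothesis applies, and the finished first column.
        rcases f_append_iff.1 hkey with ⟨hA, u, hu, he⟩ | ⟨hA, v, hv, he⟩
        · obtain ⟨h3, h4⟩ := List.append_inj' he hlen
          rw [h3] at hu
          obtain ⟨h5, h6⟩ := ih hts hts' hl.2 hu
          refine ⟨by simp [h5, hlen], f_append_iff.2 (Or.inl
            ⟨(hs'.actsLeft_iff SameStrings.rfl).2 hA, _, h6, by rw [h4]⟩)⟩
        · obtain ⟨h3, h4⟩ := List.append_inj' he ((length_of_f hv).trans hlen)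
          obtain ⟨h5, h6⟩ := List.append_inj h3 hlw
          have h7 := columnsWord_inj hl.2 h5
          have h8 := (List.cons.inj h6).1
          rw [← h7, ← h8]
          refine ⟨by simp [hlen], f_append_iff.2 (Or.inr
            ⟨fun hA' => hA ((hs'.actsLeft_iff SameStrings.rfl).1 hA'), _, hv, by rw [h4]⟩)⟩

end ColumnLists

/-! ### Column bumping on semistandard lists of columns, and its inverse -/

section ColumnTableaux

variable {m n : ℕ}

/-- The column `y` may stand to the right of the column `x`. -/
def Adjacent : List (Letter m n) → List (Letter m n) → Prop
  | _, [] => True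
  | [], _ :: _ => False
  | a :: x, b :: y => RowOK a b ∧ Adjacent x y

@[simp] theorem adjacent_nil (x : List (Letter m n)) : Adjacent x [] := by
  cases x <;> trivial

@[simp] theorem not_adjacent_nil_cons (b : Letter m n) (y : List (Letter m n)) :
    ¬ Adjacent [] (b :: y) := id

@[simp] theorem adjacent_cons_cons (a b : Letter m n) (x y : List (Letter m n)) :
    Adjacent (a :: x) (b :: y) ↔ RowOK a b ∧ Adjacent x y := Iff.rfl

theorem RowOK.trans {a b c : Letter m n} (h : RowOK a b) (h' : RowOK b c) : RowOK a c := by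
  rw [rowOK_iff] at *
  omega

theorem rowOK_of_not {a b c : Letter m n} (h : ¬ RowOK c b) (h' : RowOK c a) : RowOK b a := by
  rw [rowOK_iff] at *
  omega

/-- The two conditions are complementary, so a letter passes the entries above its place precisely
because it may stand below them. -/
theorem colOK_iff_not_rowOK {b c : Letter m n} : ColOK b c ↔ ¬ RowOK c b := by
  rw [colOK_iff, rowOK_iff]
  omega

theorem Adjacent.bump_left {x y : List (Letter m n)} (h : Adjacent x y) (c : Letter m n) :
    Adjacent (bumpColumn x c).1 y := by
  induction x generalizing y with
  | nil => cases y with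
    | nil => simp
    | cons b y => exact h.elim
  | cons a x ih => cases y with
    | nil => simp
    | cons b y =>
      rw [bumpColumn]
      split_ifs with hc
      · exact ⟨hc.trans h.1, h.2⟩
      · exact ⟨h.1, ih h.2⟩

/-- The entry to the right of the bumped `a` can be replaced by `a`, so `a` enters the next column
at the same height or higher. Its left neighbour there is `c` or an entry above `c`. -/
theorem Adjacent.bump_bump {x y : List (Letter m n)} (h : Adjacent x y) {a c : Letter m n}
    (ha : (bumpColumn x c).2 = some a) : Adjacent (bumpColumn x c).1 (bumpColumn y a).1 := by
  induction x generalizing y with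
  | nil => simp [bumpColumn] at ha
  | cons b x ih =>
    by_cases hc : RowOK c b
    · simp only [bumpColumn, hc, if_true, Option.some.injEq] at ha ⊢
      subst ha
      cases y with
      | nil => exact ⟨hc, by simp⟩
      | cons d y =>
        simp only [bumpColumn, h.1, if_true]
        exact ⟨hc, h.2⟩
    · simp only [bumpColumn, hc, if_false] at ha ⊢
      have hca : RowOK c a := by
        rcases bumpColumn_cases x c with ⟨p, a', q, rfl, -, h2, h3⟩ | ⟨-, h3⟩
        · rw [h3] at ha
          cases ha
          exact h2
        · rw [h3] at ha
          cases ha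
      have hba := rowOK_of_not hc hca
      cases y with
      | nil => exact ⟨hba, by simp⟩
      | cons d y =>
        by_cases hd : RowOK a d
        · simp only [bumpColumn, hd, if_true]
          exact ⟨hba, h.2.bump_left c⟩
        · simp only [bumpColumn, hd, if_false]
          exact ⟨h.1, ih h.2 ha⟩

theorem mem_of_mem_bumpColumn {x : List (Letter m n)} {b c : Letter m n}
    (h : b ∈ (bumpColumn x c).1) : b = c ∨ b ∈ x := by
  have : b ∈ bumpWord x c := List.mem_append_right _ h
  rw [(bumpWord_perm x c).mem_iff] at this
  simpa [or_comm] using this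

theorem IsColumn.bumpColumn {x : List (Letter m n)} (h : IsColumn x) (c : Letter m n) :
    IsColumn (bumpColumn x c).1 := by
  induction x with
  | nil => simp [GLCrystal.bumpColumn, IsColumn]
  | cons a x ih =>
    obtain ⟨h1, h2⟩ := List.pairwise_cons.1 h
    rw [GLCrystal.bumpColumn]
    split_ifs with hc
    · refine List.pairwise_cons.2 ⟨fun b hb => ?_, h2⟩
      have := h1 b hb
      rw [colOK_iff] at *
      rw [rowOK_iff] at hc
      omega
    · refine List.pairwise_cons.2 ⟨fun b hb => ?_, ih h2⟩
      rcases mem_of_mem_bumpColumn hb with rfl | hb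
      · exact colOK_iff_not_rowOK.2 hc
      · exact h1 b hb

/-- The list of the columns of a semistandard tableau. -/
def IsTableau : List (List (Letter m n)) → Prop
  | [] => True
  | t :: ts => t ≠ [] ∧ IsColumn t ∧ Adjacent t (ts.headD []) ∧ IsTableau ts

theorem IsTableau.isColumn {ts : List (List (Letter m n))} (h : IsTableau ts) :
    ∀ t ∈ ts, IsColumn t := by
  induction ts with
  | nil => simp
  | cons t ts ih => exact List.forall_mem_cons.2 ⟨h.2.1, ih h.2.2.2⟩

theorem bumpColumn_ne_nil (x : List (Letter m n)) (c : Letter m n) : (bumpColumn x c).1 ≠ [] := by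
  rcases bumpColumn_cases x c with ⟨p, a', q, rfl, -, -, h⟩ | ⟨-, h⟩ <;> simp [h]

theorem headD_columnBump (ts : List (List (Letter m n))) (c : Letter m n) :
    (columnBump ts c).headD [] = (bumpColumn (ts.headD []) c).1 := by
  cases ts with
  | nil => rfl
  | cons t ts => rcases columnBump_cons t ts c with ⟨-, h, -⟩ | ⟨a, -, h, -⟩ <;> rw [h] <;> rfl

theorem IsTableau.columnBump {ts : List (List (Letter m n))} (h : IsTableau ts) (c : Letter m n) :
    IsTableau (columnBump ts c) := by
  induction ts generalizing c with
  | nil => exact ⟨by simp, by simp [IsColumn], by simp, trivial⟩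
  | cons t ts ih =>
    obtain ⟨-, h2, h3, h4⟩ := h
    rcases columnBump_cons t ts c with ⟨-, h, -⟩ | ⟨a, ha, h, -⟩ <;> rw [h]
    · exact ⟨bumpColumn_ne_nil t c, h2.bumpColumn c, h3.bump_left c, h4⟩
    · refine ⟨bumpColumn_ne_nil t c, h2.bumpColumn c, ?_, ih h4 a⟩
      rw [headD_columnBump]
      exact h3.bump_bump ha

/-- The length of the column with index `k`, which is zero beyond the last column. -/
def columnLength (ts : List (List (Letter m n))) (k : ℕ) : ℕ := (ts.getD k []).length

@[simp] theorem columnLength_nil (k : ℕ) : columnLength ([] : List (List (Letter m n))) k = 0 := by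
  simp [columnLength]

@[simp] theorem columnLength_cons_zero (t : List (Letter m n)) (ts : List (List (Letter m n))) :
    columnLength (t :: ts) 0 = t.length := rfl

@[simp] theorem columnLength_cons_succ (t : List (Letter m n)) (ts : List (List (Letter m n)))
    (k : ℕ) : columnLength (t :: ts) (k + 1) = columnLength ts k := rfl

theorem columnLength_zero (ts : List (List (Letter m n))) :
    columnLength ts 0 = (ts.headD []).length := by
  cases ts <;> rfl

theorem columnLength_columnBump (ts : List (List (Letter m n))) (c : Letter m n) :
    ∃ j, ∀ k, columnLength (columnBump ts c) k = columnLength ts k + if k = j then 1 else 0 := by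
  induction ts generalizing c with
  | nil =>
    refine ⟨0, fun k => ?_⟩
    cases k <;> simp [columnBump]
  | cons t ts ih =>
    rcases columnBump_cons t ts c with ⟨h0, h, -⟩ | ⟨a, h0, h, -⟩ <;> rw [h]
    · refine ⟨0, fun k => ?_⟩
      cases k <;> simp [length_bumpColumn, h0]
    · obtain ⟨j, hj⟩ := ih a
      refine ⟨j + 1, fun k => ?_⟩
      cases k <;> simp [length_bumpColumn, h0, hj]

/-- A column and the letter that slid into it are determined by the result. -/
theorem bumpColumn_injective {x x' : List (Letter m n)} {c c' : Letter m n} (hx : IsColumn x)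
    (hx' : IsColumn x') (hl : x.length = x'.length) (h : bumpColumn x c = bumpColumn x' c') :
    x = x' ∧ c = c' := by
  induction x generalizing x' with
  | nil =>
    obtain rfl := List.length_eq_zero_iff.1 hl.symm
    simpa [bumpColumn] using h
  | cons a x ih =>
    cases x' with
    | nil => simp at hl
    | cons a' x' =>
      -- If one letter replaces the top and the other goes further down, both ejecting `a`, then
      -- `c'` lies below `a` in the column `a :: x`, while it also may stand left of `a`. These are
      -- contradictory.
      have aux : ∀ {a a' c c' : Letter m n} {x x' : List (Letter m n)}, IsColumn (a :: x) →
          RowOK c a → c = a' → some a = (bumpColumn x' c').2 → x = (bumpColumn x' c').1 →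
          ¬ RowOK c' a' → False := by
        intro a a' c c' x x' hx hc he h1 h2 hc'
        rcases bumpColumn_cases x' c' with ⟨p, b, q, rfl, -, h4, h5⟩ | ⟨-, h5⟩
        · rw [h5] at h1 h2
          cases h1
          have := (List.pairwise_cons.1 hx).1 c' (by simp [h2])
          rw [colOK_iff] at this
          rw [rowOK_iff] at h4 hc
          omega
        · rw [h5] at h1
          cases h1
      obtain ⟨-, hcx⟩ := List.pairwise_cons.1 hx
      obtain ⟨-, hcx'⟩ := List.pairwise_cons.1 hx'
      simp only [List.length_cons, Nat.add_right_cancel_iff] at hl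
      simp only [bumpColumn] at h
      by_cases hc : RowOK c a <;> by_cases hc' : RowOK c' a' <;>
        simp only [hc, hc', if_true, if_false, Prod.mk.injEq, List.cons.injEq,
          Option.some.injEq] at h
      · exact ⟨by rw [h.2, h.1.2], h.1.1⟩
      · exact (aux hx hc h.1.1 h.2 h.1.2 hc').elim
      · exact (aux hx' hc' h.1.1.symm h.2.symm h.1.2.symm hc).elim
      · obtain ⟨h1, h2⟩ := ih hcx hcx' hl (Prod.ext h.1.2 h.2)
        exact ⟨by rw [h.1.1, h1], h2⟩

theorem columnBump_injective {ts ts' : List (List (Letter m n))} {c c' : Letter m n}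
    (hts : IsTableau ts) (hts' : IsTableau ts')
    (hl : ∀ k, columnLength ts k = columnLength ts' k)
    (h : columnBump ts c = columnBump ts' c') : ts = ts' ∧ c = c' := by
  induction ts generalizing ts' c c' with
  | nil =>
    cases ts' with
    | nil => simpa [columnBump] using h
    | cons t' ts' =>
      have := hl 0
      simp only [columnLength_nil, columnLength_cons_zero] at this
      exact (hts'.1 (List.length_eq_zero_iff.1 this.symm)).elim
  | cons t ts ih =>
    cases ts' with
    | nil =>
      have := hl 0
      simp only [columnLength_nil, columnLength_cons_zero] at this
      exact (hts.1 (List.length_eq_zero_iff.1 this)).elim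
    | cons t' ts' =>
      have hl0 : t.length = t'.length := hl 0
      have hl' := fun k => hl (k + 1)
      simp only [columnLength_cons_succ] at hl'
      have h1 : (bumpColumn t c).1 = (bumpColumn t' c').1 := by
        have := congrArg (fun l => List.headD l []) h
        simpa only [headD_columnBump, List.headD_cons] using this
      -- The length of the resulting first column reveals whether a letter was ejected.
      have h2 : (bumpColumn t c).2.isSome = (bumpColumn t' c').2.isSome := by
        have := congrArg List.length h1
        rw [length_bumpColumn, length_bumpColumn, hl0] at this
        cases h3 : (bumpColumn t c).2.isSome <;> cases h4 : (bumpColumn t' c').2.isSome <;>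
          simp [h3, h4] at this ⊢
      have h3 : ts = ts' ∧ (bumpColumn t c).2 = (bumpColumn t' c').2 := by
        rcases columnBump_cons t ts c with ⟨h3, h4, -⟩ | ⟨a, h3, h4, -⟩ <;>
          rcases columnBump_cons t' ts' c' with ⟨h3', h4', -⟩ | ⟨a', h3', h4', -⟩ <;>
          simp only [h3, h3', Option.isSome, Bool.false_eq_true, reduceCtorEq] at h2 <;>
          rw [h4, h4'] at h <;> have h := (List.cons.inj h).2 <;> rw [h3, h3']
        · exact ⟨h, rfl⟩
        · obtain ⟨h5, h6⟩ := ih hts.2.2.2 hts'.2.2.2 hl' h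
          exact ⟨h5, by rw [h6]⟩
      obtain ⟨h4, h5⟩ := bumpColumn_injective hts.2.1 hts'.2.1 hl0 (Prod.ext h1 h3.2)
      exact ⟨by rw [h4, h3.1], h5⟩

theorem Adjacent.exists_rowOK {x y : List (Letter m n)} (h : Adjacent x y) {a : Letter m n}
    (ha : a ∈ y) : ∃ b ∈ x, RowOK b a := by
  induction x generalizing y with
  | nil => cases y with
    | nil => simp at ha
    | cons b y => exact h.elim
  | cons b x ih => cases y with
    | nil => simp at ha
    | cons d y =>
      rcases List.mem_cons.1 ha with rfl | ha
      · exact ⟨b, by simp, h.1⟩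
      · obtain ⟨e, he, h1⟩ := ih h.2 ha
        exact ⟨e, by simp [he], h1⟩

theorem mem_bumpColumn (x : List (Letter m n)) (c : Letter m n) : c ∈ (bumpColumn x c).1 := by
  rcases bumpColumn_cases x c with ⟨p, a, q, rfl, -, -, h⟩ | ⟨-, h⟩ <;> simp [h]

theorem Adjacent.replace {p q y : List (Letter m n)} {a c : Letter m n}
    (h : Adjacent (p ++ c :: q) y) (ha : ∀ b ∈ y, RowOK a b) : Adjacent (p ++ a :: q) y := by
  induction p generalizing y with
  | nil => cases y with
    | nil => simp
    | cons b y => exact ⟨ha b (by simp), h.2⟩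
  | cons d p ih => cases y with
    | nil => simp
    | cons b y => exact ⟨h.1, ih h.2 fun b hb => ha b (by simp [hb])⟩

/-- No entry of `q` may stand left of `a`, so `a` cannot have entered the right column below the
height of `c`. Restoring that column therefore leaves every entry next to `a` large enough. -/
theorem Adjacent.unbump {p q y : List (Letter m n)} {a c : Letter m n} (hy : IsColumn y)
    (h : Adjacent (p ++ c :: q) (bumpColumn y a).1) (hq : ∀ b ∈ q, ¬ RowOK b a) :
    Adjacent (p ++ a :: q) y := by
  induction p generalizing y with
  | nil => cases y with
    | nil => simp
    | cons d y =>
      by_cases hd : RowOK a d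
      · simp only [bumpColumn, hd, if_true] at h
        exact ⟨hd, h.2⟩
      · simp only [bumpColumn, hd, if_false] at h
        obtain ⟨b, hb, h1⟩ := h.2.exists_rowOK (mem_bumpColumn y a)
        exact (hq b hb h1).elim
  | cons b p ih => cases y with
    | nil => simp
    | cons d y =>
      obtain ⟨h1, h2⟩ := List.pairwise_cons.1 hy
      by_cases hd : RowOK a d
      · simp only [bumpColumn, hd, if_true] at h
        refine ⟨h.1.trans hd, Adjacent.replace h.2 fun e he => ?_⟩
        have := h1 e he
        rw [colOK_iff] at this
        rw [rowOK_iff] at hd ⊢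
        omega
      · simp only [bumpColumn, hd, if_false] at h
        exact ⟨h.1, ih h2 h.2⟩

theorem exists_last_rowOK {x : List (Letter m n)} {a : Letter m n} (h : ∃ b ∈ x, RowOK b a) :
    ∃ p c q, x = p ++ c :: q ∧ RowOK c a ∧ ∀ b ∈ q, ¬ RowOK b a := by
  induction x with
  | nil => simp at h
  | cons d x ih =>
    by_cases hx : ∃ b ∈ x, RowOK b a
    · obtain ⟨p, c, q, rfl, h1, h2⟩ := ih hx
      exact ⟨d :: p, c, q, rfl, h1, h2⟩
    · obtain ⟨b, hb, hba⟩ := h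
      push Not at hx
      rcases List.mem_cons.1 hb with rfl | hb
      · exact ⟨[], b, x, rfl, hba, hx⟩
      · exact (hx b hb hba).elim

/-- The inverse of sliding a letter into a column. -/
theorem exists_unbump {x' y : List (Letter m n)} {a : Letter m n} (hx' : IsColumn x')
    (hy : IsColumn y) (h : Adjacent x' (bumpColumn y a).1) :
    ∃ x c, bumpColumn x c = (x', some a) ∧ x ≠ [] ∧ IsColumn x ∧ Adjacent x y := by
  -- The letter to be expelled leftwards is the lowest entry that may stand left of `a`; one exists
  -- because `a` sits in the right column next to such an entry.
  obtain ⟨p, c, q, rfl, h1, h2⟩ := exists_last_rowOK (h.exists_rowOK (mem_bumpColumn y a))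
  obtain ⟨h3, h4, h5, h6, h7⟩ := hx'.append_cons
  refine ⟨p ++ a :: q, c, bumpColumn_eq (fun b hb => colOK_iff_not_rowOK.1 (h3 b hb)) h1,
    by simp, ?_, Adjacent.unbump hy h h2⟩
  refine List.pairwise_append.2 ⟨h6, List.pairwise_cons.2
    ⟨fun b hb => colOK_iff_not_rowOK.2 (h2 b hb), h7⟩, fun b hb d hd => ?_⟩
  rcases List.mem_cons.1 hd with rfl | hd
  · have := h3 b hb
    rw [colOK_iff] at this ⊢
    rw [rowOK_iff] at h1
    omega
  · exact h5 b hb d hd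

theorem Adjacent.of_append {x y : List (Letter m n)} {c : Letter m n} (h : Adjacent (x ++ [c]) y)
    (hl : y.length ≤ x.length) : Adjacent x y := by
  induction x generalizing y with
  | nil =>
    obtain rfl := List.length_eq_zero_iff.1 (Nat.le_zero.1 hl)
    simp
  | cons a x ih => cases y with
    | nil => simp
    | cons b y => exact ⟨h.1, ih h.2 (by simpa using hl)⟩

/-- The inverse of column bumping. -/
theorem exists_columnBump_eq {ts' : List (List (Letter m n))} (h : IsTableau ts') {j : ℕ}
    (hj : columnLength ts' (j + 1) < columnLength ts' j) :
    ∃ ts c, IsTableau ts ∧ columnBump ts c = ts' ∧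
      ∀ k, columnLength ts' k = columnLength ts k + if k = j then 1 else 0 := by
  induction ts' generalizing j with
  | nil => simp at hj
  | cons x' rest ih =>
    obtain ⟨h1, h2, h3, h4⟩ := h
    cases j with
    | zero =>
      simp only [zero_add, columnLength_cons_succ, columnLength_cons_zero] at hj
      -- For a corner in the first column, reverse bumping just removes the bottom letter; the next
      -- column is short enough to remain adjacent.
      obtain ⟨x, c, rfl⟩ := List.eq_nil_or_concat' x' |>.resolve_left h1
      rw [columnLength_zero] at hj
      simp only [List.length_append, List.length_singleton, Nat.lt_succ_iff] at hj
      rcases eq_or_ne x [] with rfl | hx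
      · cases rest with
        | nil =>
          refine ⟨[], c, trivial, rfl, fun k => ?_⟩
          cases k <;> simp
        | cons t rest => exact (h4.1 (List.length_eq_zero_iff.1 (Nat.le_zero.1 hj))).elim
      · obtain ⟨h5, h6, h7⟩ := List.pairwise_append.1 h2
        have hb : bumpColumn x c = (x ++ [c], none) := by
          have := bumpColumn_append (r := []) fun b hb =>
            colOK_iff_not_rowOK.1 (h7 b hb c (by simp))
          simpa [bumpColumn] using this
        refine ⟨x :: rest, c, ⟨hx, h5, h3.of_append hj, h4⟩, ?_, fun k => ?_⟩
        · rw [columnBump, hb]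
        · cases k <;> simp
    | succ j =>
      -- Undoing the bump in the later columns releases `a`, which is then pushed back into the
      -- first column.
      obtain ⟨us, a, h5, rfl, h7⟩ := ih h4 (j := j) hj
      rw [headD_columnBump] at h3
      have hu : IsColumn (us.headD []) := by
        cases us with
        | nil => exact List.Pairwise.nil
        | cons t us => exact h5.2.1
      obtain ⟨x, c, h8, h9, h10, h11⟩ := exists_unbump h2 hu h3
      refine ⟨x :: us, c, ⟨h9, h10, h11, h5⟩, ?_, fun k => ?_⟩
      · rw [columnBump, h8]
      · have h12 := length_bumpColumn x c
        cases k with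
        | zero => simpa [h8] using h12
        | succ k => simp [h7]

end ColumnTableaux

/-! ### Tableaux and their lists of columns -/

section TableauColumns

variable {m n : ℕ} {Y Y' : YoungDiagram}

theorem adjacent_iff {x y : List (Letter m n)} :
    Adjacent x y ↔ ∀ (k : ℕ) (b : Letter m n), y[k]? = some b → ∃ a, x[k]? = some a ∧ RowOK a b := by
  induction x generalizing y with
  | nil => cases y with
    | nil => simp
    | cons b y =>
      simp only [not_adjacent_nil_cons, false_iff, not_forall]
      exact ⟨0, b, rfl, by simp⟩
  | cons a x ih => cases y with
    | nil => simp
    | cons b y =>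
      rw [adjacent_cons_cons, ih]
      constructor
      · rintro ⟨h1, h2⟩ k d hk
        cases k with
        | zero => exact ⟨a, rfl, by simp at hk; rwa [← hk]⟩
        | succ k => exact h2 k d hk
      · intro h
        refine ⟨?_, fun k d hk => h (k + 1) d hk⟩
        obtain ⟨a', h1, h2⟩ := h 0 b rfl
        cases h1
        exact h2

theorem isTableau_of {ts : List (List (Letter m n))} (h : ∀ t ∈ ts, t ≠ [] ∧ IsColumn t)
    (h' : ∀ k, Adjacent (ts.getD k []) (ts.getD (k + 1) [])) : IsTableau ts := by
  induction ts with
  | nil => trivial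
  | cons t ts ih =>
    obtain ⟨h1, h2⟩ := List.forall_mem_cons.1 h
    refine ⟨h1.1, h1.2, ?_, ih h2 fun k => h' (k + 1)⟩
    have := h' 0
    cases ts <;> exact this

theorem IsTableau.adjacent {ts : List (List (Letter m n))} (h : IsTableau ts) (k : ℕ) :
    Adjacent (ts.getD k []) (ts.getD (k + 1) []) := by
  induction ts generalizing k with
  | nil => simp
  | cons t ts ih =>
    cases k with
    | zero =>
      have := h.2.2.1
      cases ts <;> exact this
    | succ k => exact ih h.2.2.2 k

theorem IsTableau.isColumn_getD {ts : List (List (Letter m n))} (h : IsTableau ts) (k : ℕ) :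
    IsColumn (ts.getD k []) := by
  rcases lt_or_ge k ts.length with hk | hk
  · rw [List.getD_eq_getElem _ _ hk]
    exact h.isColumn _ (List.getElem_mem hk)
  · rw [List.getD_eq_default _ _ hk]
    exact List.Pairwise.nil

theorem IsTableau.ext {ts ts' : List (List (Letter m n))} (h : IsTableau ts) (h' : IsTableau ts')
    (he : ∀ k, ts.getD k [] = ts'.getD k []) : ts = ts' := by
  induction ts generalizing ts' with
  | nil => cases ts' with
    | nil => rfl
    | cons t' ts' => exact (h'.1 (he 0).symm).elim
  | cons t ts ih => cases ts' with
    | nil => exact (h.1 (he 0)).elim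
    | cons t' ts' => rw [show t = t' from he 0, ih h.2.2.2 h'.2.2.2 fun k => he (k + 1)]

theorem Tableau.columns_getD (T : Tableau m n Y) (j : ℕ) :
    T.columns.getD j [] = List.ofFn fun i : Fin (Y.colLen j) =>
      T.entry ⟨(i, j), YoungDiagram.mem_iff_lt_colLen.2 i.2⟩ := by
  rcases lt_or_ge j (Y.rowLen 0) with hj | hj
  · rw [List.getD_eq_getElem _ _ (by simpa [Tableau.columns] using hj)]
    simp [Tableau.columns]
  · have h0 : Y.colLen j = 0 := by
      by_contra h
      have := YoungDiagram.mem_iff_lt_colLen.2 (Nat.pos_of_ne_zero h)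
      have := YoungDiagram.mem_iff_lt_rowLen.1 this
      omega
    rw [List.getD_eq_default _ _ (by simpa [Tableau.columns] using hj)]
    refine (List.length_eq_zero_iff.1 ?_).symm
    simp [h0]

theorem Tableau.columnLength_columns (T : Tableau m n Y) (j : ℕ) :
    columnLength T.columns j = Y.colLen j := by
  rw [columnLength, T.columns_getD]
  simp

theorem Tableau.columns_eq_some_iff (T : Tableau m n Y) (i j : ℕ) (a : Letter m n) :
    (T.columns.getD j [])[i]? = some a ↔ ∃ h : (i, j) ∈ Y, T.entry ⟨(i, j), h⟩ = a := by
  rw [T.columns_getD, List.getElem?_ofFn]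
  by_cases h : i < Y.colLen j
  · simp [h, YoungDiagram.mem_iff_lt_colLen]
  · simp [h, YoungDiagram.mem_iff_lt_colLen]

theorem Tableau.isTableau_columns (T : Tableau m n Y) : IsTableau T.columns := by
  refine isTableau_of (fun t ht => ?_) fun j => adjacent_iff.2 fun i b hb => ?_
  · obtain ⟨j, rfl⟩ := List.mem_ofFn.1 ht
    constructor
    · intro h
      have h1 := congrArg List.length h
      have h2 := YoungDiagram.mem_iff_lt_colLen.1 (YoungDiagram.mem_iff_lt_rowLen.2 j.2)
      simp only [List.length_ofFn, List.length_nil] at h1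
      omega
    · exact List.pairwise_ofFn.2 fun i i' hi => T.col_ok _ _ rfl hi
  · rw [T.columns_eq_some_iff] at hb
    obtain ⟨hb, rfl⟩ := hb
    have ha := Y.up_left_mem le_rfl (Nat.le_succ j) hb
    exact ⟨T.entry ⟨(i, j), ha⟩, (T.columns_eq_some_iff i j _).2 ⟨ha, rfl⟩,
      T.row_ok _ _ rfl (Nat.lt_succ_self j)⟩

theorem YoungDiagram.ext_colLen (h : ∀ j, Y.colLen j = Y'.colLen j) : Y = Y' := by
  refine SetLike.ext fun c => ?_
  rw [YoungDiagram.mem_iff_lt_colLen, YoungDiagram.mem_iff_lt_colLen, h]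

theorem Tableau.columns_injective {T T' : Tableau m n Y} (h : T.columns = T'.columns) : T = T' := by
  refine Tableau.ext (funext fun β => ?_)
  have h1 := (T.columns_eq_some_iff β.1.1 β.1.2 (T.entry β)).2 ⟨β.2, rfl⟩
  rw [h, T'.columns_eq_some_iff] at h1
  exact h1.2.symm

theorem Tableau.shape_eq {T : Tableau m n Y} {T' : Tableau m n Y'} (h : T.columns = T'.columns) :
    Y = Y' :=
  YoungDiagram.ext_colLen fun j => by
    rw [← T.columnLength_columns, h, T'.columnLength_columns]

theorem IsTableau.columnLength_antitone {ts : List (List (Letter m n))} (h : IsTableau ts) :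
    Antitone (columnLength ts) := by
  refine antitone_nat_of_succ_le fun k => ?_
  by_contra hk
  push Not at hk
  obtain ⟨a, ha, -⟩ := adjacent_iff.1 (h.adjacent k) _ _ (List.getElem?_eq_getElem hk)
  have := (List.getElem?_eq_some_iff.1 ha).1
  exact lt_irrefl _ this

theorem IsTableau.exists_shape {ts : List (List (Letter m n))} (h : IsTableau ts) :
    ∃ Y : YoungDiagram, ∀ i j, (i, j) ∈ Y ↔ i < columnLength ts j := by
  have hz : ∀ j, ts.length ≤ j → columnLength ts j = 0 := fun j hj => by
    rw [columnLength, List.getD_eq_default _ _ hj, List.length_nil]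
  refine ⟨⟨(Finset.range (columnLength ts 0) ×ˢ Finset.range ts.length).filter
    fun c => c.1 < columnLength ts c.2, ?_⟩, fun i j => ?_⟩
  · rintro ⟨i, j⟩ ⟨i', j'⟩ ⟨hi, hj⟩ hc
    simp only [Finset.coe_filter, Finset.mem_product, Finset.mem_range, Set.mem_ofPred_eq] at hc ⊢
    simp only at hi hj
    have := h.columnLength_antitone hj
    omega
  · rw [← YoungDiagram.mem_cells]
    simp only [Finset.mem_filter, Finset.mem_product, Finset.mem_range, and_iff_right_iff_imp]
    intro hi
    have h1 := h.columnLength_antitone (Nat.zero_le j)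
    refine ⟨by omega, ?_⟩
    by_contra hj
    have := hz j (by omega)
    omega

/-- The columns of a tableau form a tableau. -/
theorem IsTableau.exists_tableau {ts : List (List (Letter m n))} (h : IsTableau ts) :
    ∃ (Y : YoungDiagram) (T : Tableau m n Y), T.columns = ts := by
  obtain ⟨Y, hY⟩ := h.exists_shape
  have hlt : ∀ β : Box Y, β.1.1 < (ts.getD β.1.2 []).length := fun β => (hY _ _).1 β.2
  let e : Box Y → Letter m n := fun β => (ts.getD β.1.2 [])[β.1.1]'(hlt β)
  have he : ∀ i j (hb : (i, j) ∈ Y), (ts.getD j [])[i]? = some (e ⟨(i, j), hb⟩) :=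
    fun i j hb => List.getElem?_eq_getElem _
  have hrow : ∀ d i j (hb : (i, j) ∈ Y) (hb' : (i, j + d + 1) ∈ Y),
      RowOK (e ⟨(i, j), hb⟩) (e ⟨(i, j + d + 1), hb'⟩) := by
    intro d
    induction d with
    | zero =>
      intro i j hb hb'
      obtain ⟨a, h1, h2⟩ := adjacent_iff.1 (h.adjacent j) i _ (he i (j + 1) hb')
      rw [he i j hb] at h1
      cases h1
      exact h2
    | succ d ih =>
      intro i j hb hb'
      have hb2 := Y.up_left_mem (le_refl i) (Nat.le_succ (j + d + 1)) hb'
      refine (ih i j hb hb2).trans ?_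
      obtain ⟨a, h1, h2⟩ := adjacent_iff.1 (h.adjacent (j + d + 1)) i _ (he i _ hb')
      rw [he i _ hb2] at h1
      cases h1
      exact h2
  refine ⟨Y, ⟨e, ?_, ?_⟩, ?_⟩
  · rintro ⟨⟨i, j⟩, hb⟩ ⟨⟨i', j'⟩, hb'⟩ hi hj
    simp only at hi hj
    subst hi
    obtain ⟨d, rfl⟩ := Nat.exists_eq_add_of_lt hj
    exact hrow d i j hb hb'
  · rintro ⟨⟨i, j⟩, hb⟩ ⟨⟨i', j'⟩, hb'⟩ hj hi
    simp only at hi hj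
    subst hj
    exact List.pairwise_iff_getElem.1 (h.isColumn_getD j) i i' _ _ hi
  · refine IsTableau.ext (Tableau.isTableau_columns _) h fun j => List.ext_getElem? fun i =>
      Option.ext fun a => ?_
    rw [Tableau.columns_eq_some_iff]
    constructor
    · rintro ⟨hb, rfl⟩
      exact he i j hb
    · intro ha
      have hb := (hY i j).2 (List.getElem?_eq_some_iff.1 ha).1
      rw [he i j hb] at ha
      exact ⟨hb, Option.some.inj ha⟩

/-- The boxes of a diagram, column by column from right to left, each from top to bottom. -/
def columnBoxes (Y : YoungDiagram) : List (Box Y) :=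
  (List.ofFn fun j : Fin (Y.rowLen 0) =>
    List.ofFn fun i : Fin (Y.colLen j) =>
      (⟨(i, j), YoungDiagram.mem_iff_lt_colLen.2 i.2⟩ : Box Y)).reverse.flatten

theorem Tableau.word_columnBoxes (T : Tableau m n Y) :
    T.word (columnBoxes Y) = columnsWord T.columns := by
  simp only [Tableau.word, columnBoxes, columnsWord, Tableau.columns, List.map_flatten,
    List.map_reverse, List.map_ofFn, Function.comp_def]

theorem isReading_columnBoxes (Y : YoungDiagram) : IsReading (columnBoxes Y) := by
  have key : (columnBoxes Y).Pairwise fun p q => p ≠ q ∧ ¬ StrictlyHigher q p := by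
    rw [columnBoxes, List.pairwise_flatten]
    constructor
    · intro l hl
      rw [List.mem_reverse, List.mem_ofFn] at hl
      obtain ⟨j, rfl⟩ := hl
      refine List.pairwise_ofFn.2 fun i i' hi => ⟨fun h => ?_, fun h => ?_⟩
      · have := congrArg (fun β : Box Y => β.1.1) h
        simp only at this
        omega
      · have := h.2.1
        simp only at this
        omega
    · rw [List.pairwise_reverse]
      refine List.pairwise_ofFn.2 fun j j' hj x hx y hy => ?_
      obtain ⟨i, rfl⟩ := List.mem_ofFn.1 hx
      obtain ⟨i', rfl⟩ := List.mem_ofFn.1 hy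
      refine ⟨fun h => ?_, fun h => ?_⟩
      · have := congrArg (fun β : Box Y => β.1.2) h
        simp only at this
        omega
      · have := h.2.2
        simp only at this
        omega
  refine ⟨key.imp fun h => h.1, fun β => ?_, key.imp fun h => h.2⟩
  have h1 := YoungDiagram.mem_iff_lt_colLen.1 β.2
  have h2 := YoungDiagram.mem_iff_lt_rowLen.1
    (Y.up_left_mem (Nat.zero_le β.1.1) (le_refl β.1.2) β.2)
  rw [columnBoxes, List.mem_flatten]
  refine ⟨_, List.mem_reverse.2 (List.mem_ofFn.2 ⟨⟨β.1.2, h2⟩, rfl⟩),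
    List.mem_ofFn.2 ⟨⟨β.1.1, h1⟩, rfl⟩⟩

/-- Column lengths determine a diagram, and they are the data that column bumping controls. -/
theorem addsBox_iff : AddsBox Y Y' ↔ ∃ j, ∀ k, Y'.colLen k = Y.colLen k + if k = j then 1 else 0 := by
  constructor
  · rintro ⟨⟨i, j⟩, hc, h⟩
    have hmem : ∀ i' k, i' < Y'.colLen k ↔ (i' = i ∧ k = j) ∨ i' < Y.colLen k := by
      intro i' k
      rw [← YoungDiagram.mem_iff_lt_colLen, ← YoungDiagram.mem_iff_lt_colLen,
        ← YoungDiagram.mem_cells, h]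
      simp
    rw [YoungDiagram.mem_iff_lt_colLen] at hc
    refine ⟨j, fun k => ?_⟩
    have h1 := hmem (Y.colLen k) k
    have h2 := hmem (Y'.colLen k) k
    split_ifs with hk
    · subst hk
      have h3 := hmem i k
      have h4 := hmem (i - 1) k
      have h5 := hmem (Y.colLen k + 1) k
      have h6 := hmem (Y'.colLen k - 1) k
      omega
    · omega
  · rintro ⟨j, h⟩
    refine ⟨(Y.colLen j, j), ?_, ?_⟩
    · rw [YoungDiagram.mem_iff_lt_colLen]
      simp
    · ext ⟨i, k⟩
      have := h k
      simp only [YoungDiagram.mem_cells, Finset.mem_insert, YoungDiagram.mem_iff_lt_colLen,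
        Prod.mk.injEq]
      split_ifs at this with hk
      · subst hk; omega
      · omega

end TableauColumns

/-! ### Column bumping as an isomorphism of crystals -/

section BumpIso

variable {m n : ℕ} {Y Y' : YoungDiagram} {i : Node m n}

/-- A bijection that preserves the weights and commutes with the `f̃_i` is an isomorphism. -/
def Crystal.Iso.ofEquiv {X Z : Type} {C : Crystal m n X} {D : Crystal m n Z} (g : X ≃ Z)
    (wt_map : ∀ x, D.wt (g x) = C.wt x) (f_map : ∀ i x, D.f i (g x) = (C.f i x).map g) :
    Crystal.Iso C D where
  toEquiv := g
  wt_map := wt_map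
  e_map i x := Option.ext fun z => by
    obtain ⟨y, rfl⟩ := g.surjective z
    have h := f_map i y
    simp only [Equiv.toFun_as_coe, Option.map_eq_some_iff, g.injective.eq_iff, exists_eq_right]
    rw [← D.f_eq_some, ← C.f_eq_some, h]
    simp
  f_map := f_map

/-- The length of a string is the number of its arrows, and the arrows are the same for all
readings. Hence the column reading may replace the chosen one. -/
theorem Tableau.word_φ_congr {l l' : List (Box Y)} (hl : IsReading l) (hl' : IsReading l')
    (T : Tableau m n Y) :
    (listCrystal m n).φ i (T.word l) = (listCrystal m n).φ i (T.word l') := by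
  generalize hk : (listCrystal m n).φ i (T.word l) = k
  induction k generalizing T with
  | zero =>
    by_contra h
    obtain ⟨w, hw⟩ := Option.ne_none_iff_exists'.1
      (((listCrystal m n).f_eq_none i (T.word l')).not.2 (Ne.symm h))
    obtain ⟨T', rfl⟩ := T.exists_of_f_word hl' hw
    have := (listCrystal m n).φ_f _ _ _ (Tableau.f_word_congr hl' hl hw)
    omega
  | succ k ih =>
    obtain ⟨w, hw⟩ := Option.ne_none_iff_exists'.1
      (((listCrystal m n).f_eq_none i (T.word l)).not.2 (by omega))
    obtain ⟨T', rfl⟩ := T.exists_of_f_word hl hw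
    have h1 := (listCrystal m n).φ_f _ _ _ hw
    have h2 := (listCrystal m n).φ_f _ _ _ (Tableau.f_word_congr hl hl' hw)
    rw [h2, ← ih T' (by omega)]

theorem Tableau.word_ε_congr {l l' : List (Box Y)} (hl : IsReading l) (hl' : IsReading l')
    (T : Tableau m n Y) :
    (listCrystal m n).ε i (T.word l) = (listCrystal m n).ε i (T.word l') := by
  generalize hk : (listCrystal m n).ε i (T.word l) = k
  induction k generalizing T with
  | zero =>
    by_contra h
    obtain ⟨w, hw⟩ := Option.ne_none_iff_exists'.1
      (((listCrystal m n).e_eq_none i (T.word l')).not.2 (Ne.symm h))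
    rw [← (listCrystal m n).f_eq_some] at hw
    obtain ⟨T', rfl⟩ := T.exists_of_e_word hl' hw
    have := (listCrystal m n).ε_f (Tableau.f_word_congr hl' hl hw)
    omega
  | succ k ih =>
    obtain ⟨w, hw⟩ := Option.ne_none_iff_exists'.1
      (((listCrystal m n).e_eq_none i (T.word l)).not.2 (by omega))
    rw [← (listCrystal m n).f_eq_some] at hw
    obtain ⟨T', rfl⟩ := T.exists_of_e_word hl hw
    have h1 := (listCrystal m n).ε_f hw
    have h2 := (listCrystal m n).ε_f (Tableau.f_word_congr hl hl' hw)
    rw [h2, ← ih T' (by omega)]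

theorem Tableau.word_sameStrings (r : AdmissibleReading Y) (T : Tableau m n Y) :
    SameStrings (T.word (List.ofFn r.box)) (columnsWord T.columns) := by
  rw [← T.word_columnBoxes]
  have h1 := r.isReading
  have h2 := isReading_columnBoxes Y
  exact ⟨((List.perm_ext_iff_of_nodup h1.nodup h2.nodup).2 fun β => by simp [h1.mem, h2.mem]).map _,
    fun i => T.word_ε_congr h1 h2, fun i => T.word_φ_congr h1 h2⟩

variable (r : AdmissibleReading Y) (hst : r.Stable m n)

theorem tableauCrystal_wt (T : Tableau m n Y) :
    (tableauCrystal r hst).wt T = (listCrystal m n).wt (columnsWord T.columns) := by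
  rw [← listCrystal_wt_perm (T.word_sameStrings r).perm, ← r.ofFn_word, listCrystal_wt_ofFn]
  rfl

theorem tableauCrystal_ε (T : Tableau m n Y) :
    (tableauCrystal r hst).ε i T = (listCrystal m n).ε i (columnsWord T.columns) := by
  rw [← (T.word_sameStrings r).ε, ← r.ofFn_word, listCrystal_ε_ofFn]
  rfl

theorem tableauCrystal_φ (T : Tableau m n Y) :
    (tableauCrystal r hst).φ i T = (listCrystal m n).φ i (columnsWord T.columns) := by
  rw [← (T.word_sameStrings r).φ, ← r.ofFn_word, listCrystal_φ_ofFn]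
  rfl

theorem tableauCrystal_f {T T' : Tableau m n Y} :
    (tableauCrystal r hst).f i T = some T' ↔
      (listCrystal m n).f i (columnsWord T.columns) = some (columnsWord T'.columns) := by
  rw [tableauCrystal_f_iff, ← T.word_columnBoxes, ← T'.word_columnBoxes]
  exact ⟨Tableau.f_word_congr r.isReading (isReading_columnBoxes Y),
    Tableau.f_word_congr (isReading_columnBoxes Y) r.isReading⟩

theorem listCrystal_singleton (c : Letter m n) :
    (listCrystal m n).wt [c] = (letterCrystal m n).wt c ∧
    (∀ i, (listCrystal m n).ε i [c] = (letterCrystal m n).ε i c) ∧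
    (∀ i, (listCrystal m n).φ i [c] = (letterCrystal m n).φ i c) := by
  refine ⟨?_, fun i => ?_, fun i => ?_⟩
  · rw [listCrystal_wt_cons, listCrystal_wt_nil, add_zero]
  · simp only [listCrystal_ε_singleton, letterCrystal_ε, eq_tgt_iff]
  · simp only [listCrystal_φ_singleton, letterCrystal_φ, eq_src_iff]

theorem listCrystal_f_singleton {c c' : Letter m n} (h : (letterCrystal m n).f i c = some c') :
    (listCrystal m n).f i [c] = some [c'] := by
  rw [letterCrystal_f] at h
  split_ifs at h with hc
  cases h
  subst hc
  exact (listCrystal_f_eq_some_iff i _ _).2 ⟨[], [], rfl, rfl, (actsBetween_iff _ _).2 (by simp)⟩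

theorem tensor_wt (T : Tableau m n Y) (c : Letter m n) :
    ((tableauCrystal r hst).tensor (letterCrystal m n)).wt (T, c) =
      (listCrystal m n).wt (columnsWord T.columns ++ [c]) := by
  rw [listCrystal_wt_append, (listCrystal_singleton c).1, ← tableauCrystal_wt r hst]
  rfl

theorem tensor_φ (T : Tableau m n Y) (c : Letter m n) :
    ((tableauCrystal r hst).tensor (letterCrystal m n)).φ i (T, c) =
      (listCrystal m n).φ i (columnsWord T.columns ++ [c]) := by
  obtain ⟨-, h2, h3⟩ := listCrystal_singleton c
  rw [(listCrystal_ε_append i _ _).2]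
  simp only [Crystal.tensor, Crystal.tensorφ, tableauCrystal_wt, tableauCrystal_ε,
    tableauCrystal_φ, h2, h3]

/-- The tensor rule for `T ⊗ c` consults only weights and string lengths of the two factors. These
agree with those of the column word and of the one-letter word. -/
theorem tensor_f {T T' : Tableau m n Y} {c c' : Letter m n}
    (h : ((tableauCrystal r hst).tensor (letterCrystal m n)).f i (T, c) = some (T', c')) :
    (listCrystal m n).f i (columnsWord T.columns ++ [c]) =
      some (columnsWord T'.columns ++ [c']) := by
  obtain ⟨-, h2, h3⟩ := listCrystal_singleton c
  rw [f_append_iff]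
  simp only [ActsLeft, h2, h3, ← tableauCrystal_wt r hst, ← tableauCrystal_ε r hst,
    ← tableauCrystal_φ r hst]
  simp only [Crystal.tensor, Crystal.tensorF] at h
  split_ifs at h ⊢ <;> obtain ⟨a, ha, he⟩ := Option.map_eq_some_iff.1 h <;> cases he <;>
    first
    | exact Or.inl ⟨‹_›, _, (tableauCrystal_f r hst).1 ha, rfl⟩
    | exact Or.inr ⟨‹_›, _, listCrystal_f_singleton ha, rfl⟩
    | exact Or.inr ⟨not_not.2 ‹_›, _, listCrystal_f_singleton ha, rfl⟩

/-- Column bumping adds a box to the shape of the tableau. -/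
theorem exists_bump (T : Tableau m n Y) (c : Letter m n) :
    ∃ p : Σ Y' : HookExtension m n Y, Tableau m n Y'.1, p.2.columns = columnBump T.columns c := by
  obtain ⟨Y', T', h⟩ := (T.isTableau_columns.columnBump c).exists_tableau
  obtain ⟨j, hj⟩ := columnLength_columnBump T.columns c
  -- The enlarged diagram is a hook diagram because it carries a semistandard tableau.
  refine ⟨⟨⟨Y', T'.isFilling.isHook, addsBox_iff.2 ⟨j, fun k => ?_⟩⟩, T'⟩, h⟩
  rw [← T'.columnLength_columns, h, hj, T.columnLength_columns]

theorem sigma_columns_injective {p q : Σ Y' : HookExtension m n Y, Tableau m n Y'.1}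
    (h : p.2.columns = q.2.columns) : p = q := by
  obtain ⟨⟨Y₁, h₁⟩, T₁⟩ := p
  obtain ⟨⟨Y₂, h₂⟩, T₂⟩ := q
  obtain rfl : Y₁ = Y₂ := Tableau.shape_eq h
  rw [Tableau.columns_injective (T := T₁) (T' := T₂) h]

/-- The added box is a corner of the larger diagram, and reverse bumping from its column restores
the original shape. -/
theorem exists_eq_columnBump (p : Σ Y' : HookExtension m n Y, Tableau m n Y'.1) :
    ∃ (T : Tableau m n Y) (c : Letter m n), p.2.columns = columnBump T.columns c := by
  obtain ⟨⟨Y', h, h'⟩, T'⟩ := p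
  obtain ⟨j, hj⟩ := addsBox_iff.1 h'
  have hlt : columnLength T'.columns (j + 1) < columnLength T'.columns j := by
    have h1 := hj j
    have h2 := hj (j + 1)
    have h3 := Y.colLen_anti j (j + 1) (Nat.le_succ j)
    rw [if_pos rfl] at h1
    rw [if_neg (by omega)] at h2
    rw [T'.columnLength_columns, T'.columnLength_columns]
    simp only
    omega
  obtain ⟨ts, c, h1, h2, h3⟩ := exists_columnBump_eq T'.isTableau_columns hlt
  obtain ⟨Y₁, T, rfl⟩ := h1.exists_tableau
  obtain rfl : Y₁ = Y := YoungDiagram.ext_colLen fun k => by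
    have h4 := h3 k
    rw [T'.columnLength_columns, hj, T.columnLength_columns] at h4
    omega
  exact ⟨T, c, h2.symm⟩

/-- Column bumping as a bijection. -/
noncomputable def bumpEquiv (m n : ℕ) (Y : YoungDiagram) :
    Tableau m n Y × Letter m n ≃ Σ Y' : HookExtension m n Y, Tableau m n Y'.1 :=
  Equiv.ofBijective (fun p => (exists_bump p.1 p.2).choose) <| by
    constructor
    · rintro ⟨T, c⟩ ⟨T', c'⟩ h
      have h1 := (exists_bump T c).choose_spec
      have h2 := (exists_bump T' c').choose_spec
      simp only at h
      rw [h, h2] at h1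
      obtain ⟨h3, rfl⟩ := columnBump_injective T'.isTableau_columns T.isTableau_columns
        (fun k => by rw [T.columnLength_columns, T'.columnLength_columns]) h1
      rw [Tableau.columns_injective h3]
    · intro p
      obtain ⟨T, c, h⟩ := exists_eq_columnBump p
      exact ⟨(T, c), sigma_columns_injective ((exists_bump T c).choose_spec.trans h.symm)⟩

theorem bumpEquiv_columns (T : Tableau m n Y) (c : Letter m n) :
    (bumpEquiv m n Y (T, c)).2.columns = columnBump T.columns c :=
  (exists_bump T c).choose_spec

/-- Equal column lengths put both tableaux into the same summand, so an arrow between the words is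
an arrow of the direct sum. -/
theorem directSum_f {r : ∀ Y : YoungDiagram, AdmissibleReading Y}
    (hst : ∀ Y : YoungDiagram, (r Y).Stable m n)
    {p q : Σ Y' : HookExtension m n Y, Tableau m n Y'.1}
    (hl : p.2.columns.map List.length = q.2.columns.map List.length)
    (h : (listCrystal m n).f i (columnsWord p.2.columns) = some (columnsWord q.2.columns)) :
    (Crystal.directSum fun Y' : HookExtension m n Y =>
      tableauCrystal (r Y'.1) (hst Y'.1)).f i p = some q := by
  obtain ⟨⟨Y₁, h₁⟩, T₁⟩ := p
  obtain ⟨⟨Y₂, h₂⟩, T₂⟩ := q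
  obtain rfl : Y₁ = Y₂ := YoungDiagram.ext_colLen fun j => by
    rw [← T₁.columnLength_columns, ← T₂.columnLength_columns, columnLength, columnLength]
    have := congrArg (fun l => List.getD l j 0) hl
    rw [← List.length_nil (α := Letter m n), List.getD_map, List.getD_map] at this
    exact this
  have := (tableauCrystal_f (r Y₁) (hst Y₁)).2 h
  simp only [Crystal.directSum, this, Option.map_some]

/-- Column bumping is an isomorphism of crystals. -/
noncomputable def bumpIso (Y : YoungDiagram) (r : ∀ Y : YoungDiagram, AdmissibleReading Y)
    (hst : ∀ Y : YoungDiagram, (r Y).Stable m n) :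
    Crystal.Iso ((tableauCrystal (r Y) (hst Y)).tensor (letterCrystal m n))
      (Crystal.directSum fun Y' : HookExtension m n Y => tableauCrystal (r Y'.1) (hst Y'.1)) :=
  Crystal.Iso.ofEquiv (bumpEquiv m n Y)
    (by
      rintro ⟨T, c⟩
      rw [tensor_wt, ← listCrystal_wt_perm
        (columnBump_sameStrings T.isTableau_columns.isColumn c).perm, ← bumpEquiv_columns]
      exact tableauCrystal_wt _ (hst _) _)
    (by
      rintro i ⟨T, c⟩
      cases h : ((tableauCrystal (r Y) (hst Y)).tensor (letterCrystal m n)).f i (T, c) with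
      | none =>
        -- The commutation lemma transports only arrows that exist. Where `f̃_i` gives `0`, equality
        -- of `φ` shows that it gives `0` after bumping too.
        rw [Crystal.f_eq_none, tensor_φ, ← (columnBump_sameStrings
          T.isTableau_columns.isColumn c).φ, ← bumpEquiv_columns] at h
        rw [Option.map_none, Crystal.f_eq_none]
        exact (tableauCrystal_φ _ (hst _) _).trans h
      | some y =>
        obtain ⟨T', c'⟩ := y
        have hl : T.columns.map List.length = T'.columns.map List.length := by
          simp [Tableau.columns, List.map_ofFn, Function.comp_def]
        obtain ⟨h1, h2⟩ := columnBump_f T.isTableau_columns.isColumn T'.isTableau_columns.isColumn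
          hl (tensor_f _ _ h)
        rw [← bumpEquiv_columns, ← bumpEquiv_columns] at h1 h2
        exact directSum_f hst h1 h2)

end BumpIso

end GLCrystal

theorem mainTheorem5 (m n : ℕ) (Y₀ : YoungDiagram) (hY₀ : GLCrystal.IsHook m n Y₀)
    (r : ∀ Y : YoungDiagram, GLCrystal.AdmissibleReading Y) :
    ∃ hst : ∀ Y : YoungDiagram, (r Y).Stable m n,
      (∀ Y : GLCrystal.HookExtension m n Y₀,
        (GLCrystal.tableauCrystal (r Y.1) (hst Y.1)).Connected) ∧
      ∃ Φ : GLCrystal.Crystal.Iso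
          ((GLCrystal.tableauCrystal (r Y₀) (hst Y₀)).tensor (GLCrystal.letterCrystal m n))
          (GLCrystal.Crystal.directSum fun Y : GLCrystal.HookExtension m n Y₀ =>
            GLCrystal.tableauCrystal (r Y.1) (hst Y.1)),
        ∀ (T : GLCrystal.Tableau m n Y₀) (c : GLCrystal.Letter m n),
          (Φ.toEquiv (T, c)).2.columns = GLCrystal.columnBump T.columns c :=
  ⟨fun Y => (r Y).stable m n,
    fun Y => GLCrystal.tableauCrystal_connected (r Y.1) ((r Y.1).stable m n) Y.2.1,
    GLCrystal.bumpIso Y₀ r fun Y => (r Y).stable m n,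
    fun T c => GLCrystal.bumpEquiv_columns T c⟩
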